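/- Fix integers $d,n\ge 1$, corruption rates $\boldsymbol\lambda=(\lambda_1,\dots,\lambda_n)\in[0,1]^n$, a symmetric positive definite matrix $\Sigma\in\mathbb R^{d\times d}$ and $\sigma>0$. For $\beta\in\mathbb R^d$ let $P_\beta$ be the law of $(W,Y)\in\mathbb R^{d}\times\mathbb R$ with $W\sim\mathcal N(0,\Sigma)$ and $Y\mid W\sim\mathcal N(W^\top\beta,\sigma^2)$. A $\boldsymbol\lambda$-contaminated sample $\mathbf Z=(Z_1,\dots,Z_n)$ from $P_\beta$, written $\mathbf Z\sim_{\boldsymbol\lambda}P_\beta$, is $Z_i=(1-B_i)X_i+B_i\tilde X_i$, where $X_1,\dots,X_n$ are i.i.d. from $P_\beta$, the $B_i\sim\mathrm{Bern}(\lambda_i)$ are independent of each other and of the $X_i$, and the outliers $(\tilde X_1,\dots,\tilde X_n)\in(\mathbb R^{d}\times\mathbb R)^n$ are drawn from an arbitrary joint distribution (the adversary) conditionally on $(X_i)_{i\le n}$ and $(B_i)_{i\le n}$. Write $\|x\|_\Sigma^2=x^\top\Sigma x$ and $$L_{\mathsf{reg}}(\boldsymbol\lambda)=\inf\Big\{r\ge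 0:\ \inf_M\ \sup_{\beta,\ \text{adversary}}\ \Pr_{\mathbf Z\sim_{\boldsymbol\lambda}P_\beta}\big[\|M(\mathbf Z)-\beta\|_\Sigma^2>r\big]\le \tfrac15\Big\},$$ where $M$ ranges over all (measurable) estimators $(\mathbb R^d\times\mathbb R)^n\to\mathbb R^d$ and the supremum is over all $\beta\in\mathbb R^d$ and all adversaries. Let $N(t)=|\{i:\lambda_i\le t\}|$ and $$f(\boldsymbol\lambda,d)=\min_{t\in[0,1]}\Big(\frac d{N(t)}+t^2\Big),\qquad \frac d0:=\infty .$$ For $w\in\mathbb R_{\ge0}^n$ and data $Z_i=(\hat W_i,\hat Y_i)$ the weighted regression depth of $\eta\in\mathbb R^d$ is $$D_w(\eta,\mathbf Z)=\min_{\|v\|_2=1}\sum_{i=1}^n w_i\,\mathbb 1\{(\hat Y_i-\eta^\top\hat W_i)(v^\top\hat W_i)\ge 0\}.$$ **Theorem.** There are universal constants $c,C_1,C_2>0$ such that for all $d,n,\boldsymbol\lambda,\Sigma,\sigma$ as above with $f(\boldsymbol\lambda,d)\le c$, $$C_1\,\frac{\sigma^2}{\sqrt d}\,f(\boldsymbol\lambda,d)\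 \le\ L_{\mathsf{reg}}(\boldsymbol\lambda)\ \le\ C_2\,\sigma^2 f(\boldsymbol\lambda,d).$$ Moreover, the upper bound is achieved by the thresholded Tukey regression estimator: a minimizer $t^*\in[0,1]$ of $d/N(t)+t^2$ exists, and for every such $t^*$, with weights $w_i=\mathbb 1\{\lambda_i\le t^*\}/N(t^*)$, a measurable map $\hat\beta$ with $\hat\beta(\mathbf Z)\in\arg\max_{\eta\in\mathbb R^d}D_w(\eta,\mathbf Z)$ for all $\mathbf Z$ exists, and every map $\hat\beta$ with this argmax property satisfies, for all $\beta$ and all adversaries, $$\Pr_{\mathbf Z\sim_{\boldsymbol\lambda}P_\beta}\big[\|\hat\beta(\mathbf Z)-\beta\|_\Sigma^2>C_2\,\sigma^2 f(\boldsymbol\lambda,d)\big]\le\tfrac15$$ (outer probability if $\hat\beta$ is not measurable). -/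

import Mathlib

open MeasureTheory ProbabilityTheory
open scoped ENNReal NNReal

noncomputable section

namespace HeterogeneousRegression

/-- Space of one observation `(w, y)`: covariate in `ℝ^d` with the Euclidean structure, and
response. -/
abbrev Obs (d : ℕ) : Type := EuclideanSpace ℝ (Fin d) × ℝ

/-- A data set of `n` observations. -/
abbrev Dataset (d n : ℕ) : Type := Fin n → Obs d

/-- The conditional law of the response given the covariate: `w ↦ N(wᵀβ, σ²)`. -/
def responseKernel {d : ℕ} (β : EuclideanSpace ℝ (Fin d)) (σ : ℝ≥0) :
    Kernel (EuclideanSpace ℝ (Fin d)) ℝ where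
  toFun w := gaussianReal (inner ℝ w β) (σ ^ 2)
  measurable' :=
    measurable_gaussianReal.comp (f := fun w : EuclideanSpace ℝ (Fin d) =>
      ((inner ℝ w β : ℝ), σ ^ 2)) (by fun_prop)

instance {d : ℕ} (β : EuclideanSpace ℝ (Fin d)) (σ : ℝ≥0) :
    IsMarkovKernel (responseKernel β σ) :=
  ⟨fun w => inferInstanceAs (IsProbabilityMeasure (gaussianReal (inner ℝ w β) (σ ^ 2)))⟩

/-- The clean law `P_β` of one observation: `W ∼ N(0, S)` and, given `W`, `Y ∼ N(Wᵀβ, σ²)`. -/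
def cleanLaw {d : ℕ} (S : Matrix (Fin d) (Fin d) ℝ) (σ : ℝ≥0)
    (β : EuclideanSpace ℝ (Fin d)) : Measure (Obs d) :=
  (multivariateGaussian 0 S) ⊗ₘ (responseKernel β σ)

instance {d : ℕ} (S : Matrix (Fin d) (Fin d) ℝ) (σ : ℝ≥0) (β : EuclideanSpace ℝ (Fin d)) :
    IsProbabilityMeasure (cleanLaw S σ β) := by
  unfold cleanLaw; infer_instance

/-- An adversary: the joint conditional law of all outliers given all the clean samples and all
the corruption indicators. -/
abbrev Adversary (Z : Type) [MeasurableSpace Z] (n : ℕ) : Type :=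
  {κ : Kernel ((Fin n → Z) × (Fin n → Bool)) (Fin n → Z) // IsMarkovKernel κ}

/-- The observed sample: the outlier where the indicator is `true`, the clean point elsewhere. -/
def contaminate {Z : Type} {n : ℕ} (p : ((Fin n → Z) × (Fin n → Bool)) × (Fin n → Z)) :
    Fin n → Z :=
  fun i => if p.1.2 i then p.2 i else p.1.1 i

lemma measurable_contaminate {Z : Type} [MeasurableSpace Z] {n : ℕ} :
    Measurable (contaminate : ((Fin n → Z) × (Fin n → Bool)) × (Fin n → Z) → Fin n → Z) := by
  refine measurable_pi_lambda _ fun i => Measurable.ite ?_ (by fun_prop) (by fun_prop)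
  have h : Measurable fun p : ((Fin n → Z) × (Fin n → Bool)) × (Fin n → Z) => p.1.2 i := by
    fun_prop
  exact h (measurableSet_singleton true)

/-- The law of a `lam`-contaminated sample from `P` against the adversary `κ`: clean points i.i.d.
from `P`, independent indicators `B i ∼ Bern(lam i)` which are independent of the clean points,
outliers drawn from `κ` given both. -/
def contaminatedLaw {Z : Type} [MeasurableSpace Z] {n : ℕ} (lam : Fin n → unitInterval) (P : Measure Z)
    (κ : Adversary Z n) : Measure (Fin n → Z) :=
  (((Measure.pi fun _ : Fin n => P).prod
      (Measure.pi fun i => bernoulliMeasure true false (lam i))) ⊗ₘ κ.1).map contaminate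

instance {Z : Type} [MeasurableSpace Z] {n : ℕ} (lam : Fin n → unitInterval) (P : Measure Z)
    [IsProbabilityMeasure P] (κ : Adversary Z n) :
    IsProbabilityMeasure (contaminatedLaw lam P κ) := by
  have := κ.2
  exact Measure.isProbabilityMeasure_map measurable_contaminate.aemeasurable

/-- The squared error `‖b - β‖_S² = (b - β)ᵀ S (b - β)`. -/
def sqError {d : ℕ} (S : Matrix (Fin d) (Fin d) ℝ) (b β : EuclideanSpace ℝ (Fin d)) : ℝ :=
  (fun i => (b - β) i) ⬝ᵥ S.mulVec (fun i => (b - β) i)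

/-- The worst case, over the true coefficient vector and the adversary, of the probability that the
squared error of the estimator `M` exceeds `r`. -/
def worstFailure {d n : ℕ} (lam : Fin n → unitInterval) (S : Matrix (Fin d) (Fin d) ℝ) (σ : ℝ≥0)
    (M : Dataset d n → EuclideanSpace ℝ (Fin d)) (r : ℝ≥0∞) : ℝ≥0∞ :=
  ⨆ (β : EuclideanSpace ℝ (Fin d)) (κ : Adversary (Obs d) n),
    contaminatedLaw lam (cleanLaw S σ β) κ {z | r < ENNReal.ofReal (sqError S (M z) β)}

/-- The minimax PAC rate of the squared excess risk at failure probability `δ`; the infimum over `M`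
is over all measurable estimators. -/
def minimaxPACRate {d n : ℕ} (lam : Fin n → unitInterval) (S : Matrix (Fin d) (Fin d) ℝ) (σ : ℝ≥0)
    (δ : ℝ≥0∞) : ℝ≥0∞ :=
  sInf {r : ℝ≥0∞ |
    (⨅ M : {M : Dataset d n → EuclideanSpace ℝ (Fin d) // Measurable M},
      worstFailure lam S σ M.1 r) ≤ δ}

/-- `N(t) = #{i : lam i ≤ t}`. -/
def countLE {n : ℕ} (lam : Fin n → unitInterval) (t : unitInterval) : ℕ :=
  (Finset.univ.filter fun i => lam i ≤ t).card

/-- `d / N(t) + t²`; for `d ≥ 1` this is `∞` when `N(t) = 0`. -/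
def thresholdError {n : ℕ} (lam : Fin n → unitInterval) (d : ℕ) (t : unitInterval) : ℝ≥0∞ :=
  (d : ℝ≥0∞) / (countLE lam t : ℝ≥0∞) + ENNReal.ofReal ((t : ℝ) ^ 2)

/-- `min_{t ∈ [0,1]} (d / N(t) + t²)`. -/
def effectiveError {n : ℕ} (lam : Fin n → unitInterval) (d : ℕ) : ℝ≥0∞ :=
  ⨅ t : unitInterval, thresholdError lam d t

/-- `t` is a minimizer over `[0,1]` of `d / N(t) + t²`. -/
def IsOptimalThreshold {n : ℕ} (lam : Fin n → unitInterval) (d : ℕ) (t : unitInterval) : Prop :=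
  ∀ s : unitInterval, thresholdError lam d t ≤ thresholdError lam d s

/-- The weights `w(t)_i = 1{lam i ≤ t} / N(t)`. -/
def thresholdWeight {n : ℕ} (lam : Fin n → unitInterval) (t : unitInterval) (i : Fin n) : ℝ :=
  if lam i ≤ t then 1 / (countLE lam t : ℝ) else 0

open Classical in
/-- The weighted regression depth of `η`:
`min_{‖v‖ = 1} ∑ i, w i * 1{(y i - ηᵀ x i) (vᵀ x i) ≥ 0}` for observations `z i = (x i, y i)`. -/
def regressionDepth {d n : ℕ} (w : Fin n → ℝ) (η : EuclideanSpace ℝ (Fin d))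
    (z : Dataset d n) : ℝ :=
  ⨅ v : Metric.sphere (0 : EuclideanSpace ℝ (Fin d)) 1,
    ∑ i, w i *
      (if 0 ≤ ((z i).2 - inner ℝ η (z i).1) * inner ℝ (v : EuclideanSpace ℝ (Fin d)) (z i).1
        then 1 else 0)

/-- `M` is a weighted Tukey regression estimator: `M z` maximizes the weighted regression depth. -/
def IsTukeyRegression {d n : ℕ} (w : Fin n → ℝ)
    (M : Dataset d n → EuclideanSpace ℝ (Fin d)) : Prop :=
  ∀ (z : Dataset d n) (η : EuclideanSpace ℝ (Fin d)),
    regressionDepth w η z ≤ regressionDepth w (M z) z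

end HeterogeneousRegression

end

open HeterogeneousRegression

/-!
Upper bound. After whitening, moving the coefficient vector a distance `s` away from the truth makes
the depth in that direction drop by a constant multiple of `s`. The counts that define the depth
deviate from their means by `O(√(d N))` uniformly over directions (chaining over nets of the sphere
at the scales `8⁻ᵏ`), and the adversary controls about `t N` of the `N = N(t)` points that are used.
A deepest vector therefore lies within `O(√(d / N) + t)` of the truth.

Lower bound. Apply Assouad's lemma to the vertices of a cube in whitened coordinates, whose
dimension is of order `√d` and whose edge is of order `σ √f / √d`. The pointwise supremum of the
clean densities over the vertices has total mass at most `1 + t` for some `t` of order `√f`. An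
adversary can thus give every observation of rate above `t` one and the same law, whatever the
vertex. The at most `N(t)` other observations are left clean, and adjacent vertices are too close
for them to be told apart.
-/

namespace HeterogeneousRegression

/-! ### Concentration of counts -/

lemma pow_le_exp_natCast (k : ℕ) : (2.7 : ℝ) ^ k ≤ Real.exp k := by
  rw [← Real.exp_one_pow]
  gcongr
  linarith [Real.exp_one_gt_d9]

section Independent

variable {ι : Type*} [Fintype ι] {Ω : ι → Type*} [∀ i, MeasurableSpace (Ω i)]
  (P : ∀ i, Measure (Ω i)) [∀ i, IsProbabilityMeasure (P i)] (I : Finset ι) {g : ∀ i, Ω i → ℝ}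

lemma lintegral_exp_sum_pi (hg : ∀ i, Measurable (g i)) :
    ∫⁻ x, ENNReal.ofReal (Real.exp (∑ i ∈ I, g i (x i))) ∂(Measure.pi P)
      = ∏ i ∈ I, ∫⁻ ω, ENNReal.ofReal (Real.exp (g i ω)) ∂(P i) := by
  have hexp (i : ι) : Measurable fun ω => ENNReal.ofReal (Real.exp (g i ω)) := by fun_prop
  simp_rw [Real.exp_sum, ENNReal.ofReal_prod_of_nonneg fun _ _ => (Real.exp_pos _).le]
  rw [lintegral_prod_eq_prod_lintegral_of_indepFun I _
    (iIndepFun_pi fun i => (hexp i).aemeasurable) fun i => (hexp i).comp (measurable_pi_apply i)]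
  exact Finset.prod_congr rfl fun i _ => (measurePreserving_eval P i).lintegral_comp (hexp i)

lemma measure_pi_lt_sum_le_of_lintegral_exp_le (hg : ∀ i, Measurable (g i)) {b : ι → ℝ}
    (hb : ∀ i ∈ I, ∫⁻ ω, ENNReal.ofReal (Real.exp (g i ω)) ∂(P i) ≤ ENNReal.ofReal (Real.exp (b i)))
    (a : ℝ) :
    Measure.pi P {x | ∑ i ∈ I, b i + a < ∑ i ∈ I, g i (x i)} ≤ ENNReal.ofReal (Real.exp (-a)) := by
  have hF : Measurable fun x : ∀ i, Ω i => ENNReal.ofReal (Real.exp (∑ i ∈ I, g i (x i))) := by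
    fun_prop
  calc Measure.pi P {x | ∑ i ∈ I, b i + a < ∑ i ∈ I, g i (x i)}
      ≤ Measure.pi P {x | ENNReal.ofReal (Real.exp (∑ i ∈ I, b i + a))
          ≤ ENNReal.ofReal (Real.exp (∑ i ∈ I, g i (x i)))} :=
        measure_mono fun x hx => ENNReal.ofReal_le_ofReal (Real.exp_le_exp.2 (le_of_lt hx))
    _ ≤ (∫⁻ x, ENNReal.ofReal (Real.exp (∑ i ∈ I, g i (x i))) ∂(Measure.pi P))
          / ENNReal.ofReal (Real.exp (∑ i ∈ I, b i + a)) :=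
        meas_ge_le_lintegral_div hF.aemeasurable (by simp [Real.exp_pos]) ENNReal.ofReal_ne_top
    _ ≤ ENNReal.ofReal (Real.exp (∑ i ∈ I, b i))
          / ENNReal.ofReal (Real.exp (∑ i ∈ I, b i + a)) := by
        gcongr
        rw [lintegral_exp_sum_pi P I hg, Real.exp_sum,
          ENNReal.ofReal_prod_of_nonneg fun _ _ => (Real.exp_pos _).le]
        exact Finset.prod_le_prod' hb
    _ = ENNReal.ofReal (Real.exp (-a)) := by
        rw [← ENNReal.ofReal_div_of_pos (Real.exp_pos _), ← Real.exp_sub]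
        congr 2; ring

lemma lintegral_exp_le_exp_integral_add_integral_sq {α : Type*} [MeasurableSpace α]
    (μ : Measure α) [IsProbabilityMeasure μ] {f : α → ℝ} (hf : Measurable f)
    (hf1 : ∀ x, |f x| ≤ 1) :
    ∫⁻ x, ENNReal.ofReal (Real.exp (f x)) ∂μ
      ≤ ENNReal.ofReal (Real.exp (∫ x, f x ∂μ + ∫ x, f x ^ 2 ∂μ)) := by
  have hfi : Integrable f μ := .of_bound hf.aestronglyMeasurable 1 (.of_forall hf1)
  have hf2i : Integrable (fun x => f x ^ 2) μ :=
    .of_bound (hf.pow_const 2).aestronglyMeasurable 1 (.of_forall fun x => by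
      simpa only [norm_pow, Real.norm_eq_abs] using pow_le_one₀ (abs_nonneg _) (hf1 x))
  have hpt (x : α) : Real.exp (f x) ≤ 1 + f x + f x ^ 2 := by
    have := (abs_le.1 (Real.abs_exp_sub_one_sub_id_le (hf1 x))).2
    linarith
  calc ∫⁻ x, ENNReal.ofReal (Real.exp (f x)) ∂μ
      ≤ ∫⁻ x, ENNReal.ofReal (1 + f x + f x ^ 2) ∂μ :=
        lintegral_mono fun x => ENNReal.ofReal_le_ofReal (hpt x)
    _ = ENNReal.ofReal (∫ x, (1 + f x + f x ^ 2) ∂μ) :=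
        (ofReal_integral_eq_lintegral_ofReal (by fun_prop)
          (.of_forall fun x => (Real.exp_pos _).le.trans (hpt x))).symm
    _ = ENNReal.ofReal (∫ x, f x ∂μ + ∫ x, f x ^ 2 ∂μ + 1) := by
        rw [integral_add (by fun_prop) hf2i, integral_add (by fun_prop) hfi, integral_const,
          probReal_univ, one_smul]
        congr 1; ring
    _ ≤ _ := ENNReal.ofReal_le_ofReal (Real.add_one_le_exp _)

lemma measure_pi_lt_sum_le_of_integral_sq_le (hg : ∀ i, Measurable (g i))
    (hg1 : ∀ i ω, |g i ω| ≤ 1) {m v : ι → ℝ} (hm : ∀ i ∈ I, ∫ ω, g i ω ∂(P i) ≤ m i)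
    (hv : ∀ i ∈ I, ∫ ω, g i ω ^ 2 ∂(P i) ≤ v i) {θ : ℝ} (hθ : 0 < θ) (hθ1 : θ ≤ 1) (a : ℝ) :
    Measure.pi P {x | ∑ i ∈ I, (m i + θ * v i) + a / θ < ∑ i ∈ I, g i (x i)}
      ≤ ENNReal.ofReal (Real.exp (-a)) := by
  have hexp (i : ι) (hi : i ∈ I) : ∫⁻ ω, ENNReal.ofReal (Real.exp (θ * g i ω)) ∂(P i)
      ≤ ENNReal.ofReal (Real.exp (θ * (m i + θ * v i))) := by
    refine (lintegral_exp_le_exp_integral_add_integral_sq (P i) ((hg i).const_mul θ)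
      fun ω => ?_).trans ?_
    · rw [abs_mul, abs_of_pos hθ]
      exact mul_le_one₀ hθ1 (abs_nonneg _) (hg1 i ω)
    · simp_rw [mul_pow, integral_const_mul, mul_add, ← mul_assoc, ← sq]
      gcongr
      exacts [hm i hi, hv i hi]
  refine (measure_mono fun x hx => ?_).trans (measure_pi_lt_sum_le_of_lintegral_exp_le P I
    (fun i => (hg i).const_mul θ) hexp a)
  have hx' := mul_lt_mul_of_pos_left (Set.mem_ofPred_eq.mp hx) hθ
  rwa [mul_add, mul_div_cancel₀ _ hθ.ne', Finset.mul_sum, Finset.mul_sum] at hx'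

end Independent

lemma measure_exists_mem_le {Ω ι : Type*} [MeasurableSpace Ω] (μ : Measure Ω) (T : Finset ι)
    (F : ι → Set Ω) {a b : ℝ} (hF : ∀ u ∈ T, μ (F u) ≤ ENNReal.ofReal (Real.exp (-a)))
    (hT : (T.card : ℝ) ≤ Real.exp b) :
    μ {x | ∃ u ∈ T, x ∈ F u} ≤ ENNReal.ofReal (Real.exp (b - a)) := by
  rw [show {x | ∃ u ∈ T, x ∈ F u} = ⋃ u ∈ T, F u by ext; simp, sub_eq_add_neg, Real.exp_add,
    ENNReal.ofReal_mul (Real.exp_pos _).le]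
  calc μ (⋃ u ∈ T, F u) ≤ ∑ u ∈ T, μ (F u) := measure_biUnion_finset_le T F
    _ ≤ T.card * ENNReal.ofReal (Real.exp (-a)) :=
      (Finset.sum_le_sum hF).trans_eq (by rw [Finset.sum_const, nsmul_eq_mul])
    _ ≤ _ := by
      gcongr
      rw [← ENNReal.ofReal_natCast]
      exact ENNReal.ofReal_le_ofReal hT

/-- The number of observations with index in `I` that lie in `A`, as a real number. -/
noncomputable def hits {ι Z : Type*} (I : Finset ι) (A : Set Z) (x : ι → Z) : ℝ :=
  ∑ i ∈ I, A.indicator 1 (x i)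

section Hits

variable {ι Z : Type*} (I : Finset ι)

lemma hits_mono {A B : Set Z} (h : A ⊆ B) (x : ι → Z) : hits I A x ≤ hits I B x :=
  Finset.sum_le_sum fun _ _ => Set.indicator_le_indicator_of_subset h (fun _ => zero_le_one) _

lemma hits_union_le (A B : Set Z) (x : ι → Z) : hits I (A ∪ B) x ≤ hits I A x + hits I B x := by
  rw [hits, hits, hits, ← Finset.sum_add_distrib]
  refine Finset.sum_le_sum fun i _ => ?_
  by_cases hA : x i ∈ A <;> by_cases hB : x i ∈ B <;> simp [hA, hB]

lemma measure_pi_lt_hits_le [Fintype ι] [MeasurableSpace Z] (P : ι → Measure Z)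
    [∀ i, IsProbabilityMeasure (P i)] {A : Set Z} (hA : MeasurableSet A) {p : ℝ}
    (hp : ∀ i ∈ I, (P i).real A ≤ p) {θ : ℝ} (hθ : 0 < θ) (hθ1 : θ ≤ 1) (a : ℝ) :
    Measure.pi P {x | I.card * (p + θ * p) + a / θ < hits I A x}
      ≤ ENNReal.ofReal (Real.exp (-a)) := by
  have hsq (z : Z) : (A.indicator 1 z : ℝ) ^ 2 = A.indicator 1 z := by
    by_cases hz : z ∈ A <;> simp [hz]
  simpa only [hits, Finset.sum_const, nsmul_eq_mul] using
    measure_pi_lt_sum_le_of_integral_sq_le P I (g := fun _ => A.indicator 1) (m := fun _ => p)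
      (v := fun _ => p)
      (fun _ => measurable_one.indicator hA) (fun _ z => by by_cases hz : z ∈ A <;> simp [hz])
      (fun i hi => by simpa only [integral_indicator_one hA] using hp i hi)
      (fun i hi => by simpa only [hsq, integral_indicator_one hA] using hp i hi) hθ hθ1 a

end Hits

/-! ### The standard Gaussian observation -/

lemma gaussianPDFReal_zero_one (x : ℝ) :
    gaussianPDFReal 0 1 x = (√(2 * Real.pi))⁻¹ * Real.exp (-x ^ 2 / 2) := by
  simp [gaussianPDFReal]

lemma gaussianPDFReal_zero_one_le (x : ℝ) : gaussianPDFReal 0 1 x ≤ 1 / 2 := by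
  have hsqrt : (2 : ℝ) ≤ √(2 * Real.pi) :=
    Real.le_sqrt_of_sq_le (by linarith [Real.pi_gt_three])
  have hexp : Real.exp (-x ^ 2 / 2) ≤ 1 :=
    Real.exp_le_one_iff.2 (by linarith [sq_nonneg x])
  calc gaussianPDFReal 0 1 x = (√(2 * Real.pi))⁻¹ * Real.exp (-x ^ 2 / 2) :=
        gaussianPDFReal_zero_one x
    _ ≤ 2⁻¹ * 1 := by gcongr
    _ = 1 / 2 := by norm_num

lemma le_gaussianPDFReal_zero_one {x : ℝ} (hx : |x| ≤ 2) : 1 / 30 ≤ gaussianPDFReal 0 1 x := by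
  have hsqrt : √(2 * Real.pi) ≤ 3 :=
    Real.sqrt_le_iff.2 ⟨by norm_num, by linarith [Real.pi_lt_four]⟩
  have hexp : (10 : ℝ)⁻¹ ≤ Real.exp (-x ^ 2 / 2) := by
    have hx2 : x ^ 2 ≤ 2 ^ 2 := sq_le_sq' (abs_le.1 hx).1 (abs_le.1 hx).2
    calc (10 : ℝ)⁻¹ ≤ (Real.exp 1 ^ 2)⁻¹ := by
          gcongr; nlinarith [Real.exp_one_lt_d9, Real.exp_pos 1]
      _ = Real.exp (-2) := by rw [Real.exp_one_pow, ← Real.exp_neg]; norm_num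
      _ ≤ _ := by gcongr; linarith
  calc (1 / 30 : ℝ) = 3⁻¹ * 10⁻¹ := by norm_num
    _ ≤ (√(2 * Real.pi))⁻¹ * Real.exp (-x ^ 2 / 2) := by gcongr
    _ = gaussianPDFReal 0 1 x := (gaussianPDFReal_zero_one x).symm

lemma gaussianReal_Icc_le (a b : ℝ) :
    gaussianReal 0 1 (Set.Icc a b) ≤ ENNReal.ofReal ((b - a) / 2) := by
  rw [gaussianReal_apply 0 one_ne_zero]
  calc ∫⁻ x in Set.Icc a b, gaussianPDF 0 1 x
      ≤ ∫⁻ _ in Set.Icc a b, ENNReal.ofReal (1 / 2) :=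
        lintegral_mono fun x => ENNReal.ofReal_le_ofReal (gaussianPDFReal_zero_one_le x)
    _ = ENNReal.ofReal ((b - a) / 2) := by
        rw [setLIntegral_const, Real.volume_Icc, ← ENNReal.ofReal_mul (by norm_num)]
        congr 1; ring

lemma le_gaussianReal_real_Ioo {a b : ℝ} (ha : -2 ≤ a) (hb : b ≤ 2) :
    (b - a) / 30 ≤ (gaussianReal 0 1).real (Set.Ioo a b) := by
  rw [Measure.real, ← ENNReal.ofReal_le_iff_le_toReal (measure_ne_top _ _),
    gaussianReal_apply 0 one_ne_zero]
  calc ENNReal.ofReal ((b - a) / 30) = ∫⁻ _ in Set.Ioo a b, ENNReal.ofReal (1 / 30) := by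
        rw [setLIntegral_const, Real.volume_Ioo, ← ENNReal.ofReal_mul (by norm_num)]
        congr 1; ring
    _ ≤ ∫⁻ x in Set.Ioo a b, gaussianPDF 0 1 x :=
        setLIntegral_mono (measurable_gaussianPDF 0 1) fun x hx =>
          ENNReal.ofReal_le_ofReal (le_gaussianPDFReal_zero_one
            (abs_le.2 ⟨by linarith [hx.1], by linarith [hx.2]⟩))

lemma lintegral_exp_sq_div_four_gaussianReal_le :
    ∫⁻ x, ENNReal.ofReal (Real.exp (x ^ 2 / 4)) ∂(gaussianReal 0 1)
      ≤ ENNReal.ofReal (Real.exp 1) := by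
  have htilt (x : ℝ) : gaussianPDF 0 1 x * ENNReal.ofReal (Real.exp (x ^ 2 / 4))
      = ENNReal.ofReal √2 * gaussianPDF 0 2 x := by
    rw [gaussianPDF, gaussianPDF, ← ENNReal.ofReal_mul (gaussianPDFReal_nonneg _ _ _),
      ← ENNReal.ofReal_mul (by positivity), gaussianPDFReal_zero_one, gaussianPDFReal,
      mul_assoc, ← Real.exp_add, NNReal.coe_ofNat, Real.sqrt_mul (by positivity) 2, mul_inv,
      mul_comm (√(2 * Real.pi))⁻¹ (√2)⁻¹, mul_assoc, mul_inv_cancel_left₀ (by positivity)]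
    congr 3
    ring
  rw [gaussianReal_of_var_ne_zero 0 one_ne_zero,
    lintegral_withDensity_eq_lintegral_mul _ (measurable_gaussianPDF 0 1) (by fun_prop)]
  simp_rw [Pi.mul_apply, htilt]
  rw [lintegral_const_mul _ (measurable_gaussianPDF 0 2),
    lintegral_gaussianPDF_eq_one 0 two_ne_zero, mul_one]
  have hsqrt : √2 ≤ 2 := Real.sqrt_le_iff.2 (by norm_num)
  exact ENNReal.ofReal_le_ofReal (by linarith [Real.add_one_le_exp 1])

section StdObs

variable {E : Type*} [NormedAddCommGroup E] [InnerProductSpace ℝ E] [FiniteDimensional ℝ E]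
  [MeasurableSpace E] [BorelSpace E]

lemma stdGaussian_map_inner (u : E) :
    (stdGaussian E).map (fun x => inner ℝ u x) = gaussianReal 0 (‖u‖₊ ^ 2) := by
  have h := IsGaussian.map_eq_gaussianReal (μ := stdGaussian E) (innerSL ℝ u)
  rw [variance_dual_stdGaussian, innerSL_apply_norm, integral_strongDual_stdGaussian] at h
  rwa [show ‖u‖₊ ^ 2 = (‖u‖ ^ 2).toNNReal by ext; simp]

variable (E) in
/-- The law of a whitened observation: a standard Gaussian covariate and an independent standard
Gaussian noise. -/
noncomputable def stdObs : Measure (E × ℝ) :=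
  (stdGaussian E).prod (gaussianReal 0 1)

instance : IsProbabilityMeasure (stdObs E) := by unfold stdObs; infer_instance

lemma stdObs_map_inner_prod (u : E) :
    (stdObs E).map (fun z => ((inner ℝ u z.1 : ℝ), z.2))
      = (gaussianReal 0 (‖u‖₊ ^ 2)).prod (gaussianReal 0 1) := by
  rw [← stdGaussian_map_inner]
  conv_rhs => rw [← Measure.map_id (μ := gaussianReal 0 1)]
  exact (Measure.map_prod_map _ _ (by fun_prop) measurable_id).symm

lemma stdObs_map_inner_fst (u : E) :
    (stdObs E).map (fun z => (inner ℝ u z.1 : ℝ)) = gaussianReal 0 (‖u‖₊ ^ 2) := by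
  rw [← Measure.fst_prod (μ := gaussianReal 0 (‖u‖₊ ^ 2)) (ν := gaussianReal 0 1),
    ← stdObs_map_inner_prod, Measure.fst, Measure.map_map (by fun_prop) (by fun_prop)]
  rfl

lemma stdObs_real_lt_abs_inner_le (u : E) {κ : ℝ} (hκ : 0 < κ) :
    (stdObs E).real {z | κ < |(inner ℝ u z.1 : ℝ)|} ≤ ‖u‖ ^ 2 / κ ^ 2 := by
  have hmeas : MeasurableSet {x : ℝ | κ < |x|} := measurableSet_lt (by fun_prop) (by fun_prop)
  have hmap : (stdObs E) {z | κ < |(inner ℝ u z.1 : ℝ)|}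
      = gaussianReal 0 (‖u‖₊ ^ 2) {x | κ < |x|} := by
    rw [← stdObs_map_inner_fst, Measure.map_apply (by fun_prop) hmeas]
    rfl
  have hchebyshev := meas_ge_le_variance_div_sq (μ := gaussianReal 0 (‖u‖₊ ^ 2)) (X := id)
    (memLp_id_gaussianReal 2) hκ
  simp only [id, integral_id_gaussianReal, sub_zero] at hchebyshev
  rw [Measure.real, hmap]
  refine ENNReal.toReal_le_of_le_ofReal (by positivity)
    ((measure_mono fun x (hx : κ < |x|) => hx.le).trans (hchebyshev.trans_eq ?_))
  rw [variance_id_gaussianReal]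
  simp

end StdObs

/-- The pairs `(a, y)` of a covariate coordinate and a response for which the residual `y - s * a`
has the sign of `a`. -/
def tiltRegion (s : ℝ) : Set (ℝ × ℝ) :=
  {q | s * q.1 ^ 2 ≤ q.2 * q.1}

lemma measurableSet_tiltRegion (s : ℝ) : MeasurableSet (tiltRegion s) :=
  measurableSet_le (by fun_prop) (by fun_prop)

/-- The probability of `tiltRegion s` under the standard Gaussian law of the plane. -/
noncomputable def tiltProb (s : ℝ) : ℝ :=
  ((gaussianReal 0 1).prod (gaussianReal 0 1)).real (tiltRegion s)

lemma tiltProb_le_one (s : ℝ) : tiltProb s ≤ 1 := measureReal_le_one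

lemma gaussian_real_preimage_neg_tiltRegion (s : ℝ) :
    ((gaussianReal 0 1).prod (gaussianReal 0 1)).real
      ((fun q : ℝ × ℝ => (q.1, -q.2)) ⁻¹' tiltRegion s) = tiltProb s := by
  have hmap := Measure.map_prod_map (gaussianReal 0 1) (gaussianReal 0 1) (f := id)
    (g := fun x : ℝ => -x) measurable_id measurable_neg
  rw [Measure.map_id, gaussianReal_map_neg, neg_zero] at hmap
  rw [tiltProb, Measure.real, Measure.real]
  conv_rhs => rw [hmap, Measure.map_apply (by fun_prop) (measurableSet_tiltRegion s)]
  rfl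

lemma gaussian_real_tiltRegion_inter_preimage_neg {s : ℝ} (hs : 0 ≤ s) :
    ((gaussianReal 0 1).prod (gaussianReal 0 1)).real
      (tiltRegion s ∩ (fun q : ℝ × ℝ => (q.1, -q.2)) ⁻¹' tiltRegion s) = 0 := by
  have := nullSingletonClass_gaussianReal (μ := 0) one_ne_zero
  have haxes : tiltRegion s ∩ (fun q : ℝ × ℝ => (q.1, -q.2)) ⁻¹' tiltRegion s
      ⊆ ({0} ×ˢ Set.univ) ∪ (Set.univ ×ˢ {0}) := by
    rintro ⟨a, b⟩ ⟨h, h'⟩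
    simp only [tiltRegion, Set.mem_preimage, Set.mem_ofPred_eq] at h h'
    have h0 : b * a = 0 := by nlinarith [mul_nonneg hs (sq_nonneg a)]
    rcases mul_eq_zero.1 h0 with rfl | rfl <;> simp
  rw [Measure.real, measure_mono_null haxes (measure_union_null (by simp) (by simp)),
    ENNReal.toReal_zero]

lemma disjoint_tiltRegion_Ioo_prod_Ioo {s : ℝ} (hs : 0 ≤ s) :
    Disjoint (tiltRegion s) (Set.Ioo 1 2 ×ˢ Set.Ioo (-s) s) := by
  rw [Set.disjoint_left]
  rintro ⟨a, b⟩ h ⟨ha, hb⟩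
  simp only [tiltRegion, Set.mem_ofPred_eq, Set.mem_Ioo] at h ha hb
  nlinarith [mul_nonneg hs (sub_nonneg.2 ha.1.le)]

/- `tiltRegion s` and its reflection in the first axis have the same mass, essentially do not
overlap, and both miss the box `(1, 2) × (-s, s)`. -/
lemma tiltProb_le {s : ℝ} (hs : 0 ≤ s) (hs1 : s ≤ 1) : tiltProb s ≤ 1 / 2 - s / 900 := by
  set γ₂ : Measure (ℝ × ℝ) := (gaussianReal 0 1).prod (gaussianReal 0 1)
  set T : Set (ℝ × ℝ) := tiltRegion s
  set T' : Set (ℝ × ℝ) := (fun q : ℝ × ℝ => (q.1, -q.2)) ⁻¹' T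
  set box : Set (ℝ × ℝ) := Set.Ioo 1 2 ×ˢ Set.Ioo (-s) s
  have hT' : MeasurableSet T' := (measurableSet_tiltRegion s).preimage (by fun_prop)
  have hbox : s / 450 ≤ γ₂.real box := by
    have hs15 := le_gaussianReal_real_Ioo (a := -s) (b := s) (by linarith) (by linarith)
    calc s / 450 = (2 - 1) / 30 * ((s - -s) / 30) := by ring
      _ ≤ (gaussianReal 0 1).real (Set.Ioo 1 2) * (gaussianReal 0 1).real (Set.Ioo (-s) s) :=
        mul_le_mul (le_gaussianReal_real_Ioo (by norm_num) le_rfl) hs15 (by linarith)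
          measureReal_nonneg
      _ = γ₂.real box := (measureReal_prod_prod _ _).symm
  have hdisj : Disjoint (T ∪ T') box := by
    have hT := disjoint_tiltRegion_Ioo_prod_Ioo hs
    refine Set.disjoint_union_left.2 ⟨hT, Set.disjoint_left.2 fun q hq hqbox => ?_⟩
    exact Set.disjoint_left.1 hT hq ⟨hqbox.1, by linarith [hqbox.2.2], by linarith [hqbox.2.1]⟩
  have hle : γ₂.real (T ∪ T') + γ₂.real box ≤ 1 := by
    rw [← measureReal_union hdisj (measurableSet_Ioo.prod measurableSet_Ioo)]
    exact measureReal_le_one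
  have hunion : γ₂.real (T ∪ T') + γ₂.real (T ∩ T') = γ₂.real T + γ₂.real T' :=
    measureReal_union_add_inter hT'
  rw [gaussian_real_tiltRegion_inter_preimage_neg hs,
    gaussian_real_preimage_neg_tiltRegion] at hunion
  change γ₂.real T ≤ _
  change _ = γ₂.real T + γ₂.real T at hunion
  linarith

lemma gaussian_abs_abs_sub_le_le {s κ : ℝ} (hs : 0 ≤ s) (hs1 : s ≤ 1) (hκ : 0 ≤ κ) :
    ((gaussianReal 0 1).prod (gaussianReal 0 1)) {q : ℝ × ℝ | |(|q.2| - s * |q.1|)| ≤ s * κ}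
      ≤ ENNReal.ofReal (2 * κ) := by
  rw [Measure.prod_apply (measurableSet_le (by fun_prop) (by fun_prop))]
  refine (lintegral_mono (g := fun _ => ENNReal.ofReal (2 * κ)) fun a => ?_).trans_eq (by simp)
  have hslice : Prod.mk a ⁻¹' {q : ℝ × ℝ | |(|q.2| - s * |q.1|)| ≤ s * κ}
      ⊆ Set.Icc (s * |a| - s * κ) (s * |a| + s * κ)
        ∪ Set.Icc (-(s * |a|) - s * κ) (-(s * |a|) + s * κ) := by
    intro b (hb : |(|b| - s * |a|)| ≤ s * κ)
    obtain ⟨hlow, hhigh⟩ := abs_le.1 hb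
    rcases abs_cases b with ⟨h, -⟩ | ⟨h, -⟩
    · left; constructor <;> linarith
    · right; constructor <;> linarith
  refine (measure_mono hslice).trans ((measure_union_le _ _).trans
    ((add_le_add (gaussianReal_Icc_le _ _) (gaussianReal_Icc_le _ _)).trans ?_))
  have hsκ : 0 ≤ s * κ := by positivity
  rw [← ENNReal.ofReal_add (by linarith) (by linarith)]
  exact ENNReal.ofReal_le_ofReal (by nlinarith)

lemma gaussian_abs_fst_le_le (κ : ℝ) :
    ((gaussianReal 0 1).prod (gaussianReal 0 1)) {q : ℝ × ℝ | |q.1| ≤ κ} ≤ ENNReal.ofReal κ := by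
  rw [show {q : ℝ × ℝ | |q.1| ≤ κ} = Set.Icc (-κ) κ ×ˢ Set.univ by ext; simp [abs_le],
    Measure.prod_prod, measure_univ, mul_one]
  exact (gaussianReal_Icc_le _ _).trans_eq (by ring_nf)

lemma abs_abs_sub_mul_abs_le {s κ a a₀ y : ℝ} (hs : 0 ≤ s) (ha : s * a ^ 2 ≤ y * a)
    (ha₀ : y * a₀ < s * a₀ ^ 2) (h : |a - a₀| ≤ κ) (hκ : κ < |a₀|) :
    |(|y| - s * |a₀|)| ≤ s * κ := by
  wlog hpos : 0 < a₀ generalizing a a₀ y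
  · have h0 : a₀ < 0 := lt_of_le_of_ne (not_lt.1 hpos) (by rintro rfl; simp at ha₀)
    simpa using this (a := -a) (a₀ := -a₀) (y := -y) (by simpa using ha) (by simpa using ha₀)
      (by rwa [← neg_sub', abs_neg]) (by rwa [abs_neg]) (by linarith)
  rw [abs_of_pos hpos] at hκ ⊢
  have hdiff := abs_le.1 h
  have hapos : 0 < a := by linarith
  have hy : s * a ≤ y := le_of_mul_le_mul_right (by linarith [sq a]) hapos
  have hy₀ : y < s * a₀ := lt_of_mul_lt_mul_right (by linarith [sq a₀]) hpos.le
  rw [abs_of_nonneg (by nlinarith : 0 ≤ y), abs_le]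
  constructor <;> nlinarith

section TiltSet

variable {E : Type*} [NormedAddCommGroup E] [InnerProductSpace ℝ E]

/-- The observations whose residual, after moving the coefficients by `s` in the direction `u`, has
the sign of the covariate in that direction. -/
def tiltSet (s : ℝ) (u : E) : Set (E × ℝ) :=
  (fun z => ((inner ℝ u z.1 : ℝ), z.2)) ⁻¹' tiltRegion s

/-- A neighbourhood of width `κ` of the boundary of `tiltSet s u`. -/
def tiltBoundary (s κ : ℝ) (u : E) : Set (E × ℝ) :=
  (fun z => ((inner ℝ u z.1 : ℝ), z.2)) ⁻¹'
    ({q | |q.1| ≤ κ} ∪ {q | |(|q.2| - s * |q.1|)| ≤ s * κ})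

lemma tiltSet_diff_subset {s : ℝ} (hs : 0 ≤ s) (κ : ℝ) (u u₀ : E) :
    tiltSet s u \ tiltSet s u₀
      ⊆ tiltBoundary s κ u₀ ∪ {z | κ < |(inner ℝ (u - u₀) z.1 : ℝ)|} := by
  rintro z ⟨hz, hz₀⟩
  simp only [tiltSet, tiltRegion, Set.mem_preimage, Set.mem_ofPred_eq, not_le] at hz hz₀
  rcases lt_or_ge κ |(inner ℝ (u - u₀) z.1 : ℝ)| with hfar | hnear
  · exact .inr hfar
  rcases le_or_gt |(inner ℝ u₀ z.1 : ℝ)| κ with hsmall | hlarge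
  · exact .inl (.inl hsmall)
  · exact .inl (.inr (abs_abs_sub_mul_abs_le hs hz hz₀ (by rwa [← inner_sub_left]) hlarge))

variable [FiniteDimensional ℝ E] [MeasurableSpace E] [BorelSpace E]

lemma measurableSet_tiltSet (s : ℝ) (u : E) : MeasurableSet (tiltSet s u) :=
  (measurableSet_tiltRegion s).preimage (by fun_prop)

lemma measurableSet_tiltBoundary (s κ : ℝ) (u : E) : MeasurableSet (tiltBoundary s κ u) :=
  ((measurableSet_le (by fun_prop) (by fun_prop)).union
    (measurableSet_le (by fun_prop) (by fun_prop))).preimage (by fun_prop)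

lemma stdObs_preimage_inner_prod {u : E} (hu : ‖u‖ = 1) {A : Set (ℝ × ℝ)} (hA : MeasurableSet A) :
    stdObs E ((fun z => ((inner ℝ u z.1 : ℝ), z.2)) ⁻¹' A)
      = ((gaussianReal 0 1).prod (gaussianReal 0 1)) A := by
  rw [← Measure.map_apply (by fun_prop) hA, stdObs_map_inner_prod,
    show ‖u‖₊ = 1 from NNReal.eq hu, one_pow]

lemma stdObs_real_tiltSet (s : ℝ) {u : E} (hu : ‖u‖ = 1) :
    (stdObs E).real (tiltSet s u) = tiltProb s :=
  congrArg ENNReal.toReal (stdObs_preimage_inner_prod hu (measurableSet_tiltRegion s))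

lemma stdObs_real_tiltBoundary_le {s κ : ℝ} (hs : 0 ≤ s) (hs1 : s ≤ 1) (hκ : 0 ≤ κ) {u : E}
    (hu : ‖u‖ = 1) : (stdObs E).real (tiltBoundary s κ u) ≤ 3 * κ := by
  refine ENNReal.toReal_le_of_le_ofReal (by positivity) ?_
  rw [tiltBoundary, stdObs_preimage_inner_prod hu ((measurableSet_le (by fun_prop)
    (by fun_prop)).union (measurableSet_le (by fun_prop) (by fun_prop)))]
  refine (measure_union_le _ _).trans ((add_le_add (gaussian_abs_fst_le_le κ)
    (gaussian_abs_abs_sub_le_le hs hs1 hκ)).trans_eq ?_)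
  rw [← ENNReal.ofReal_add hκ (by positivity)]
  ring_nf

lemma stdObs_real_tiltSet_diff_le {s κ ε : ℝ} (hs : 0 ≤ s) (hs1 : s ≤ 1) (hκ : 0 < κ) {u u₀ : E}
    (hu₀ : ‖u₀‖ = 1) (hε : ‖u - u₀‖ ≤ ε) :
    (stdObs E).real (tiltSet s u \ tiltSet s u₀) ≤ 3 * κ + ε ^ 2 / κ ^ 2 :=
  calc (stdObs E).real (tiltSet s u \ tiltSet s u₀)
      ≤ (stdObs E).real (tiltBoundary s κ u₀)
          + (stdObs E).real {z | κ < |(inner ℝ (u - u₀) z.1 : ℝ)|} :=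
        (measureReal_mono (tiltSet_diff_subset hs κ u u₀)).trans (measureReal_union_le _ _)
    _ ≤ 3 * κ + ‖u - u₀‖ ^ 2 / κ ^ 2 :=
        add_le_add (stdObs_real_tiltBoundary_le hs hs1 hκ.le hu₀)
          (stdObs_real_lt_abs_inner_le _ hκ)
    _ ≤ 3 * κ + ε ^ 2 / κ ^ 2 := by gcongr

lemma integral_sq_indicator_tiltSet_sub_le {s κ ε : ℝ} (hs : 0 ≤ s) (hs1 : s ≤ 1) (hκ : 0 < κ)
    {u u₀ : E} (hu : ‖u‖ = 1) (hu₀ : ‖u₀‖ = 1) (hε : ‖u - u₀‖ ≤ ε) :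
    ∫ z, ((tiltSet s u).indicator 1 z - (tiltSet s u₀).indicator 1 z : ℝ) ^ 2 ∂(stdObs E)
      ≤ 2 * (3 * κ + ε ^ 2 / κ ^ 2) := by
  have hm := (measurableSet_tiltSet s u).diff (measurableSet_tiltSet s u₀)
  have hm₀ := (measurableSet_tiltSet s u₀).diff (measurableSet_tiltSet s u)
  have hsq (z : E × ℝ) :
      ((tiltSet s u).indicator 1 z - (tiltSet s u₀).indicator 1 z : ℝ) ^ 2
        = (tiltSet s u \ tiltSet s u₀).indicator 1 z
          + (tiltSet s u₀ \ tiltSet s u).indicator 1 z := by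
    by_cases h : z ∈ tiltSet s u <;> by_cases h₀ : z ∈ tiltSet s u₀ <;> simp [h, h₀]
  simp_rw [hsq]
  rw [integral_add ((integrable_const 1).indicator hm) ((integrable_const 1).indicator hm₀),
    integral_indicator_one hm, integral_indicator_one hm₀, two_mul]
  exact add_le_add (stdObs_real_tiltSet_diff_le hs hs1 hκ hu₀ hε)
    (stdObs_real_tiltSet_diff_le hs hs1 hκ hu (by rwa [norm_sub_rev]))

end TiltSet

/-! ### Chaining over the unit sphere -/

section Nets

variable {E : Type*} [NormedAddCommGroup E] [NormedSpace ℝ E]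

/-- A sequence of nets of the unit sphere at the scales `8⁻ᵏ`, of the cardinality that a volume
comparison allows. -/
structure IsSphereNetSeq (T : ℕ → Finset E) : Prop where
  norm_eq_one : ∀ {k u}, u ∈ T k → ‖u‖ = 1
  exists_near : ∀ k u, ‖u‖ = 1 → ∃ v ∈ T k, ‖u - v‖ ≤ ((8 : ℝ) ^ k)⁻¹
  card_le : ∀ k, ((T k).card : ℝ) ≤ Real.exp (Module.finrank ℝ E * (3 * k + 2))

variable [FiniteDimensional ℝ E]

lemma card_le_of_separated_sphere {ε : ℝ} (hε : 0 < ε) (T : Finset E) (hT : ∀ u ∈ T, ‖u‖ = 1)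
    (hsep : ∀ u ∈ T, ∀ v ∈ T, u ≠ v → ε ≤ ‖u - v‖) :
    (T.card : ℝ) ≤ (1 + 2 / ε) ^ Module.finrank ℝ E := by
  borelize E
  set μ : Measure E := Measure.addHaar
  have hdisj : (T : Set E).PairwiseDisjoint fun u => Metric.ball u (ε / 2) := by
    refine fun u hu v hv huv => Metric.ball_disjoint_ball ?_
    rw [add_halves, dist_eq_norm]
    exact hsep u hu v hv huv
  have hsub : ⋃ u ∈ T, Metric.ball u (ε / 2) ⊆ Metric.ball (0 : E) (1 + ε / 2) :=
    Set.iUnion₂_subset fun u hu => Metric.ball_subset_ball' (by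
      rw [dist_zero_right, hT u hu, add_comm])
  have hvol : T.card * ENNReal.ofReal ((ε / 2) ^ Module.finrank ℝ E) * μ (Metric.ball 0 1)
      ≤ ENNReal.ofReal ((1 + ε / 2) ^ Module.finrank ℝ E) * μ (Metric.ball 0 1) :=
    calc _ = μ (⋃ u ∈ T, Metric.ball u (ε / 2)) := by
          rw [measure_biUnion_finset hdisj fun _ _ => measurableSet_ball]
          simp only [μ.addHaar_ball_of_pos _ (half_pos hε), Finset.sum_const, nsmul_eq_mul,
            mul_assoc]
      _ ≤ μ (Metric.ball 0 (1 + ε / 2)) := measure_mono hsub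
      _ = _ := μ.addHaar_ball_of_pos _ (by positivity)
  have hcard : (T.card : ℝ) * (ε / 2) ^ Module.finrank ℝ E ≤ (1 + ε / 2) ^ Module.finrank ℝ E := by
    have hle := (ENNReal.mul_le_mul_iff_left (Metric.measure_ball_pos μ _ zero_lt_one).ne'
      measure_ball_lt_top.ne).1 hvol
    rw [← ENNReal.ofReal_natCast, ← ENNReal.ofReal_mul (by positivity)] at hle
    exact (ENNReal.ofReal_le_ofReal_iff (by positivity)).1 hle
  calc (T.card : ℝ) ≤ (1 + ε / 2) ^ Module.finrank ℝ E / (ε / 2) ^ Module.finrank ℝ E :=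
        (le_div_iff₀ (by positivity)).2 hcard
    _ = (1 + 2 / ε) ^ Module.finrank ℝ E := by rw [← div_pow]; congr 1; field_simp; ring

variable (E) in
lemma exists_net_sphere {ε : ℝ≥0} (hε : 0 < ε) (hε1 : ε ≤ 1) :
    ∃ T : Finset E, (∀ u ∈ T, ‖u‖ = 1) ∧ (∀ u, ‖u‖ = 1 → ∃ v ∈ T, ‖u - v‖ ≤ ε) ∧
      (T.card : ℝ) ≤ (3 / ε) ^ Module.finrank ℝ E := by
  have hfin : Metric.packingNumber ε (Metric.sphere (0 : E) 1) ≠ ⊤ := by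
    obtain ⟨C, -, hC, hcover⟩ :=
      Metric.exists_finite_isCover_of_isCompact (half_pos hε).ne' (isCompact_sphere (0 : E) 1)
    have hle := (Metric.packingNumber_two_mul_le_externalCoveringNumber _ _).trans
      hcover.externalCoveringNumber_le_encard
    rw [mul_div_cancel₀ _ two_ne_zero] at hle
    exact (hle.trans_lt hC.encard_lt_top).ne
  set T := Metric.maximalSeparatedSet ε (Metric.sphere (0 : E) 1)
  have hTfin : T.Finite := Set.encard_ne_top_iff.1 (by rwa [Metric.encard_maximalSeparatedSet hfin])
  have hT (u : E) (hu : u ∈ hTfin.toFinset) : ‖u‖ = 1 :=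
    mem_sphere_zero_iff_norm.1 (Metric.maximalSeparatedSet_subset (hTfin.mem_toFinset.1 hu))
  refine ⟨hTfin.toFinset, hT, fun u hu => ?_,
    (card_le_of_separated_sphere hε _ hT fun u hu v hv huv => ?_).trans ?_⟩
  · have := Metric.isCover_iff_subset_iUnion_closedBall.1 (Metric.isCover_maximalSeparatedSet hfin)
      (mem_sphere_zero_iff_norm.2 hu)
    simpa only [Set.mem_iUnion, Metric.mem_closedBall, dist_eq_norm, exists_prop,
      Set.Finite.mem_toFinset] using this
  · have : (ε : ℝ≥0∞) < edist u v := Metric.isSeparated_maximalSeparatedSet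
      (hTfin.mem_toFinset.1 hu) (hTfin.mem_toFinset.1 hv) huv
    rw [edist_nndist, ENNReal.coe_lt_coe, ← NNReal.coe_lt_coe, coe_nndist, dist_eq_norm] at this
    exact this.le
  · have hbase : 1 + 2 / (ε : ℝ) ≤ 3 / ε := by
      rw [le_div_iff₀ (by positivity), add_mul, div_mul_cancel₀ _ (by positivity)]
      linarith [NNReal.coe_le_one.2 hε1]
    exact pow_le_pow_left₀ (by positivity) hbase _

variable (E) in
lemma exists_isSphereNetSeq : ∃ T : ℕ → Finset E, IsSphereNetSeq T := by
  have hbase (k : ℕ) : 3 / ((8 : ℝ) ^ k)⁻¹ ≤ Real.exp (3 * k + 2) := by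
    have h3 : (8 : ℝ) ≤ Real.exp 3 := le_trans (by norm_num) (pow_le_exp_natCast 3)
    rw [div_inv_eq_mul, add_comm, Real.exp_add, mul_comm (3 : ℝ) k, Real.exp_nat_mul]
    gcongr
    linarith [Real.add_one_le_exp (2 : ℝ)]
  choose T hT hnet hcard using fun k : ℕ => exists_net_sphere E (ε := ((8 : ℝ≥0) ^ k)⁻¹)
    (by positivity) (inv_le_one_of_one_le₀ (one_le_pow₀ (by norm_num)))
  refine ⟨T, fun {k} => hT k _, fun k => by simpa using hnet k, fun k => (hcard k).trans ?_⟩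
  rw [Real.exp_nat_mul]
  gcongr
  simpa using hbase k

end Nets

section SecondMoment

variable {E : Type*} [NormedAddCommGroup E] [InnerProductSpace ℝ E] {ι : Type*} (I : Finset ι)

lemma sum_inner_add_sq_le (x : ι → E) (u v : E) :
    ∑ i ∈ I, (inner ℝ (u + v) (x i) : ℝ) ^ 2
      ≤ 2 * ∑ i ∈ I, (inner ℝ u (x i) : ℝ) ^ 2 + 2 * ∑ i ∈ I, (inner ℝ v (x i) : ℝ) ^ 2 := by
  rw [Finset.mul_sum, Finset.mul_sum, ← Finset.sum_add_distrib]
  refine Finset.sum_le_sum fun i _ => ?_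
  rw [inner_add_left, ← mul_add]
  exact add_sq_le

lemma sum_inner_sq_le_of_le_sphere (x : ι → E) {B : ℝ}
    (hB : ∀ u : E, ‖u‖ = 1 → ∑ i ∈ I, (inner ℝ u (x i) : ℝ) ^ 2 ≤ B) (v : E) :
    ∑ i ∈ I, (inner ℝ v (x i) : ℝ) ^ 2 ≤ B * ‖v‖ ^ 2 := by
  rcases eq_or_ne v 0 with rfl | hv
  · simp
  have hunit : ‖(‖v‖⁻¹ • v)‖ = 1 := by
    rw [norm_smul, norm_inv, norm_norm, inv_mul_cancel₀ (norm_ne_zero_iff.2 hv)]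
  have h := hB _ hunit
  simp only [real_inner_smul_left, mul_pow, inv_pow, ← Finset.mul_sum] at h
  rwa [inv_mul_le_iff₀ (by positivity), mul_comm] at h

lemma sum_inner_sq_le_of_net [FiniteDimensional ℝ E] (x : ι → E) (T : Finset E)
    (hT : ∀ u : E, ‖u‖ = 1 → ∃ v ∈ T, ‖u - v‖ ≤ 1 / 8) {B : ℝ}
    (hB : ∀ u ∈ T, ∑ i ∈ I, (inner ℝ u (x i) : ℝ) ^ 2 ≤ B) (v : E) :
    ∑ i ∈ I, (inner ℝ v (x i) : ℝ) ^ 2 ≤ 4 * B * ‖v‖ ^ 2 := by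
  set q : E → ℝ := fun v => ∑ i ∈ I, (inner ℝ v (x i) : ℝ) ^ 2
  refine sum_inner_sq_le_of_le_sphere I x (fun w hw => ?_) v
  obtain ⟨m, hm, hmax⟩ := (isCompact_sphere (0 : E) 1).exists_isMaxOn (f := q)
    ⟨w, mem_sphere_zero_iff_norm.2 hw⟩ (by fun_prop)
  rw [mem_sphere_zero_iff_norm] at hm
  have hle (u : E) (hu : ‖u‖ = 1) : q u ≤ q m := hmax (mem_sphere_zero_iff_norm.2 hu)
  obtain ⟨u, hu, hmu⟩ := hT m hm
  have hsplit : q m ≤ 2 * q u + 2 * q (m - u) := by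
    simpa only [add_sub_cancel] using sum_inner_add_sq_le I x u (m - u)
  have hrest : q (m - u) ≤ q m * (1 / 8) ^ 2 :=
    (sum_inner_sq_le_of_le_sphere I x hle (m - u)).trans (by gcongr)
  have hnonneg : 0 ≤ q u := Finset.sum_nonneg fun i _ => sq_nonneg _
  linarith [hB u hu, hle w hw]

lemma measure_pi_lt_sum_inner_sq_le [FiniteDimensional ℝ E] [MeasurableSpace E] [BorelSpace E]
    [Fintype ι] {u : E} (hu : ‖u‖ = 1) :
    (Measure.pi fun _ : ι => stdObs E) {x | 44 * (I.card : ℝ) < ∑ i ∈ I, (inner ℝ u (x i).1) ^ 2}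
      ≤ ENNReal.ofReal (Real.exp (-(10 * I.card))) := by
  have hexp : ∫⁻ z, ENNReal.ofReal (Real.exp ((inner ℝ u z.1) ^ 2 / 4)) ∂stdObs E
      ≤ ENNReal.ofReal (Real.exp 1) := by
    have hmap := stdObs_map_inner_fst u
    rw [show ‖u‖₊ = 1 from NNReal.eq hu, one_pow] at hmap
    have h := lintegral_exp_sq_div_four_gaussianReal_le
    rwa [← hmap, lintegral_map (by fun_prop) (by fun_prop)] at h
  refine (measure_mono fun x hx => ?_).trans (measure_pi_lt_sum_le_of_lintegral_exp_le
    (fun _ => stdObs E) I (g := fun _ z => (inner ℝ u z.1) ^ 2 / 4) (b := fun _ => 1)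
    (fun _ => by fun_prop) (fun _ _ => hexp) (10 * I.card))
  simp only [Set.mem_ofPred_eq, ← Finset.sum_div, Finset.sum_const, nsmul_eq_mul] at hx ⊢
  linarith

end SecondMoment

section Tails

variable {E : Type*} [NormedAddCommGroup E] [InnerProductSpace ℝ E] {ι : Type*} (I : Finset ι)

lemma hits_lt_abs_inner_le (v : E) {κ : ℝ} (hκ : 0 < κ) (x : ι → E × ℝ) :
    hits I {z | κ < |(inner ℝ v z.1 : ℝ)|} x ≤ (∑ i ∈ I, (inner ℝ v (x i).1 : ℝ) ^ 2) / κ ^ 2 := by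
  rw [hits, Finset.sum_div]
  refine Finset.sum_le_sum fun i _ => Set.indicator_apply_le' (fun (hi : κ < _) => ?_)
    fun _ => by positivity
  rw [Pi.one_apply, one_le_div (by positivity), ← sq_abs (inner ℝ v (x i).1)]
  gcongr

variable [FiniteDimensional ℝ E] [MeasurableSpace E] [BorelSpace E] [Fintype ι] {s θ : ℝ}

lemma measure_pi_lt_hits_tiltSet_le {u : E} (hu : ‖u‖ = 1) (hθ : 0 < θ) (hθ1 : θ ≤ 1) (a : ℝ) :
    (Measure.pi fun _ : ι => stdObs E)
      {x | I.card * (tiltProb s + θ) + a / θ < hits I (tiltSet s u) x}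
      ≤ ENNReal.ofReal (Real.exp (-a)) := by
  refine le_trans (measure_mono fun x hx => ?_) (measure_pi_lt_hits_le I _
    (measurableSet_tiltSet s u) (fun _ _ => (stdObs_real_tiltSet s hu).le) hθ hθ1 a)
  rw [Set.mem_ofPred_eq] at hx ⊢
  refine hx.trans_le' ?_
  gcongr
  exact mul_le_of_le_one_right hθ.le (tiltProb_le_one s)

lemma measure_pi_lt_hits_tiltSet_sub_le (hs : 0 ≤ s) (hs1 : s ≤ 1) (k : ℕ) {u v : E}
    (hu : ‖u‖ = 1) (hv : ‖v‖ = 1) (huv : ‖v - u‖ ≤ 2 * ((8 : ℝ) ^ k)⁻¹) (hθ : 0 < θ) (hθ1 : θ ≤ 1)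
    (a : ℝ) :
    (Measure.pi fun _ : ι => stdObs E)
      {x | I.card * (θ * (14 * ((4 : ℝ) ^ k)⁻¹)) + a / θ
        < hits I (tiltSet s v) x - hits I (tiltSet s u) x}
      ≤ ENNReal.ofReal (Real.exp (-a)) := by
  have hmeas (w : E) : Measurable ((tiltSet s w).indicator (1 : E × ℝ → ℝ)) :=
    measurable_one.indicator (measurableSet_tiltSet s w)
  have hmean : ∫ z, ((tiltSet s v).indicator 1 z - (tiltSet s u).indicator 1 z : ℝ) ∂stdObs E
      ≤ 0 := by
    rw [integral_sub ((integrable_const 1).indicator (measurableSet_tiltSet s v))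
      ((integrable_const 1).indicator (measurableSet_tiltSet s u)),
      integral_indicator_one (measurableSet_tiltSet s v),
      integral_indicator_one (measurableSet_tiltSet s u), stdObs_real_tiltSet s hu,
      stdObs_real_tiltSet s hv, sub_self]
  have hvar : ∫ z, ((tiltSet s v).indicator 1 z - (tiltSet s u).indicator 1 z : ℝ) ^ 2 ∂stdObs E
      ≤ 14 * ((4 : ℝ) ^ k)⁻¹ := by
    refine (integral_sq_indicator_tiltSet_sub_le hs hs1 (κ := ((4 : ℝ) ^ k)⁻¹) (by positivity) hv hu
      huv).trans_eq ?_
    have h8 : (8 : ℝ) ^ k = 2 ^ k * 2 ^ k * 2 ^ k := by rw [← mul_pow, ← mul_pow]; norm_num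
    have h4 : (4 : ℝ) ^ k = 2 ^ k * 2 ^ k := by rw [← mul_pow]; norm_num
    rw [h8, h4]
    field_simp
    norm_num
  have hbound (z : E × ℝ) :
      |((tiltSet s v).indicator 1 z - (tiltSet s u).indicator 1 z : ℝ)| ≤ 1 := by
    by_cases h : z ∈ tiltSet s v <;> by_cases h' : z ∈ tiltSet s u <;> simp [h, h']
  simpa only [hits, Pi.sub_apply, Finset.sum_sub_distrib, zero_add, Finset.sum_const,
    nsmul_eq_mul] using measure_pi_lt_sum_le_of_integral_sq_le _ I (m := fun _ => 0)
      (v := fun _ => 14 * ((4 : ℝ) ^ k)⁻¹) (fun _ => (hmeas v).sub (hmeas u)) (fun _ => hbound)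
      (fun _ _ => hmean) (fun _ _ => hvar) hθ hθ1 a

end Tails

lemma sum_range_chaining_weight_le (K : ℕ) :
    ∑ k ∈ Finset.range K, (7 * (k : ℝ) + 26) * ((2 : ℝ) ^ k)⁻¹ ≤ 66 := by
  have h : ∑ k ∈ Finset.range K, (7 * (k : ℝ) + 26) * ((2 : ℝ) ^ k)⁻¹
      = 66 - (14 * K + 66) * ((2 : ℝ) ^ K)⁻¹ := by
    induction K with
    | zero => simp
    | succ K ih =>
      rw [Finset.sum_range_succ, ih, pow_succ]
      push_cast
      field_simp
      ring
  rw [h, sub_le_self_iff]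
  positivity

lemma sum_range_exp_neg_add_le (a : ℝ) (K : ℕ) :
    ∑ k ∈ Finset.range K, Real.exp (-(k + a)) ≤ 2 * Real.exp (-a) := by
  have hterm (k : ℕ) : Real.exp (-(k + a)) ≤ Real.exp (-a) * (1 / 2) ^ k := by
    have hbase : Real.exp (-1) ≤ 1 / 2 := by
      rw [Real.exp_neg, ← one_div]
      exact one_div_le_one_div_of_le two_pos (by linarith [Real.add_one_le_exp (1 : ℝ)])
    rw [neg_add_rev, Real.exp_add, ← mul_neg_one (k : ℝ), Real.exp_nat_mul]
    gcongr
  calc ∑ k ∈ Finset.range K, Real.exp (-(k + a))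
      ≤ Real.exp (-a) * ∑ k ∈ Finset.range K, (1 / 2) ^ k :=
        (Finset.sum_le_sum fun k _ => hterm k).trans_eq (Finset.mul_sum ..).symm
    _ ≤ Real.exp (-a) * 2 := by
        gcongr
        exact sum_geometric_two_le K
    _ = _ := mul_comm _ _

section Chaining

variable {E : Type*} [NormedAddCommGroup E] [InnerProductSpace ℝ E] {ι : Type*}

/-- The deterministic input of the chaining argument along the nets `T k`, `k ≤ K`. Here `ρ` stands
for `√(d / N)` with `d` the dimension and `N = #I`, so that `N ρ = √(d N)` is the order of the
fluctuations of the counts. -/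
structure ChainBounds (T : ℕ → Finset E) (I : Finset ι) (s ρ : ℝ) (K : ℕ) (x : ι → E × ℝ) :
    Prop where
  coarse : ∀ u ∈ T 0, hits I (tiltSet s u) x ≤ I.card * tiltProb s + 13 * (I.card * ρ)
  increment : ∀ k < K, ∀ u ∈ T k, ∀ v ∈ T (k + 1), ‖v - u‖ ≤ 2 * ((8 : ℝ) ^ k)⁻¹ →
    hits I (tiltSet s v) x - hits I (tiltSet s u) x
      ≤ (7 * k + 26) * ((2 : ℝ) ^ k)⁻¹ * (I.card * ρ)
  boundary : ∀ u ∈ T K, hits I (tiltBoundary s ((4 : ℝ) ^ K)⁻¹ u) x ≤ 36 * (I.card * ρ)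
  secondMoment : ∀ u ∈ T 1, ∑ i ∈ I, (inner ℝ u (x i).1) ^ 2 ≤ 44 * I.card

variable {T : ℕ → Finset E} {I : Finset ι} {s ρ : ℝ} {K : ℕ}
  {x : ι → E × ℝ}

lemma ChainBounds.hits_tiltSet_net_le (h : ChainBounds T I s ρ K x) (hρ : 0 ≤ ρ) {v : ℕ → E}
    (hv : ∀ k, v k ∈ T k) {u : E} (hvu : ∀ k, ‖u - v k‖ ≤ ((8 : ℝ) ^ k)⁻¹) :
    hits I (tiltSet s (v K)) x ≤ I.card * tiltProb s + 79 * (I.card * ρ) := by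
  have hstep (k : ℕ) (hk : k < K) : hits I (tiltSet s (v (k + 1))) x - hits I (tiltSet s (v k)) x
      ≤ (7 * k + 26) * ((2 : ℝ) ^ k)⁻¹ * (I.card * ρ) := by
    refine h.increment k hk _ (hv k) _ (hv (k + 1)) ?_
    calc ‖v (k + 1) - v k‖ ≤ ‖u - v (k + 1)‖ + ‖u - v k‖ := by
          rw [norm_sub_rev u (v (k + 1))]
          exact norm_sub_le_norm_sub_add_norm_sub _ _ _
      _ ≤ ((8 : ℝ) ^ k)⁻¹ + ((8 : ℝ) ^ k)⁻¹ := by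
          refine add_le_add ((hvu _).trans ?_) (hvu k)
          gcongr <;> norm_num
      _ = 2 * ((8 : ℝ) ^ k)⁻¹ := (two_mul _).symm
  have htele : hits I (tiltSet s (v K)) x - hits I (tiltSet s (v 0)) x ≤ 66 * (I.card * ρ) := by
    rw [← Finset.sum_range_sub (fun k => hits I (tiltSet s (v k)) x)]
    refine (Finset.sum_le_sum fun k hk => hstep k (Finset.mem_range.1 hk)).trans ?_
    rw [← Finset.sum_mul]
    gcongr
    exact sum_range_chaining_weight_le K
  linarith [h.coarse _ (hv 0)]

variable [FiniteDimensional ℝ E]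

lemma ChainBounds.hits_lt_abs_inner_net_le (h : ChainBounds T I s ρ K x) (hT : IsSphereNetSeq T)
    {u : E} (hu : ‖u‖ ≤ ((8 : ℝ) ^ K)⁻¹) :
    hits I {z | ((4 : ℝ) ^ K)⁻¹ < |(inner ℝ u z.1 : ℝ)|} x ≤ 176 * (I.card * ((4 : ℝ) ^ K)⁻¹) := by
  have hop := sum_inner_sq_le_of_net I (fun i => (x i).1) (T 1)
    (fun u hu => by simpa using hT.exists_near 1 u hu) h.secondMoment u
  have h8 : (((8 : ℝ) ^ K)⁻¹) ^ 2 = ((4 : ℝ) ^ K)⁻¹ * (((4 : ℝ) ^ K)⁻¹) ^ 2 := by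
    rw [← inv_pow, ← inv_pow, ← pow_mul, ← pow_mul, mul_comm K 2, pow_mul, pow_mul, ← mul_pow]
    norm_num
  refine (hits_lt_abs_inner_le I u (by positivity) x).trans ?_
  rw [div_le_iff₀ (by positivity)]
  calc ∑ i ∈ I, (inner ℝ u (x i).1) ^ 2 ≤ 4 * (44 * I.card) * (((8 : ℝ) ^ K)⁻¹) ^ 2 :=
        hop.trans (by gcongr)
    _ = 176 * (I.card * ((4 : ℝ) ^ K)⁻¹) * (((4 : ℝ) ^ K)⁻¹) ^ 2 := by rw [h8]; ring

lemma ChainBounds.hits_tiltSet_le (h : ChainBounds T I s ρ K x) (hT : IsSphereNetSeq T)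
    (hs : 0 ≤ s) (hρ : 0 ≤ ρ) (hK : I.card * ((4 : ℝ) ^ K)⁻¹ ≤ 4 * (I.card * ρ)) {u : E}
    (hu : ‖u‖ = 1) : hits I (tiltSet s u) x ≤ I.card * tiltProb s + 900 * (I.card * ρ) := by
  choose v hv hvu using fun k => hT.exists_near k u hu
  have hsub : tiltSet s u ⊆ tiltSet s (v K) ∪ (tiltBoundary s ((4 : ℝ) ^ K)⁻¹ (v K)
      ∪ {z | ((4 : ℝ) ^ K)⁻¹ < |(inner ℝ (u - v K) z.1 : ℝ)|}) :=
    Set.sdiff_subset_iff.1 (tiltSet_diff_subset hs _ u (v K))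
  have hsplit := (hits_mono I hsub x).trans ((hits_union_le I _ _ x).trans
    (add_le_add_right (hits_union_le I _ _ x) _))
  have hcard : 0 ≤ I.card * ρ := by positivity
  linarith [h.hits_tiltSet_net_le hρ hv hvu, h.boundary _ (hv K),
    h.hits_lt_abs_inner_net_le hT (hvu K)]

end Chaining

section Deviation

open Module

variable {E : Type*} [NormedAddCommGroup E] [InnerProductSpace ℝ E] [FiniteDimensional ℝ E]
  [MeasurableSpace E] [BorelSpace E] {ι : Type*} [Fintype ι] {T : ℕ → Finset E} {I : Finset ι}
  {s ρ : ℝ} {K : ℕ}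

lemma measure_exists_net_lt_hits_tiltSet_le (hT : IsSphereNetSeq T) (hE : 1 ≤ finrank ℝ E)
    (hρ : 0 < ρ) (hρ1 : ρ ≤ 1) (hIρ : I.card * ρ ^ 2 = finrank ℝ E) :
    (Measure.pi fun _ : ι => stdObs E)
      {x | ∃ u ∈ T 0, I.card * tiltProb s + 13 * (I.card * ρ) < hits I (tiltSet s u) x}
      ≤ ENNReal.ofReal (Real.exp (-10)) := by
  have hE' : (1 : ℝ) ≤ finrank ℝ E := by exact_mod_cast hE
  have hthr : I.card * (tiltProb s + ρ) + 12 * finrank ℝ E / ρ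
      = I.card * tiltProb s + 13 * (I.card * ρ) := by
    rw [← hIρ]
    field_simp
    ring
  refine (measure_exists_mem_le _ (T 0) (fun u => {x | _ < hits I (tiltSet s u) x})
    (fun u hu => hthr ▸ measure_pi_lt_hits_tiltSet_le I (hT.norm_eq_one hu) hρ hρ1 _)
    (hT.card_le 0)).trans (ENNReal.ofReal_le_ofReal (Real.exp_le_exp.2 ?_))
  push_cast
  linarith

lemma measure_exists_net_lt_hits_tiltSet_sub_le (hT : IsSphereNetSeq T) (hE : 1 ≤ finrank ℝ E)
    (hs : 0 ≤ s) (hs1 : s ≤ 1) (hρ : 0 < ρ) (hIρ : I.card * ρ ^ 2 = finrank ℝ E) (k : ℕ)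
    (hk : 2 ^ k * ρ ≤ 1) :
    (Measure.pi fun _ : ι => stdObs E)
      {x | ∃ p ∈ (T k ×ˢ T (k + 1)).filter fun p => ‖p.2 - p.1‖ ≤ 2 * ((8 : ℝ) ^ k)⁻¹,
        (7 * k + 26) * ((2 : ℝ) ^ k)⁻¹ * (I.card * ρ)
          < hits I (tiltSet s p.2) x - hits I (tiltSet s p.1) x}
      ≤ ENNReal.ofReal (Real.exp (-(k + 5))) := by
  have hE' : (1 : ℝ) ≤ finrank ℝ E := by exact_mod_cast hE
  have hthr : I.card * (2 ^ k * ρ * (14 * ((4 : ℝ) ^ k)⁻¹))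
      + (7 * k + 12) * finrank ℝ E / (2 ^ k * ρ)
      = (7 * k + 26) * ((2 : ℝ) ^ k)⁻¹ * (I.card * ρ) := by
    rw [← hIρ, show (4 : ℝ) ^ k = 2 ^ k * 2 ^ k by rw [← mul_pow]; norm_num]
    field_simp
    ring
  set P := (T k ×ˢ T (k + 1)).filter fun p => ‖p.2 - p.1‖ ≤ 2 * ((8 : ℝ) ^ k)⁻¹ with hP
  have hcard : (P.card : ℝ)
      ≤ Real.exp (finrank ℝ E * (3 * k + 2) + finrank ℝ E * (3 * (k + 1) + 2)) := by
    rw [Real.exp_add]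
    calc (P.card : ℝ) ≤ (T k ×ˢ T (k + 1)).card := by exact_mod_cast Finset.card_filter_le _ _
      _ = (T k).card * (T (k + 1)).card := by rw [Finset.card_product, Nat.cast_mul]
      _ ≤ _ := by
          gcongr
          · exact hT.card_le k
          · exact_mod_cast hT.card_le (k + 1)
  have htail (p : E × E) (hp : p ∈ P) := by
    simp only [hP, Finset.mem_filter, Finset.mem_product] at hp
    exact hthr ▸ measure_pi_lt_hits_tiltSet_sub_le (ι := ι) I hs hs1 k (hT.norm_eq_one hp.1.1)
      (hT.norm_eq_one hp.1.2) hp.2 (by positivity) hk ((7 * k + 12) * finrank ℝ E)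
  have hunion := measure_exists_mem_le _ P
    (fun p => {x | _ < hits I (tiltSet s p.2) x - hits I (tiltSet s p.1) x}) htail hcard
  refine hunion.trans (ENNReal.ofReal_le_ofReal (Real.exp_le_exp.2 ?_))
  nlinarith [(Nat.cast_nonneg k : (0 : ℝ) ≤ k)]

lemma measure_exists_net_lt_hits_tiltBoundary_le (hT : IsSphereNetSeq T) (hE : 1 ≤ finrank ℝ E)
    (hs : 0 ≤ s) (hs1 : s ≤ 1) (hρ : 0 < ρ) (hIρ : I.card * ρ ^ 2 = finrank ℝ E)
    (hK : 2 ^ K * ρ ≤ 1) (hIK : I.card * ((4 : ℝ) ^ K)⁻¹ ≤ 4 * (I.card * ρ)) :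
    (Measure.pi fun _ : ι => stdObs E)
      {x | ∃ u ∈ T K, 36 * (I.card * ρ) < hits I (tiltBoundary s ((4 : ℝ) ^ K)⁻¹ u) x}
      ≤ ENNReal.ofReal (Real.exp (-10)) := by
  have hE' : (1 : ℝ) ≤ finrank ℝ E := by exact_mod_cast hE
  have hthr : I.card * (3 * ((4 : ℝ) ^ K)⁻¹ + 2 ^ K * ρ * (3 * ((4 : ℝ) ^ K)⁻¹))
      + (7 * K + 12) * finrank ℝ E / (2 ^ K * ρ) ≤ 36 * (I.card * ρ) := by
    have hbern : 7 * (K : ℝ) + 12 ≤ 12 * 2 ^ K := by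
      linarith [one_add_mul_sub_le_pow (by norm_num : (-1 : ℝ) ≤ 2) K,
        (Nat.cast_nonneg K : (0 : ℝ) ≤ K)]
    have hdev : (7 * K + 12) * finrank ℝ E / (2 ^ K * ρ) ≤ 12 * (I.card * ρ) := by
      rw [← hIρ, div_le_iff₀ (by positivity)]
      calc (7 * K + 12) * (I.card * ρ ^ 2) ≤ 12 * 2 ^ K * (I.card * ρ ^ 2) := by gcongr
        _ = 12 * (I.card * ρ) * (2 ^ K * ρ) := by ring
    have hmean : (I.card : ℝ) * (3 * ((4 : ℝ) ^ K)⁻¹ + 2 ^ K * ρ * (3 * ((4 : ℝ) ^ K)⁻¹))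
        ≤ I.card * (3 * ((4 : ℝ) ^ K)⁻¹ + 1 * (3 * ((4 : ℝ) ^ K)⁻¹)) := by gcongr
    linarith
  refine (measure_exists_mem_le _ (T K)
    (fun u => {x | _ < hits I (tiltBoundary s ((4 : ℝ) ^ K)⁻¹ u) x})
    (a := (7 * K + 12) * finrank ℝ E) (fun u hu => ?_)
    (hT.card_le K)).trans (ENNReal.ofReal_le_ofReal (Real.exp_le_exp.2 ?_))
  · exact (measure_mono fun x hx => hthr.trans_lt hx).trans (measure_pi_lt_hits_le I _
      (measurableSet_tiltBoundary s _ u)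
      (fun _ _ => stdObs_real_tiltBoundary_le hs hs1 (by positivity) (hT.norm_eq_one hu))
      (by positivity) hK _)
  · nlinarith [(Nat.cast_nonneg K : (0 : ℝ) ≤ K)]

lemma measure_exists_net_lt_sum_inner_sq_le (hT : IsSphereNetSeq T) (hE : 1 ≤ finrank ℝ E)
    (hI : finrank ℝ E ≤ I.card) :
    (Measure.pi fun _ : ι => stdObs E)
      {x | ∃ u ∈ T 1, 44 * (I.card : ℝ) < ∑ i ∈ I, (inner ℝ u (x i).1) ^ 2}
      ≤ ENNReal.ofReal (Real.exp (-5)) := by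
  have hE' : (1 : ℝ) ≤ finrank ℝ E := by exact_mod_cast hE
  have hI' : (finrank ℝ E : ℝ) ≤ I.card := by exact_mod_cast hI
  have hunion := measure_exists_mem_le (Measure.pi fun _ : ι => stdObs E) (T 1)
    (fun u => {x | _ < ∑ i ∈ I, (inner ℝ u (x i).1) ^ 2})
    (fun u hu => measure_pi_lt_sum_inner_sq_le I (hT.norm_eq_one hu)) (hT.card_le 1)
  refine hunion.trans (ENNReal.ofReal_le_ofReal (Real.exp_le_exp.2 ?_))
  push_cast
  linarith

lemma measure_not_chainBounds_le (hT : IsSphereNetSeq T) (hE : 1 ≤ finrank ℝ E)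
    (hI : finrank ℝ E ≤ I.card) (hs : 0 ≤ s) (hs1 : s ≤ 1) (hρ : 0 < ρ)
    (hIρ : I.card * ρ ^ 2 = finrank ℝ E) (hK : 2 ^ K * ρ ≤ 1)
    (hIK : I.card * ((4 : ℝ) ^ K)⁻¹ ≤ 4 * (I.card * ρ)) :
    (Measure.pi fun _ : ι => stdObs E) {x | ¬ ChainBounds T I s ρ K x}
      ≤ ENNReal.ofReal (1 / 20) := by
  have hk (k : ℕ) (hkK : k ≤ K) : 2 ^ k * ρ ≤ 1 :=
    hK.trans' (by gcongr; norm_num)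
  have hcoarse := measure_exists_net_lt_hits_tiltSet_le (s := s) hT hE hρ
    (by simpa using hk 0 (Nat.zero_le K)) hIρ
  have hboundary := measure_exists_net_lt_hits_tiltBoundary_le hT hE hs hs1 hρ hIρ hK hIK
  have hmoment := measure_exists_net_lt_sum_inner_sq_le hT hE hI
  have hincr := (measure_biUnion_finset_le (Finset.range K) _).trans
    ((Finset.sum_le_sum fun k hkK => measure_exists_net_lt_hits_tiltSet_sub_le hT hE hs hs1 hρ hIρ k
      (hk k (Finset.mem_range.1 hkK).le)).trans_eq
      (ENNReal.ofReal_sum_of_nonneg fun k _ => (Real.exp_pos _).le).symm)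
  refine (measure_mono fun x hx => ?_).trans ((measure_union_le _ _).trans ((add_le_add
    ((measure_union_le _ _).trans (add_le_add ((measure_union_le _ _).trans
      (add_le_add hcoarse hincr)) hboundary)) hmoment).trans ?_))
  · by_contra hout
    simp only [Set.mem_union, Set.mem_iUnion, Set.mem_ofPred_eq, Finset.mem_filter,
      Finset.mem_product, Finset.mem_range, not_or, not_exists, not_and, not_lt, Prod.forall,
      and_imp] at hout
    obtain ⟨⟨⟨hc, hi⟩, hb⟩, hm⟩ := hout
    exact hx ⟨hc, fun k hk u hu v hv h => hi k hk u v hu hv h, hb, hm⟩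
  · have hgeom := sum_range_exp_neg_add_le 5 K
    have h10 : Real.exp (-10) ≤ Real.exp (-5) := Real.exp_le_exp.2 (by norm_num)
    have h5 : Real.exp (-5) ≤ 1 / 100 := by
      rw [Real.exp_neg, ← one_div]
      exact one_div_le_one_div_of_le (by norm_num)
        ((pow_le_exp_natCast 5).trans' (by norm_num))
    rw [← ENNReal.ofReal_add (by positivity) (by positivity),
      ← ENNReal.ofReal_add (by positivity) (by positivity),
      ← ENNReal.ofReal_add (by positivity) (by positivity)]
    exact ENNReal.ofReal_le_ofReal (by linarith)

lemma exists_chain_scale {D N : ℝ} (hD : 1 ≤ D) (hDN : D ≤ N) :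
    ∃ K : ℕ, 2 ^ K * √(D / N) ≤ 1 ∧ N * ((4 : ℝ) ^ K)⁻¹ ≤ 4 * (N * √(D / N)) := by
  have hD0 : 0 < D := one_pos.trans_le hD
  have hN : 0 < N := hD0.trans_le hDN
  obtain ⟨K, hK, hK'⟩ := exists_nat_pow_near ((one_le_div hD0).2 hDN) (by norm_num : (1 : ℝ) < 4)
  rw [le_div_iff₀ hD0] at hK
  rw [div_lt_iff₀ hD0, pow_succ] at hK'
  refine ⟨K, ?_, ?_⟩
  · rw [← Real.sqrt_sq (show (0 : ℝ) ≤ 2 ^ K by positivity), ← Real.sqrt_mul (by positivity),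
      Real.sqrt_le_one, ← pow_mul, mul_comm K, pow_mul, mul_div_assoc', div_le_one hN]
    norm_num
    exact hK
  · have hDρ : D ≤ N * √(D / N) := by
      have hratio : D / N ≤ √(D / N) :=
        Real.le_sqrt_of_sq_le (by
          rw [sq]; exact mul_le_of_le_one_left (by positivity) ((div_le_one hN).2 hDN))
      calc D = N * (D / N) := by field_simp
        _ ≤ _ := by gcongr
    rw [← div_eq_mul_inv, div_le_iff₀ (by positivity)]
    nlinarith [show (0 : ℝ) < 4 ^ K by positivity]

/- The uniform deviation of the counts over all directions is of order `√(dN)`, without the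
logarithmic factor of a single net: the chain stops at a scale where the boundary strips, of measure
`4⁻ᴷ ≈ d / N`, are already negligible. -/
theorem measure_exists_lt_hits_tiltSet_le (hE : 1 ≤ finrank ℝ E) (I : Finset ι)
    (hI : finrank ℝ E ≤ I.card) (hs : 0 ≤ s) (hs1 : s ≤ 1) :
    (Measure.pi fun _ : ι => stdObs E)
      {x | ∃ u : E, ‖u‖ = 1 ∧
        I.card * tiltProb s + 900 * √(finrank ℝ E * I.card) < hits I (tiltSet s u) x}
      ≤ ENNReal.ofReal (1 / 20) := by
  obtain ⟨T, hT⟩ := exists_isSphereNetSeq E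
  have hE' : (1 : ℝ) ≤ finrank ℝ E := by exact_mod_cast hE
  have hI' : (finrank ℝ E : ℝ) ≤ I.card := by exact_mod_cast hI
  have hI0 : (0 : ℝ) < I.card := by linarith
  obtain ⟨K, hK, hIK⟩ := exists_chain_scale hE' hI'
  have hIρ : I.card * √((finrank ℝ E : ℝ) / I.card) ^ 2 = finrank ℝ E := by
    rw [Real.sq_sqrt (by positivity)]
    field_simp
  have hR : I.card * √((finrank ℝ E : ℝ) / I.card) = √(finrank ℝ E * I.card) := by
    nth_rewrite 2 [← hIρ]
    rw [show (I.card * √((finrank ℝ E : ℝ) / I.card) ^ 2 * I.card : ℝ)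
      = (I.card * √((finrank ℝ E : ℝ) / I.card)) ^ 2 by ring, Real.sqrt_sq (by positivity)]
  refine (measure_mono ?_).trans
    (measure_not_chainBounds_le hT hE hI hs hs1 (by positivity) hIρ hK hIK)
  rintro x ⟨u, hu, hx⟩ hchain
  exact hx.not_ge (hR ▸ hchain.hits_tiltSet_le hT hs (by positivity) hIK hu)

end Deviation

/-! ### Measurable selection of a deepest vector -/

section Selection

open Filter Metric TopologicalSpace

variable {Z : Type*} [MeasurableSpace Z]

lemma exists_measurable_nat_seq {P : ℕ → Z → ℕ → Prop} {R : ℕ → ℕ → ℕ → Prop}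
    (hP : ∀ k j, MeasurableSet {z | P k z j}) (hzero : ∀ z, ∃ j, P 0 z j)
    (hsucc : ∀ k z i, P k z i → ∃ j, P (k + 1) z j ∧ R k i j) :
    ∃ f : ℕ → Z → ℕ, (∀ k, Measurable (f k)) ∧ (∀ k z, P k z (f k z)) ∧
      ∀ k z, R k (f k z) (f (k + 1) z) := by
  classical
  let A (k : ℕ) : Type _ := {f : Z → ℕ // Measurable f ∧ ∀ z, P k z (f z)}
  have hstep (k : ℕ) (f : A k) : ∃ g : A (k + 1), ∀ z, R k (f.1 z) (g.1 z) := by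
    obtain ⟨f, hf, hfP⟩ := f
    have hex (z : Z) := hsucc k z (f z) (hfP z)
    have hmeas (j : ℕ) : MeasurableSet {z | P (k + 1) z j ∧ R k (f z) j} :=
      (hP (k + 1) j).inter (hf (MeasurableSet.of_discrete (s := {i | R k i j})))
    exact ⟨⟨fun z => Nat.find (hex z), measurable_find hex hmeas,
      fun z => (Nat.find_spec (hex z)).1⟩, fun z => (Nat.find_spec (hex z)).2⟩
  choose g hg using hstep
  let f (k : ℕ) : A k := Nat.rec ⟨fun z => Nat.find (hzero z), measurable_find hzero (hP 0),
    fun z => Nat.find_spec (hzero z)⟩ g k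
  exact ⟨fun k => (f k).1, fun k => (f k).2.1, fun k => (f k).2.2, fun k => hg k (f k)⟩

theorem exists_measurable_selection {E : Type*} [MetricSpace E] [CompleteSpace E]
    [SecondCountableTopology E] [MeasurableSpace E] [BorelSpace E] [Nonempty E] (F : Z → Set E)
    (hF : ∀ z, IsClosed (F z)) (hne : ∀ z, (F z).Nonempty)
    (hmeas : ∀ q r, MeasurableSet {z | ∃ x ∈ closedBall q r, x ∈ F z}) :
    ∃ M : Z → E, Measurable M ∧ ∀ z, M z ∈ F z := by
  set q : ℕ → E := denseSeq E
  have hnear (x : E) (k : ℕ) : ∃ j, dist x (q j) < (1 / 2) ^ k :=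
    (denseRange_denseSeq E).exists_dist_lt x (by positivity)
  obtain ⟨f, hf, hfF, hff⟩ := exists_measurable_nat_seq
    (P := fun k z j => ∃ x ∈ closedBall (q j) ((1 / 2) ^ k), x ∈ F z)
    (R := fun k i j => dist (q i) (q j) ≤ 2 * (1 / 2) ^ k) (fun k j => hmeas _ _)
    (fun z => by
      obtain ⟨x, hx⟩ := hne z
      obtain ⟨j, hj⟩ := hnear x 0
      exact ⟨j, x, mem_closedBall.2 hj.le, hx⟩)
    (fun k z i ⟨x, hx, hxF⟩ => by
      obtain ⟨j, hj⟩ := hnear x (k + 1)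
      refine ⟨j, ⟨x, mem_closedBall.2 hj.le, hxF⟩, ?_⟩
      have hpow : (1 / 2 : ℝ) ^ (k + 1) ≤ (1 / 2) ^ k :=
        pow_le_pow_of_le_one (by norm_num) (by norm_num) k.le_succ
      linarith [mem_closedBall'.1 hx, dist_triangle (q i) x (q j)])
  choose M hM using fun z => cauchySeq_tendsto_of_complete
    (cauchySeq_of_le_geometric (1 / 2) 2 (by norm_num) fun k => hff k z)
  refine ⟨M, measurable_of_tendsto_metrizable (f := fun k z => q (f k z))
    (fun k => (measurable_of_countable q).comp (hf k)) (tendsto_pi_nhds.2 hM), fun z => ?_⟩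
  choose x hx hxF using fun k => hfF k z
  refine (hF z).mem_of_tendsto ((tendsto_iff_of_dist ?_).1 (hM z)) (Eventually.of_forall hxF)
  exact squeeze_zero (fun _ => dist_nonneg) (fun k => mem_closedBall'.1 (hx k))
    (tendsto_pow_atTop_nhds_zero_of_lt_one (by norm_num) (by norm_num))

end Selection

lemma isClosed_exists_mem {X Z : Type*} [TopologicalSpace X] [TopologicalSpace Z] {K : Set X}
    (hK : IsCompact K) {C : Set (X × Z)} (hC : IsClosed C) :
    IsClosed {z | ∃ x ∈ K, (x, z) ∈ C} := by
  have := isCompact_iff_compactSpace.1 hK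
  have hpre : IsClosed ((fun p : K × Z => (p.1.1, p.2)) ⁻¹' C) := hC.preimage (by fun_prop)
  convert isClosedMap_snd_of_compactSpace _ hpre using 1
  ext z
  simp

section FiniteValued

open Metric

variable {E Z : Type*} [MetricSpace E] [ProperSpace E] [TopologicalSpace Z] [MeasurableSpace Z]
  [BorelSpace Z] {f : E × Z → ℝ}

lemma measurableSet_exists_le (hf : UpperSemicontinuous f) (a : ℝ) :
    MeasurableSet {z | ∃ x, a ≤ f (x, z)} := by
  rcases isEmpty_or_nonempty E with hE | ⟨⟨q⟩⟩
  · simp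
  have hunion : {z | ∃ x, a ≤ f (x, z)} = ⋃ m : ℕ, {z | ∃ x ∈ closedBall q m, a ≤ f (x, z)} := by
    ext z
    simp only [Set.mem_ofPred_eq, Set.mem_iUnion]
    refine ⟨fun ⟨x, hx⟩ => ?_, fun ⟨_, x, _, hx⟩ => ⟨x, hx⟩⟩
    obtain ⟨m, hm⟩ := exists_nat_ge (dist x q)
    exact ⟨m, x, mem_closedBall.2 hm, hx⟩
  rw [hunion]
  exact MeasurableSet.iUnion fun m => (isClosed_exists_mem (isCompact_closedBall q m)
    (upperSemicontinuous_iff_isClosed_preimage.1 hf a)).measurableSet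

lemma measurableSet_forall_le (hf : UpperSemicontinuous f) (hfin : (Set.range f).Finite) (a : ℝ) :
    MeasurableSet {z | ∀ x, f (x, z) ≤ a} := by
  have hcompl : {z | ∀ x, f (x, z) ≤ a}
      = (⋃ b ∈ Set.range f ∩ Set.Ioi a, {z | ∃ x, b ≤ f (x, z)})ᶜ := by
    ext z
    simp only [Set.mem_ofPred_eq, Set.mem_compl_iff, Set.mem_iUnion, Set.mem_inter_iff,
      Set.mem_Ioi, not_exists, not_le]
    refine ⟨fun h b hb x => (h x).trans_lt hb.2, fun h x => ?_⟩
    by_contra! hx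
    exact (h _ ⟨⟨_, rfl⟩, hx⟩ x).false
  rw [hcompl]
  exact ((hfin.inter_of_left _).measurableSet_biUnion
    fun b _ => measurableSet_exists_le hf b).compl

theorem exists_measurable_forall_le_of_finite_range [Nonempty E] [MeasurableSpace E] [BorelSpace E]
    (hf : UpperSemicontinuous f) (hfin : (Set.range f).Finite) :
    ∃ M : Z → E, Measurable M ∧ ∀ z x, f (x, z) ≤ f (M z, z) := by
  have hclosed (a : ℝ) := upperSemicontinuous_iff_isClosed_preimage.1 hf a
  refine exists_measurable_selection (fun z => {x | ∀ y, f (y, z) ≤ f (x, z)})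
    (fun z => ?_) (fun z => ?_) fun q r => ?_
  · simp only [Set.ofPred_forall]
    exact isClosed_iInter fun y => (hclosed (f (y, z))).preimage (f := fun x => (x, z))
      (by fun_prop)
  · obtain ⟨_, ⟨x, rfl⟩, hx⟩ := Set.exists_max_image (Set.range fun x => f (x, z)) id
      (hfin.subset (by rintro _ ⟨x, rfl⟩; exact ⟨_, rfl⟩)) (Set.range_nonempty _)
    exact ⟨x, fun y => hx _ ⟨y, rfl⟩⟩
  · have hunion : {z | ∃ x ∈ closedBall q r, x ∈ {x | ∀ y, f (y, z) ≤ f (x, z)}}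
        = ⋃ a ∈ Set.range f, {z | ∃ x ∈ closedBall q r, a ≤ f (x, z)} ∩
          {z | ∀ y, f (y, z) ≤ a} := by
      ext z
      simp only [Set.mem_ofPred_eq, Set.mem_iUnion, Set.mem_inter_iff, exists_prop]
      constructor
      · rintro ⟨x, hx, hmax⟩
        exact ⟨_, ⟨_, rfl⟩, ⟨x, hx, le_rfl⟩, hmax⟩
      · rintro ⟨a, _, ⟨x, hx, hax⟩, hmax⟩
        exact ⟨x, hx, fun y => (hmax y).trans hax⟩
    rw [hunion]
    exact hfin.measurableSet_biUnion fun a _ =>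
      (isClosed_exists_mem (isCompact_closedBall q r) (hclosed a)).measurableSet.inter
        (measurableSet_forall_le hf hfin a)

end FiniteValued

lemma upperSemicontinuous_sum_mul_indicator {ι X Z : Type*} [TopologicalSpace X]
    [TopologicalSpace Z] {I : Finset ι} {w : ι → ℝ} (hw : ∀ i ∈ I, 0 ≤ w i) {A : X → Set Z}
    (hA : IsClosed {p : X × Z | p.2 ∈ A p.1}) :
    UpperSemicontinuous fun p : X × (ι → Z) => ∑ i ∈ I, w i * (A p.1).indicator 1 (p.2 i) := by
  refine upperSemicontinuous_sum fun i hi => ?_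
  have hclosed : IsClosed {p : X × (ι → Z) | p.2 i ∈ A p.1} :=
    hA.preimage (by fun_prop : Continuous fun p : X × (ι → Z) => (p.1, p.2 i))
  have hind : (fun p : X × (ι → Z) => w i * (A p.1).indicator 1 (p.2 i))
      = {p : X × (ι → Z) | p.2 i ∈ A p.1}.indicator fun _ => w i := by
    ext p
    by_cases hp : p.2 i ∈ A p.1 <;> simp [hp]
  exact hind ▸ hclosed.upperSemicontinuous_indicator (hw i hi)

section Depth

variable {E ι : Type*} [NormedAddCommGroup E] [InnerProductSpace ℝ E] [Fintype ι]

/-- The observations that support the coefficient vector `η` against a move in the direction `v`: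
those whose residual at `η` does not shrink along `v`. -/
def depthSet (η v : E) : Set (E × ℝ) := {o | 0 ≤ (o.2 - inner ℝ η o.1) * inner ℝ v o.1}

/-- The weighted count whose infimum over the unit directions `v` is the regression depth. -/
noncomputable def directionalDepth (w : ι → ℝ) (η : E) (z : ι → E × ℝ) (v : E) : ℝ :=
  ∑ i, w i * (depthSet η v).indicator 1 (z i)

lemma finite_setOf_directionalDepth (w : ι → ℝ) :
    {a | ∃ (η : E) (z : ι → E × ℝ) (v : E), a = directionalDepth w η z v}.Finite := by
  classical
  refine (Set.finite_range fun J : Finset ι => ∑ i ∈ J, w i).subset ?_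
  rintro _ ⟨η, z, v, rfl⟩
  refine ⟨Finset.univ.filter fun i => z i ∈ depthSet η v, ?_⟩
  simp only [directionalDepth, Set.indicator_apply, Pi.one_apply, mul_ite, mul_one, mul_zero,
    Finset.sum_filter]

lemma isClosed_setOf_mem_depthSet (v : E) :
    IsClosed {p : E × (E × ℝ) | p.2 ∈ depthSet p.1 v} := by
  simp only [depthSet, Set.mem_ofPred_eq]
  exact isClosed_le (by fun_prop) (by fun_prop)

lemma upperSemicontinuous_directionalDepth {w : ι → ℝ} (hw : ∀ i, 0 ≤ w i) (v : E) :
    UpperSemicontinuous fun p : E × (ι → E × ℝ) => directionalDepth w p.1 p.2 v := by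
  unfold directionalDepth
  exact upperSemicontinuous_sum_mul_indicator (A := fun η => depthSet η v)
    (fun i _ => hw i) (isClosed_setOf_mem_depthSet v)

end Depth

section RegressionDepth

variable {d n : ℕ}

lemma regressionDepth_eq_iInf (w : Fin n → ℝ) (η : EuclideanSpace ℝ (Fin d)) (z : Dataset d n) :
    regressionDepth w η z = ⨅ v : Metric.sphere (0 : EuclideanSpace ℝ (Fin d)) 1,
      directionalDepth w η z v := by
  simp only [regressionDepth, directionalDepth, Set.indicator_apply, Pi.one_apply, depthSet,
    Set.mem_ofPred_eq]

lemma finite_range_directionalDepth (w : Fin n → ℝ) (η : EuclideanSpace ℝ (Fin d))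
    (z : Dataset d n) : (Set.range fun v : Metric.sphere (0 : EuclideanSpace ℝ (Fin d)) 1 =>
      directionalDepth w η z v).Finite :=
  (finite_setOf_directionalDepth (E := EuclideanSpace ℝ (Fin d)) w).subset
    (by rintro _ ⟨v, rfl⟩; exact ⟨η, z, v, rfl⟩)

variable (hd : 1 ≤ d)
include hd

lemma nonempty_sphere : Nonempty (Metric.sphere (0 : EuclideanSpace ℝ (Fin d)) 1) :=
  ⟨⟨EuclideanSpace.single ⟨0, hd⟩ 1, by simp⟩⟩

lemma finite_range_regressionDepth (w : Fin n → ℝ) :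
    (Set.range fun p : EuclideanSpace ℝ (Fin d) × Dataset d n =>
      regressionDepth w p.1 p.2).Finite := by
  have := nonempty_sphere hd
  refine (finite_setOf_directionalDepth (E := EuclideanSpace ℝ (Fin d)) w).subset ?_
  rintro _ ⟨p, rfl⟩
  obtain ⟨v, hv⟩ := (Set.range_nonempty _).csInf_mem (finite_range_directionalDepth w p.1 p.2)
  exact ⟨p.1, p.2, v, (regressionDepth_eq_iInf w p.1 p.2).trans hv.symm⟩

lemma le_regressionDepth_iff {w : Fin n → ℝ} {η : EuclideanSpace ℝ (Fin d)} {z : Dataset d n}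
    {a : ℝ} : a ≤ regressionDepth w η z ↔
      ∀ v : EuclideanSpace ℝ (Fin d), ‖v‖ = 1 → a ≤ directionalDepth w η z v := by
  have := nonempty_sphere hd
  rw [regressionDepth_eq_iInf, le_ciInf_iff (finite_range_directionalDepth w η z).bddBelow]
  simp

lemma upperSemicontinuous_regressionDepth {w : Fin n → ℝ} (hw : ∀ i, 0 ≤ w i) :
    UpperSemicontinuous fun p : EuclideanSpace ℝ (Fin d) × Dataset d n =>
      regressionDepth w p.1 p.2 := by
  refine upperSemicontinuous_iff_isClosed_preimage.2 fun a => ?_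
  simp only [Set.preimage, Set.mem_Ici, le_regressionDepth_iff hd, Set.ofPred_forall]
  exact isClosed_iInter fun v => isClosed_iInter fun _ =>
    upperSemicontinuous_iff_isClosed_preimage.1 (upperSemicontinuous_directionalDepth hw v) a

theorem exists_measurable_isTukeyRegression {w : Fin n → ℝ} (hw : ∀ i, 0 ≤ w i) :
    ∃ M : Dataset d n → EuclideanSpace ℝ (Fin d), Measurable M ∧ IsTukeyRegression w M :=
  exists_measurable_forall_le_of_finite_range (upperSemicontinuous_regressionDepth hd hw)
    (finite_range_regressionDepth hd w)

end RegressionDepth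

/-! ### The upper bound -/

section Whitening

open scoped MatrixOrder

variable {d : ℕ} {S : Matrix (Fin d) (Fin d) ℝ} {σ : ℝ≥0} {β : EuclideanSpace ℝ (Fin d)}

/-- The square root `S^(1/2)` of the covariance matrix, as an operator on `ℝ^d`. -/
noncomputable def sqrtCov (S : Matrix (Fin d) (Fin d) ℝ) :
    EuclideanSpace ℝ (Fin d) →L[ℝ] EuclideanSpace ℝ (Fin d) :=
  Matrix.toEuclideanCLM (𝕜 := ℝ) (CFC.sqrt S)

lemma inner_sqrtCov_left (S : Matrix (Fin d) (Fin d) ℝ) (x y : EuclideanSpace ℝ (Fin d)) :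
    (inner ℝ (sqrtCov S x) y : ℝ) = inner ℝ x (sqrtCov S y) := by
  have h : IsSelfAdjoint (sqrtCov S) := (CFC.sqrt_nonneg S).isSelfAdjoint.map _
  conv_lhs => rw [← h.adjoint_eq]
  rw [ContinuousLinearMap.adjoint_inner_left]

lemma norm_sqrtCov_sq (hS : S.PosDef) (x : EuclideanSpace ℝ (Fin d)) :
    ‖sqrtCov S x‖ ^ 2 = (fun i => x i) ⬝ᵥ S.mulVec (fun i => x i) := by
  rw [← real_inner_self_eq_norm_sq, inner_sqrtCov_left, sqrtCov, ← ContinuousLinearMap.comp_apply,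
    ← ContinuousLinearMap.mul_def, ← map_mul, CFC.sqrt_mul_sqrt_self _ hS.posSemidef.nonneg,
    Matrix.inner_toEuclideanCLM]

lemma sqError_eq_norm_sq (hS : S.PosDef) (b β : EuclideanSpace ℝ (Fin d)) :
    sqError S b β = ‖sqrtCov S (b - β)‖ ^ 2 := (norm_sqrtCov_sq hS _).symm

lemma multivariateGaussian_zero_eq_map_sqrtCov (S : Matrix (Fin d) (Fin d) ℝ) :
    multivariateGaussian 0 S = (stdGaussian (EuclideanSpace ℝ (Fin d))).map (sqrtCov S) := by
  rw [multivariateGaussian]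
  simp only [zero_add]
  rfl

lemma sqrtCov_injective (hS : S.PosDef) : Function.Injective (sqrtCov S) := by
  refine (injective_iff_map_eq_zero _).2 fun x hx => by_contra fun hne => ?_
  have hpos := hS.dotProduct_mulVec_pos (x := fun i => x i)
    fun h => hne (by ext i; exact congrFun h i)
  rw [star_trivial, ← norm_sqrtCov_sq hS, hx] at hpos
  simp at hpos

/-- `sqrtCov` as a linear equivalence, for a positive definite covariance. -/
noncomputable def sqrtCovEquiv (hS : S.PosDef) :
    EuclideanSpace ℝ (Fin d) ≃L[ℝ] EuclideanSpace ℝ (Fin d) :=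
  (LinearEquiv.ofInjectiveEndo (sqrtCov S).toLinearMap
    (sqrtCov_injective hS)).toContinuousLinearEquiv

@[simp]
lemma sqrtCovEquiv_apply (hS : S.PosDef) (x : EuclideanSpace ℝ (Fin d)) :
    sqrtCovEquiv hS x = sqrtCov S x := rfl

/-- The observation generated by a standard Gaussian covariate and a standard Gaussian noise. -/
noncomputable def observe (S : Matrix (Fin d) (Fin d) ℝ) (σ : ℝ≥0) (β : EuclideanSpace ℝ (Fin d))
    (z : Obs d) : Obs d :=
  (sqrtCov S z.1, inner ℝ (sqrtCov S z.1) β + σ * z.2)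

@[fun_prop]
lemma measurable_observe : Measurable (observe S σ β) := by unfold observe; fun_prop

/-- The standardized covariate and noise of an observation; the inverse of `observe`. -/
noncomputable def unobserve (hS : S.PosDef) (σ : ℝ≥0) (β : EuclideanSpace ℝ (Fin d))
    (z : Obs d) : Obs d :=
  ((sqrtCovEquiv hS).symm z.1, (z.2 - inner ℝ z.1 β) / σ)

@[fun_prop]
lemma measurable_unobserve (hS : S.PosDef) : Measurable (unobserve hS σ β) := by
  unfold unobserve; fun_prop

lemma unobserve_observe (hS : S.PosDef) (hσ : 0 < σ) (β : EuclideanSpace ℝ (Fin d)) (z : Obs d) :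
    unobserve hS σ β (observe S σ β z) = z := by
  ext1
  · simp only [unobserve, observe]
    rw [← sqrtCovEquiv_apply hS, ContinuousLinearEquiv.symm_apply_apply]
  · simp only [unobserve, observe]
    field_simp
    ring

lemma inner_fst_eq_inner_unobserve (hS : S.PosDef) (v : EuclideanSpace ℝ (Fin d)) (o : Obs d) :
    (inner ℝ v o.1 : ℝ) = inner ℝ (sqrtCov S v) (unobserve hS σ β o).1 := by
  rw [inner_sqrtCov_left, ← sqrtCovEquiv_apply hS, unobserve,
    ContinuousLinearEquiv.apply_symm_apply]

lemma residual_eq_mul_unobserve (hS : S.PosDef) (hσ : 0 < σ) (β : EuclideanSpace ℝ (Fin d))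
    (o : Obs d) : o.2 - inner ℝ β o.1 = σ * (unobserve hS σ β o).2 := by
  rw [unobserve, real_inner_comm]
  field_simp

lemma gaussianReal_eq_map_affine (m : ℝ) (σ : ℝ≥0) :
    gaussianReal m (σ ^ 2) = (gaussianReal 0 1).map fun x => m + σ * x := by
  rw [show (fun x : ℝ => m + σ * x) = (m + ·) ∘ (σ * ·) from rfl,
    ← Measure.map_map (by fun_prop) (by fun_prop), gaussianReal_map_const_mul,
    gaussianReal_map_const_add]
  congr 1
  · simp
  · ext; simp

lemma cleanLaw_eq_map_observe (S : Matrix (Fin d) (Fin d) ℝ) (σ : ℝ≥0)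
    (β : EuclideanSpace ℝ (Fin d)) :
    cleanLaw S σ β = (stdObs (EuclideanSpace ℝ (Fin d))).map (observe S σ β) := by
  ext s hs
  rw [cleanLaw, Measure.compProd_apply hs, multivariateGaussian_zero_eq_map_sqrtCov, lintegral_map
    (Kernel.measurable_kernel_prodMk_left hs) (by fun_prop),
    Measure.map_apply measurable_observe hs, stdObs, Measure.prod_apply (measurable_observe hs)]
  refine lintegral_congr fun g => ?_
  change gaussianReal _ _ _ = _
  rw [gaussianReal_eq_map_affine, Measure.map_apply (by fun_prop) (measurable_prodMk_left hs)]
  rfl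

lemma pi_cleanLaw_eq_map_observe {ι : Type*} [Fintype ι] (S : Matrix (Fin d) (Fin d) ℝ) (σ : ℝ≥0)
    (β : EuclideanSpace ℝ (Fin d)) :
    (Measure.pi fun _ : ι => cleanLaw S σ β)
      = (Measure.pi fun _ : ι => stdObs (EuclideanSpace ℝ (Fin d))).map
          fun x i => observe S σ β (x i) := by
  have (_ : ι) : SigmaFinite ((stdObs (EuclideanSpace ℝ (Fin d))).map (observe S σ β)) := by
    rw [← cleanLaw_eq_map_observe]; infer_instance
  simp_rw [cleanLaw_eq_map_observe]
  exact (Measure.pi_map_pi (μ := fun _ : ι => stdObs _)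
    fun _ => measurable_observe.aemeasurable).symm

end Whitening

section TiltCounts

variable {ι : Type*} (I : Finset ι)

lemma hits_add_hits_compl {Z : Type*} (A : Set Z) (x : ι → Z) :
    hits I A x + hits I Aᶜ x = I.card := by
  rw [hits, hits, ← Finset.sum_add_distrib, Finset.card_eq_sum_ones]
  push_cast
  refine Finset.sum_congr rfl fun i _ => ?_
  by_cases h : x i ∈ A <;> simp [h]

lemma hits_preimage {Z Z' : Type*} (A : Set Z') (g : Z → Z') (x : ι → Z) :
    hits I (g ⁻¹' A) x = hits I A fun i => g (x i) := rfl

lemma finite_setOf_hits (Z : Type*) :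
    {a | ∃ (A : Set Z) (x : ι → Z), a = hits I A x}.Finite := by
  classical
  refine (Set.finite_range fun J : I.powerset => (J.1.card : ℝ)).subset ?_
  rintro _ ⟨A, x, rfl⟩
  refine ⟨⟨I.filter fun i => x i ∈ A, Finset.mem_powerset.2 (Finset.filter_subset _ _)⟩, ?_⟩
  simp only [hits, Set.indicator_apply, Pi.one_apply, Finset.sum_boole]

lemma upperSemicontinuous_hits {X Z : Type*} [TopologicalSpace X] [TopologicalSpace Z]
    {A : X → Set Z} (hA : IsClosed {p : X × Z | p.2 ∈ A p.1}) :
    UpperSemicontinuous fun p : X × (ι → Z) => hits I (A p.1) p.2 := by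
  simpa [hits] using
    upperSemicontinuous_sum_mul_indicator (I := I) (w := 1) (fun _ _ => zero_le_one) hA

variable {E : Type*} [NormedAddCommGroup E] [InnerProductSpace ℝ E]

/-- No set `tiltSet s u`, for `u` a unit vector, contains more points of the sample `x` with index
in `I` than its expected number plus `e`. -/
def TiltCountsLE (s e : ℝ) (x : ι → E × ℝ) : Prop :=
  ∀ u : E, ‖u‖ = 1 → hits I (tiltSet s u) x ≤ I.card * tiltProb s + e

lemma measurableSet_tiltCountsLE [FiniteDimensional ℝ E] [MeasurableSpace E] [BorelSpace E]
    [Countable ι] (s e : ℝ) : MeasurableSet {x : ι → E × ℝ | TiltCountsLE I s e x} := by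
  have hclosed : IsClosed {p : Metric.sphere (0 : E) 1 × (E × ℝ) | p.2 ∈ tiltSet s (p.1 : E)} := by
    simp only [tiltSet, tiltRegion, Set.mem_preimage, Set.mem_ofPred_eq]
    exact isClosed_le (by fun_prop) (by fun_prop)
  have hfin : (Set.range fun p : Metric.sphere (0 : E) 1 × (ι → E × ℝ) =>
      hits I (tiltSet s (p.1 : E)) p.2).Finite :=
    (finite_setOf_hits I (E × ℝ)).subset (by rintro _ ⟨p, rfl⟩; exact ⟨_, _, rfl⟩)
  simpa [TiltCountsLE] using
    measurableSet_forall_le (upperSemicontinuous_hits I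
      (A := fun u : Metric.sphere (0 : E) 1 => tiltSet s (u : E)) hclosed) hfin
      (I.card * tiltProb s + e)

end TiltCounts

section Contamination

variable {n : ℕ} {Z : Type} (lam : Fin n → unitInterval) (I : Finset (Fin n))

lemma hits_contaminate_le {Z' : Type*} (A : Set Z') (g : Z → Z')
    (p : ((Fin n → Z) × (Fin n → Bool)) × (Fin n → Z)) :
    hits I A (fun i => g (contaminate p i))
      ≤ hits I A (fun i => g (p.1.1 i)) + hits I {true} p.1.2 := by
  rw [hits, hits, hits, ← Finset.sum_add_distrib]
  refine Finset.sum_le_sum fun i _ => ?_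
  rcases hcorrupted : p.1.2 i with _ | _
  · simp [contaminate, hcorrupted]
  · by_cases hA : g (contaminate p i) ∈ A <;> by_cases hA' : g (p.1.1 i) ∈ A <;> simp [hA, hA']

variable {lam} in
lemma measure_pi_bernoulli_lt_hits_le {t : ℝ} (hI : ∀ i ∈ I, (lam i : ℝ) ≤ t) :
    (Measure.pi fun i => bernoulliMeasure true false (lam i))
      {b : Fin n → Bool | 2 * (I.card * t) + 4 < hits I {true} b} ≤ ENNReal.ofReal (1 / 20) := by
  have hrate (i) (hi : i ∈ I) : (bernoulliMeasure true false (lam i)).real {true} ≤ t := by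
    simpa [measureReal_def, bernoulliMeasure_apply, (lam i).2.1] using hI i hi
  have htail := measure_pi_lt_hits_le I (fun i => bernoulliMeasure true false (lam i))
    (measurableSet_singleton true) hrate one_pos le_rfl 4
  have hexp : Real.exp (-4) ≤ 1 / 20 := by
    rw [Real.exp_neg, inv_eq_one_div]
    have := pow_le_exp_natCast 4
    norm_num at this
    gcongr
    linarith
  refine (measure_mono fun b hb => ?_).trans (htail.trans (ENNReal.ofReal_le_ofReal hexp))
  rw [Set.mem_ofPred_eq] at hb ⊢
  linarith

lemma contaminatedLaw_le [MeasurableSpace Z] (P : Measure Z) [IsProbabilityMeasure P]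
    (κ : Adversary Z n) {F : Set (Fin n → Z)} (hF : MeasurableSet F) (A : Set (Fin n → Z))
    (B : Set (Fin n → Bool)) (h : ∀ p, contaminate p ∈ F → p.1.1 ∈ A ∨ p.1.2 ∈ B) :
    contaminatedLaw lam P κ F ≤ (Measure.pi fun _ : Fin n => P) A
      + (Measure.pi fun i => bernoulliMeasure true false (lam i)) B := by
  have := κ.2
  set ν := (Measure.pi fun _ : Fin n => P).prod
      (Measure.pi fun i => bernoulliMeasure true false (lam i))
  calc contaminatedLaw lam P κ F
      ≤ (ν ⊗ₘ κ.1) (Prod.fst ⁻¹' (Prod.fst ⁻¹' A ∪ Prod.snd ⁻¹' B)) := by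
        rw [contaminatedLaw, Measure.map_apply measurable_contaminate hF]
        exact measure_mono h
    _ ≤ (ν ⊗ₘ κ.1).fst (Prod.fst ⁻¹' A ∪ Prod.snd ⁻¹' B) :=
        Measure.le_map_apply measurable_fst.aemeasurable _
    _ ≤ ν (Prod.fst ⁻¹' A) + ν (Prod.snd ⁻¹' B) := by
        rw [Measure.fst_compProd]
        exact measure_union_le _ _
    _ ≤ ν.fst A + ν.snd B := add_le_add (Measure.le_map_apply measurable_fst.aemeasurable _)
        (Measure.le_map_apply measurable_snd.aemeasurable _)
    _ = _ := by rw [Measure.fst_prod, Measure.snd_prod]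

end Contamination

section CleanDeviation

variable {d n : ℕ} {I : Finset (Fin n)} {S : Matrix (Fin d) (Fin d) ℝ} {σ : ℝ≥0} {s : ℝ}

lemma measure_pi_cleanLaw_not_tiltCountsLE_le (hd : 1 ≤ d) (hI : d ≤ I.card) (hS : S.PosDef)
    (hσ : 0 < σ) (β : EuclideanSpace ℝ (Fin d)) (hs : 0 ≤ s) (hs1 : s ≤ 1) :
    (Measure.pi fun _ : Fin n => cleanLaw S σ β)
      {x | ¬ TiltCountsLE I s (900 * √(d * I.card)) fun i => unobserve hS σ β (x i)}
      ≤ ENNReal.ofReal (1 / 20) := by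
  have hmeas : MeasurableSet
      {x : Dataset d n | ¬ TiltCountsLE I s (900 * √(d * I.card))
        fun i => unobserve hS σ β (x i)} :=
    (measurableSet_tiltCountsLE I s _).compl.preimage
      (f := fun (x : Dataset d n) i => unobserve hS σ β (x i)) (by fun_prop)
  rw [pi_cleanLaw_eq_map_observe, Measure.map_apply (by fun_prop) hmeas]
  simpa [TiltCountsLE, unobserve_observe hS hσ] using
    measure_exists_lt_hits_tiltSet_le (E := EuclideanSpace ℝ (Fin d)) (by simpa using hd) I
      (by simpa using hI) hs hs1

lemma contaminatedLaw_not_tiltCountsLE_le (hd : 1 ≤ d) (hI : d ≤ I.card)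
    {lam : Fin n → unitInterval} {t : ℝ} (hlam : ∀ i ∈ I, (lam i : ℝ) ≤ t) (hS : S.PosDef)
    (hσ : 0 < σ) (β : EuclideanSpace ℝ (Fin d)) (κ : Adversary (Obs d) n) (hs : 0 ≤ s)
    (hs1 : s ≤ 1) :
    contaminatedLaw lam (cleanLaw S σ β) κ
      {z | ¬ TiltCountsLE I s (900 * √(d * I.card) + (2 * (I.card * t) + 4))
        fun i => unobserve hS σ β (z i)} ≤ ENNReal.ofReal (1 / 10) := by
  have hmeas : MeasurableSet {z : Dataset d n | ¬ TiltCountsLE I s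
      (900 * √(d * I.card) + (2 * (I.card * t) + 4)) fun i => unobserve hS σ β (z i)} :=
    (measurableSet_tiltCountsLE I s _).compl.preimage
      (f := fun (x : Dataset d n) i => unobserve hS σ β (x i)) (by fun_prop)
  refine (contaminatedLaw_le lam _ κ hmeas
    {x | ¬ TiltCountsLE I s (900 * √(d * I.card)) fun i => unobserve hS σ β (x i)}
    {b | 2 * (I.card * t) + 4 < hits I {true} b} fun p hp => ?_).trans
    ((add_le_add (measure_pi_cleanLaw_not_tiltCountsLE_le hd hI hS hσ β hs hs1)
      (measure_pi_bernoulli_lt_hits_le I hlam)).trans_eq ?_)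
  · by_contra! hgood
    simp only [Set.mem_ofPred_eq, not_not, not_lt] at hp hgood
    refine hp fun u hu => ?_
    linarith [hits_contaminate_le I (tiltSet s u) (unobserve hS σ β) p, hgood.1 u hu, hgood.2]
  · rw [← ENNReal.ofReal_add (by norm_num) (by norm_num)]
    norm_num

end CleanDeviation

section Depth

lemma depthSet_smul {E : Type*} [NormedAddCommGroup E] [InnerProductSpace ℝ E] (η v : E) {c : ℝ}
    (hc : 0 < c) : depthSet η (c • v) = depthSet η v := by
  ext o
  simp only [depthSet, Set.mem_ofPred_eq, real_inner_smul_left, mul_left_comm _ c,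
    mul_nonneg_iff_of_pos_left hc]

variable {d n : ℕ} {S : Matrix (Fin d) (Fin d) ℝ} {σ : ℝ≥0}

lemma compl_depthSet_subset (hS : S.PosDef) (hσ : 0 < σ) (β v : EuclideanSpace ℝ (Fin d)) :
    (depthSet β v)ᶜ
      ⊆ unobserve hS σ β ⁻¹' tiltSet 0 (-(‖sqrtCov S v‖⁻¹ • sqrtCov S v)) := by
  intro o ho
  simp only [depthSet, Set.mem_compl_iff, Set.mem_ofPred_eq, not_le] at ho
  rw [residual_eq_mul_unobserve hS hσ, inner_fst_eq_inner_unobserve (σ := σ) (β := β) hS] at ho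
  simp only [tiltSet, tiltRegion, Set.mem_preimage, Set.mem_ofPred_eq, inner_neg_left,
    real_inner_smul_left, zero_mul]
  set h : ℝ := inner ℝ (sqrtCov S v) (unobserve hS σ β o).1
  have hneg : (unobserve hS σ β o).2 * h < 0 := by
    rw [mul_assoc] at ho
    exact neg_of_mul_neg_right ho σ.2
  nlinarith [mul_nonneg (inv_nonneg.2 (norm_nonneg (sqrtCov S v))) (neg_nonneg.2 hneg.le)]

lemma depthSet_subset (hS : S.PosDef) (hσ : 0 < σ) {β b : EuclideanSpace ℝ (Fin d)} {s : ℝ}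
    (hs : s * σ ≤ ‖sqrtCov S (b - β)‖) :
    depthSet b (b - β)
      ⊆ unobserve hS σ β ⁻¹' tiltSet s (‖sqrtCov S (b - β)‖⁻¹ • sqrtCov S (b - β)) := by
  intro o ho
  simp only [depthSet, Set.mem_ofPred_eq] at ho
  rw [show o.2 - inner ℝ b o.1 = (o.2 - inner ℝ β o.1) - inner ℝ (b - β) o.1 by
      rw [inner_sub_left]; ring, residual_eq_mul_unobserve hS hσ,
    inner_fst_eq_inner_unobserve (σ := σ) (β := β) hS] at ho
  simp only [tiltSet, tiltRegion, Set.mem_preimage, Set.mem_ofPred_eq, real_inner_smul_left]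
  set w := sqrtCov S (b - β)
  set h : ℝ := inner ℝ w (unobserve hS σ β o).1
  set ξ := (unobserve hS σ β o).2
  have hσ' : (0 : ℝ) < σ := hσ
  have hle : s * σ * ‖w‖⁻¹ ≤ 1 := by
    rw [← div_eq_mul_inv]
    exact div_le_one_of_le₀ hs (norm_nonneg w)
  have htilt : s * ‖w‖⁻¹ * h ^ 2 ≤ ξ * h := by
    refine le_of_mul_le_mul_left ?_ hσ'
    nlinarith [mul_le_mul_of_nonneg_right hle (sq_nonneg h)]
  nlinarith [mul_le_mul_of_nonneg_left htilt (inv_nonneg.2 (norm_nonneg w))]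

/-- The indices of corruption rate at most `t`, whose number is `countLE lam t`. -/
noncomputable def lowRate (lam : Fin n → unitInterval) (t : unitInterval) : Finset (Fin n) :=
  Finset.univ.filter fun i => lam i ≤ t

lemma card_lowRate (lam : Fin n → unitInterval) (t : unitInterval) :
    (lowRate lam t).card = countLE lam t := rfl

lemma directionalDepth_thresholdWeight (lam : Fin n → unitInterval) (t : unitInterval)
    (η v : EuclideanSpace ℝ (Fin d)) (z : Dataset d n) :
    directionalDepth (thresholdWeight lam t) η z v
      = hits (lowRate lam t) (depthSet η v) z / countLE lam t := by
  rw [directionalDepth, hits, lowRate, Finset.sum_filter, Finset.sum_div]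
  refine Finset.sum_congr rfl fun i _ => ?_
  rw [thresholdWeight]
  split_ifs <;> ring

variable {lam : Fin n → unitInterval} {t : unitInterval} {β b : EuclideanSpace ℝ (Fin d)}
  {z : Dataset d n} {s e : ℝ}

lemma le_regressionDepth_of_tiltCountsLE (hd : 1 ≤ d) (hN : 0 < countLE lam t) (hS : S.PosDef)
    (hσ : 0 < σ) (hz : TiltCountsLE (lowRate lam t) 0 e fun i => unobserve hS σ β (z i)) :
    1 / 2 - e / countLE lam t ≤ regressionDepth (thresholdWeight lam t) β z := by
  have hN' : (0 : ℝ) < countLE lam t := Nat.cast_pos.2 hN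
  refine (le_regressionDepth_iff hd).2 fun v hv => ?_
  have hv0 : sqrtCov S v ≠ 0 := fun h =>
    one_ne_zero (hv ▸ norm_eq_zero.2 (sqrtCov_injective hS (by rw [h, map_zero])))
  have hmono := hits_mono (lowRate lam t) (compl_depthSet_subset hS hσ β v) z
  rw [hits_preimage] at hmono
  have hdev := hz (-(‖sqrtCov S v‖⁻¹ • sqrtCov S v))
    (by rw [norm_neg]; exact norm_smul_inv_norm hv0)
  have htilt : countLE lam t * tiltProb 0 ≤ countLE lam t * (1 / 2) := by
    gcongr
    simpa using tiltProb_le le_rfl zero_le_one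
  have hsum := hits_add_hits_compl (lowRate lam t) (depthSet β v) z
  rw [card_lowRate] at hsum hdev
  rw [directionalDepth_thresholdWeight, le_div_iff₀ hN', sub_mul, div_mul_cancel₀ _ hN'.ne']
  linarith

lemma regressionDepth_le_of_tiltCountsLE (hd : 1 ≤ d) (hN : 0 < countLE lam t) (hS : S.PosDef)
    (hσ : 0 < σ) (hs : 0 < s) (hs1 : s ≤ 1) (hb : s * σ < ‖sqrtCov S (b - β)‖)
    (hz : TiltCountsLE (lowRate lam t) s e fun i => unobserve hS σ β (z i)) :
    regressionDepth (thresholdWeight lam t) b z ≤ 1 / 2 - s / 900 + e / countLE lam t := by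
  have hN' : (0 : ℝ) < countLE lam t := Nat.cast_pos.2 hN
  have hw : sqrtCov S (b - β) ≠ 0 := norm_pos_iff.1 (lt_of_le_of_lt (by positivity) hb)
  have hbβ : b - β ≠ 0 := fun h => hw (by rw [h, map_zero])
  calc regressionDepth (thresholdWeight lam t) b z
      ≤ directionalDepth (thresholdWeight lam t) b z (‖b - β‖⁻¹ • (b - β)) :=
        (le_regressionDepth_iff hd).1 le_rfl _ (norm_smul_inv_norm hbβ)
    _ = hits (lowRate lam t) (depthSet b (b - β)) z / countLE lam t := by
        rw [directionalDepth_thresholdWeight, depthSet_smul _ _ (inv_pos.2 (norm_pos_iff.2 hbβ))]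
    _ ≤ (countLE lam t * (1 / 2 - s / 900) + e) / countLE lam t := by
        have hmono := hits_mono (lowRate lam t) (depthSet_subset hS hσ hb.le) z
        rw [hits_preimage] at hmono
        have hdev := hz (‖sqrtCov S (b - β)‖⁻¹ • sqrtCov S (b - β)) (norm_smul_inv_norm hw)
        rw [card_lowRate] at hdev
        have htilt := mul_le_mul_of_nonneg_left (tiltProb_le hs.le hs1) hN'.le
        gcongr
        linarith
    _ = _ := by field_simp

-- The tilt by `s` costs a fraction `s / 900` of the depth, which the deviations cannot make up.
lemma norm_le_of_tiltCountsLE (hd : 1 ≤ d) (hN : 0 < countLE lam t) (hS : S.PosDef) (hσ : 0 < σ)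
    (hs : 0 < s) (hs1 : s ≤ 1) (hse : 1800 * e < s * countLE lam t)
    (hz₀ : TiltCountsLE (lowRate lam t) 0 e fun i => unobserve hS σ β (z i))
    (hz : TiltCountsLE (lowRate lam t) s e fun i => unobserve hS σ β (z i))
    (hb : regressionDepth (thresholdWeight lam t) β z
      ≤ regressionDepth (thresholdWeight lam t) b z) :
    ‖sqrtCov S (b - β)‖ ≤ s * σ := by
  by_contra! hfar
  have hgap : s / 900 ≤ 2 * (e / countLE lam t) := by
    linarith [le_regressionDepth_of_tiltCountsLE hd hN hS hσ hz₀,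
      regressionDepth_le_of_tiltCountsLE hd hN hS hσ hs hs1 hfar hz]
  rw [mul_div_assoc', le_div_iff₀ (Nat.cast_pos.2 hN)] at hgap
  linarith

end Depth

section UpperBound

variable {d n : ℕ} {lam : Fin n → unitInterval} {t : unitInterval}

lemma deviation_mul_lt {N r t : ℝ} (hd : (1 : ℝ) ≤ d) (hN : 0 < N) (hr : 0 < r) (ht : t ≤ r)
    (hdr : d / N ≤ r ^ 2) (hN1 : 1 ≤ N) :
    1800 * (900 * √(d * N) + (2 * (N * t) + 4)) < 1660000 * r * N := by
  have hsqrt : √(d * N) ≤ N * r := by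
    refine Real.sqrt_le_iff.2 ⟨by positivity, ?_⟩
    rw [div_le_iff₀ hN] at hdr
    nlinarith
  have hone : 1 ≤ √(d * N) := Real.one_le_sqrt.2 (one_le_mul_of_one_le_of_one_le hd hN1)
  have hNr : N * t ≤ N * r := by gcongr
  nlinarith [mul_pos hN hr]

theorem worstFailure_tukey_le (hd : 1 ≤ d) {S : Matrix (Fin d) (Fin d) ℝ} (hS : S.PosDef) {σ : ℝ≥0}
    (hσ : 0 < σ) {f : ℝ} (hN : 0 < countLE lam t) (hf : f = d / countLE lam t + (t : ℝ) ^ 2)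
    (hfc : 1660000 ^ 2 * f ≤ 1) {M : Dataset d n → EuclideanSpace ℝ (Fin d)}
    (hM : IsTukeyRegression (thresholdWeight lam t) M) :
    worstFailure lam S σ M (ENNReal.ofReal (1660000 ^ 2 * σ ^ 2 * f)) ≤ 1 / 5 := by
  have hdN : (d : ℝ) / countLE lam t ≤ f := by rw [hf]; linarith [sq_nonneg (t : ℝ)]
  have htf : (t : ℝ) ^ 2 ≤ f := by
    rw [hf]
    exact le_add_of_nonneg_left (by positivity)
  have hf0 : 0 < f := lt_of_lt_of_le (by positivity) hdN
  have hI : d ≤ (lowRate lam t).card := by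
    rw [card_lowRate, ← Nat.cast_le (α := ℝ), ← div_le_one (Nat.cast_pos.2 hN)]
    linarith
  have hlam (i) (hi : i ∈ lowRate lam t) : (lam i : ℝ) ≤ t := (Finset.mem_filter.1 hi).2
  set s : ℝ := 1660000 * √f with hs
  set e : ℝ := 900 * √(d * (lowRate lam t).card) + (2 * ((lowRate lam t).card * t) + 4)
  have hs0 : 0 < s := by positivity
  have hsq : s ^ 2 = 1660000 ^ 2 * f := by rw [hs, mul_pow, Real.sq_sqrt hf0.le]
  have hs1 : s ≤ 1 := by nlinarith
  have hse : 1800 * e < s * countLE lam t :=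
    deviation_mul_lt (by exact_mod_cast hd) (Nat.cast_pos.2 hN) (by positivity)
      (Real.le_sqrt_of_sq_le htf) (by rwa [Real.sq_sqrt hf0.le]) (by exact_mod_cast hN)
  refine iSup₂_le fun β κ => ?_
  have hevent : {z | ENNReal.ofReal (1660000 ^ 2 * σ ^ 2 * f) < ENNReal.ofReal (sqError S (M z) β)}
      ⊆ {z | ¬ TiltCountsLE (lowRate lam t) 0 e fun i => unobserve hS σ β (z i)}
        ∪ {z | ¬ TiltCountsLE (lowRate lam t) s e fun i => unobserve hS σ β (z i)} := by
    intro z hz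
    by_contra! hgood
    simp only [Set.mem_union, Set.mem_ofPred_eq, not_or, not_not] at hgood
    have hnear := norm_le_of_tiltCountsLE hd hN hS hσ hs0 hs1 hse hgood.1 hgood.2 (hM z β)
    refine absurd hz (not_lt.2 (ENNReal.ofReal_le_ofReal ?_))
    calc sqError S (M z) β = ‖sqrtCov S (M z - β)‖ ^ 2 := sqError_eq_norm_sq hS _ _
      _ ≤ (s * σ) ^ 2 := by gcongr
      _ = _ := by rw [mul_pow, hsq]; ring
  calc _ ≤ ENNReal.ofReal (1 / 10) + ENNReal.ofReal (1 / 10) :=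
        (measure_mono hevent).trans ((measure_union_le _ _).trans (add_le_add
          (contaminatedLaw_not_tiltCountsLE_le hd hI hlam hS hσ β κ le_rfl zero_le_one)
          (contaminatedLaw_not_tiltCountsLE_le hd hI hlam hS hσ β κ hs0.le hs1)))
    _ = 1 / 5 := by
        rw [← ENNReal.ofReal_add (by norm_num) (by norm_num),
          show (1 / 10 + 1 / 10 : ℝ) = 1 / 5 by norm_num, ENNReal.ofReal_div_of_pos (by norm_num)]
        simp

end UpperBound

section OptimalThreshold

variable {d n : ℕ} {lam : Fin n → unitInterval} {t : unitInterval}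

lemma thresholdError_eq_top (hd : 1 ≤ d) (h : countLE lam t = 0) : thresholdError lam d t = ⊤ := by
  rw [thresholdError, h, Nat.cast_zero,
    ENNReal.div_zero (by exact_mod_cast Nat.one_le_iff_ne_zero.1 hd), top_add]

lemma thresholdError_eq_ofReal (hN : 0 < countLE lam t) :
    thresholdError lam d t = ENNReal.ofReal (d / countLE lam t + (t : ℝ) ^ 2) := by
  rw [thresholdError, ENNReal.ofReal_add (by positivity) (by positivity),
    ENNReal.ofReal_div_of_pos (by exact_mod_cast hN), ENNReal.ofReal_natCast,
    ENNReal.ofReal_natCast]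

lemma effectiveError_eq_thresholdError (ht : IsOptimalThreshold lam d t) :
    effectiveError lam d = thresholdError lam d t :=
  le_antisymm (iInf_le _ t) (le_iInf ht)

variable (lam) in
lemma exists_thresholdError_rate_le (hN : 0 < countLE lam t) :
    ∃ i, thresholdError lam d (lam i) ≤ thresholdError lam d t := by
  obtain ⟨i, hi, hmax⟩ := (lowRate lam t).exists_max_image lam (Finset.card_pos.1 hN)
  have hit : lam i ≤ t := (Finset.mem_filter.1 hi).2
  have hcount : countLE lam (lam i) = countLE lam t :=
    congrArg Finset.card (Finset.filter_congr fun j _ => ⟨fun hj => hj.trans hit,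
      fun hj => hmax j (Finset.mem_filter.2 ⟨Finset.mem_univ j, hj⟩)⟩)
  refine ⟨i, ?_⟩
  rw [thresholdError, thresholdError, hcount]
  gcongr
  exact (lam i).2.1

lemma exists_isOptimalThreshold (hd : 1 ≤ d) (lam : Fin n → unitInterval) :
    ∃ t : unitInterval, IsOptimalThreshold lam d t := by
  classical
  obtain ⟨t, -, ht⟩ := (insert 1 (Finset.univ.image lam)).exists_min_image
    (thresholdError lam d) (Finset.insert_nonempty _ _)
  refine ⟨t, fun s => ?_⟩
  rcases (countLE lam s).eq_zero_or_pos with h0 | hpos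
  · exact le_top.trans_eq (thresholdError_eq_top hd h0).symm
  · obtain ⟨i, hi⟩ := exists_thresholdError_rate_le lam (d := d) hpos
    exact (ht _ (by simp)).trans hi

end OptimalThreshold

/-! ### The lower bound -/

section Adversary

variable {Z : Type} [MeasurableSpace Z]

lemma measurable_ite_snd_fst :
    Measurable fun q : (Z × Bool) × Z => if q.1.2 then q.2 else q.1.1 :=
  .ite ((measurable_snd.comp measurable_fst) (measurableSet_singleton true)) (by fun_prop)
    (by fun_prop)

lemma map_ite_prod_bernoulliMeasure (P R : Measure Z) [IsProbabilityMeasure P]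
    [IsProbabilityMeasure R] (p : unitInterval) :
    ((P.prod (bernoulliMeasure true false p)).prod R).map
      (fun q : (Z × Bool) × Z => if q.1.2 then q.2 else q.1.1)
      = ENNReal.ofReal p • R + ENNReal.ofReal (1 - p) • P := by
  set pick : (Z × Bool) × Z → Z := fun q => if q.1.2 then q.2 else q.1.1
  have hm : Measurable pick := measurable_ite_snd_fst
  have hber : bernoulliMeasure true false p
      = ENNReal.ofReal p • Measure.dirac true + ENNReal.ofReal (1 - p) • Measure.dirac false := by
    rw [bernoulliMeasure_def, ← unitInterval.coe_symm_eq, ENNReal.ofReal, ENNReal.ofReal,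
      Real.toNNReal_of_nonneg p.2.1, Real.toNNReal_of_nonneg (unitInterval.symm p).2.1]
    rfl
  have hdirac (b : Bool) : ((P.prod (Measure.dirac b)).prod R).map pick
      = (P.prod R).map (fun q => if b then q.2 else q.1) := by
    rw [Measure.prod_dirac]
    nth_rewrite 1 [← Measure.map_id (μ := R)]
    rw [Measure.map_prod_map _ _ (by fun_prop) measurable_id, Measure.map_map hm (by fun_prop)]
    rfl
  rw [hber, Measure.prod_add, Measure.add_prod, Measure.map_add _ _ hm, Measure.prod_smul_right,
    Measure.prod_smul_right, Measure.prod_smul_left, Measure.prod_smul_left, Measure.map_smul,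
    Measure.map_smul, hdirac, hdirac]
  congr 2
  exacts [Measure.snd_prod, Measure.fst_prod]

lemma exists_isProbabilityMeasure_smul_add_smul_eq {P Q : Measure Z} [IsProbabilityMeasure P]
    [IsProbabilityMeasure Q] {p : ℝ} (hp0 : 0 ≤ p) (hp1 : p ≤ 1)
    (hPQ : ENNReal.ofReal (1 - p) • P ≤ Q) :
    ∃ R : Measure Z, IsProbabilityMeasure R ∧
      ENNReal.ofReal p • R + ENNReal.ofReal (1 - p) • P = Q := by
  rcases hp0.eq_or_lt with rfl | hp
  · refine ⟨P, inferInstance, ?_⟩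
    simp only [sub_zero, ENNReal.ofReal_one, one_smul] at hPQ
    simp [Measure.eq_of_le_of_isProbabilityMeasure hPQ]
  have hp' : ENNReal.ofReal p ≠ 0 := by simpa using hp
  have : IsFiniteMeasure (ENNReal.ofReal (1 - p) • P) := ⟨by simp⟩
  have hsub := Measure.sub_add_cancel_of_le hPQ
  have hmass : (Q - ENNReal.ofReal (1 - p) • P) Set.univ = ENNReal.ofReal p := by
    rw [Measure.sub_apply .univ hPQ, Measure.smul_apply, measure_univ, measure_univ, smul_eq_mul,
      mul_one, ← ENNReal.ofReal_one, ← ENNReal.ofReal_sub _ (by linarith), sub_sub_cancel]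
  refine ⟨(ENNReal.ofReal p)⁻¹ • (Q - ENNReal.ofReal (1 - p) • P), ⟨?_⟩, ?_⟩
  · rw [Measure.smul_apply, hmass, smul_eq_mul, ENNReal.inv_mul_cancel hp' ENNReal.ofReal_ne_top]
  · rw [smul_smul, ENNReal.mul_inv_cancel hp' ENNReal.ofReal_ne_top, one_smul, hsub]

lemma contaminatedLaw_const_pi {n : ℕ} (lam : Fin n → unitInterval) (P : Measure Z)
    [IsProbabilityMeasure P] (R : Fin n → Measure Z) [∀ i, IsProbabilityMeasure (R i)] :
    contaminatedLaw lam P ⟨Kernel.const _ (Measure.pi R), inferInstance⟩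
      = Measure.pi fun i => ENNReal.ofReal (lam i) • R i + ENNReal.ofReal (1 - lam i) • P := by
  set B : Fin n → Measure Bool := fun i => bernoulliMeasure true false (lam i)
  set pick : (Z × Bool) × Z → Z := fun q => if q.1.2 then q.2 else q.1.1
  have hm : Measurable pick := measurable_ite_snd_fst
  have hclean := measurePreserving_arrowProdEquivProdArrow Z Bool (Fin n) (fun _ => P) B
  have hsample := (hclean.prod (.id (Measure.pi R))).comp
    (measurePreserving_arrowProdEquivProdArrow (Z × Bool) Z (Fin n) (fun i => P.prod (B i)) R)
  have (i : Fin n) : IsProbabilityMeasure (((P.prod (B i)).prod (R i)).map pick) :=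
    Measure.isProbabilityMeasure_map hm.aemeasurable
  simp_rw [← map_ite_prod_bernoulliMeasure]
  rw [← Measure.pi_map_pi fun i => hm.aemeasurable, contaminatedLaw, Measure.compProd_const,
    ← hsample.map_eq, Measure.map_map measurable_contaminate hsample.measurable]
  rfl

-- The outliers are independent draws from the laws that complete `(1 - lam i) P` to `Q i`.
lemma exists_contaminatedLaw_eq_pi {n : ℕ} {lam : Fin n → unitInterval} {P : Measure Z}
    [IsProbabilityMeasure P] {Q : Fin n → Measure Z} [∀ i, IsProbabilityMeasure (Q i)]
    (hQ : ∀ i, ENNReal.ofReal (1 - lam i) • P ≤ Q i) :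
    ∃ κ : Adversary Z n, contaminatedLaw lam P κ = Measure.pi Q := by
  choose R hR hRQ using fun i =>
    exists_isProbabilityMeasure_smul_add_smul_eq (lam i).2.1 (lam i).2.2 (hQ i)
  exact ⟨_, (contaminatedLaw_const_pi lam P R).trans (by simp_rw [hRQ])⟩

end Adversary

section Affinity

section Pi

variable {ι : Type*} [Fintype ι] {α : ι → Type*} [∀ i, MeasurableSpace (α i)]
  (ν : ∀ i, Measure (α i)) [∀ i, SigmaFinite (ν i)] {p q : ∀ i, α i → ℝ≥0∞}

lemma lintegral_fintype_prod_eq_prod (hp : ∀ i, Measurable (p i)) :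
    ∫⁻ x, ∏ i, p i (x i) ∂(Measure.pi ν) = ∏ i, ∫⁻ a, p i a ∂(ν i) := by
  classical
  have hmeas : Measurable fun x : ∀ i, α i => ∏ i, p i (x i) := by fun_prop
  have hmarginal (s : Finset ι) (x : ∀ i, α i) : (∫⋯∫⁻_s, (fun x => ∏ i, p i (x i)) ∂ν) x
      = (∏ i ∈ s, ∫⁻ a, p i a ∂(ν i)) * ∏ i ∈ sᶜ, p i (x i) := by
    induction s using Finset.induction generalizing x with
    | empty => simp
    | insert i s hi ih =>
      have hcompl : sᶜ = insert i (insert i s)ᶜ := by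
        rw [Finset.compl_insert, Finset.insert_erase (Finset.mem_compl.2 hi)]
      have hupdate (a : α i) : ∏ j ∈ sᶜ, p j (Function.update x i a j)
          = p i a * ∏ j ∈ (insert i s)ᶜ, p j (x j) := by
        rw [hcompl, Finset.prod_insert (by simp), Function.update_self]
        congr 1
        refine Finset.prod_congr rfl fun j hj => ?_
        rw [Function.update_of_ne]
        rintro rfl
        simp at hj
      simp_rw [lmarginal_insert _ hmeas hi, ih, hupdate, Finset.prod_insert hi, ← mul_assoc]
      rw [lintegral_mul_const _ (by fun_prop), lintegral_const_mul _ (hp i),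
        mul_comm (∏ i ∈ s, _)]
  rcases isEmpty_or_nonempty (∀ i, α i) with hempty | ⟨⟨x⟩⟩
  · obtain ⟨i, hi⟩ := isEmpty_pi.1 hempty
    rw [lintegral_of_isEmpty, Finset.prod_eq_zero (Finset.mem_univ i) (lintegral_of_isEmpty _ _)]
  · rw [lintegral_eq_lmarginal_univ x, hmarginal, Finset.compl_univ, Finset.prod_empty, mul_one]

lemma pi_withDensity (hp : ∀ i, Measurable (p i)) [∀ i, SigmaFinite ((ν i).withDensity (p i))] :
    Measure.pi (fun i => (ν i).withDensity (p i))
      = (Measure.pi ν).withDensity fun x => ∏ i, p i (x i) := by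
  classical
  refine Measure.pi_eq fun s hs => ?_
  have hbox := MeasurableSet.univ_pi hs
  have hindicator (x : ∀ i, α i) : (Set.univ.pi s).indicator (fun x => ∏ i, p i (x i)) x
      = ∏ i, (s i).indicator (p i) (x i) := by
    by_cases hx : x ∈ Set.univ.pi s
    · rw [Set.indicator_of_mem hx]
      exact Finset.prod_congr rfl fun i _ => (Set.indicator_of_mem (hx i trivial) _).symm
    · obtain ⟨i, -, hi⟩ := by simpa only [Set.mem_pi, not_forall] using hx
      rw [Set.indicator_of_notMem hx,
        Finset.prod_eq_zero (Finset.mem_univ i) (Set.indicator_of_notMem hi _)]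
  rw [withDensity_apply _ hbox, ← lintegral_indicator hbox]
  simp_rw [hindicator]
  rw [lintegral_fintype_prod_eq_prod ν fun i => (hp i).indicator (hs i)]
  exact Finset.prod_congr rfl fun i _ => by
    rw [lintegral_indicator (hs i), withDensity_apply _ (hs i)]

end Pi

variable {α : Type*} [MeasurableSpace α] (ν : Measure α) {p q : α → ℝ≥0∞}

/-- The Hellinger affinity of the two laws of densities `p` and `q` with respect to `ν`, which
bounds from below the sum of the errors of any test between them. -/
noncomputable def affinity (ν : Measure α) (p q : α → ℝ≥0∞) : ℝ≥0∞ :=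
  ∫⁻ x, (p x * q x) ^ (1 / 2 : ℝ) ∂ν

lemma setLIntegral_mul_rpow_half_le (hp : Measurable p) (hq : Measurable q) {A : Set α}
    (hA : MeasurableSet A) :
    ∫⁻ x in A, (p x * q x) ^ (1 / 2 : ℝ) ∂ν
      ≤ (ν.withDensity p A) ^ (1 / 2 : ℝ) * (ν.withDensity q A) ^ (1 / 2 : ℝ) := by
  have hcs := ENNReal.lintegral_mul_le_Lp_mul_Lq (ν.restrict A) Real.HolderConjugate.two_two
    (f := fun x => p x ^ (1 / 2 : ℝ)) (g := fun x => q x ^ (1 / 2 : ℝ))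
    (hp.pow_const _).aemeasurable (hq.pow_const _).aemeasurable
  simp only [← ENNReal.rpow_mul] at hcs
  norm_num at hcs
  simp_rw [withDensity_apply _ hA, ENNReal.mul_rpow_of_nonneg _ _ (one_half_pos (α := ℝ)).le]
  norm_num
  exact hcs

section Test

variable [IsProbabilityMeasure (ν.withDensity p)] [IsProbabilityMeasure (ν.withDensity q)]

lemma affinity_le_rpow_add_rpow (hp : Measurable p) (hq : Measurable q) {A : Set α}
    (hA : MeasurableSet A) :
    affinity ν p q
      ≤ (ν.withDensity p A) ^ (1 / 2 : ℝ) + (ν.withDensity q Aᶜ) ^ (1 / 2 : ℝ) := by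
  have hle_one (μ : Measure α) [IsProbabilityMeasure μ] (B : Set α) : μ B ^ (1 / 2 : ℝ) ≤ 1 :=
    ENNReal.rpow_le_one prob_le_one (by norm_num)
  rw [affinity, ← lintegral_add_compl _ hA]
  exact add_le_add
    ((setLIntegral_mul_rpow_half_le ν hp hq hA).trans (mul_le_of_le_one_right' (hle_one _ A)))
    ((setLIntegral_mul_rpow_half_le ν hp hq hA.compl).trans
      (mul_le_of_le_one_left' (hle_one _ Aᶜ)))

lemma sq_affinity_le (hp : Measurable p) (hq : Measurable q) {A : Set α} (hA : MeasurableSet A) :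
    affinity ν p q ^ 2 ≤ 2 * (ν.withDensity p A + ν.withDensity q Aᶜ) := by
  have hsq (a b : ℝ≥0∞) : (a ^ (1 / 2 : ℝ) + b ^ (1 / 2 : ℝ)) ^ 2 ≤ 2 * (a + b) := by
    have h := ENNReal.rpow_add_le_mul_rpow_add_rpow (a ^ (1 / 2 : ℝ)) (b ^ (1 / 2 : ℝ))
      one_le_two
    simp only [← ENNReal.rpow_mul, ← ENNReal.rpow_two] at h ⊢
    norm_num at h
    simpa using h
  calc affinity ν p q ^ 2
      ≤ ((ν.withDensity p A) ^ (1 / 2 : ℝ) + (ν.withDensity q Aᶜ) ^ (1 / 2 : ℝ)) ^ 2 := by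
        gcongr
        exact affinity_le_rpow_add_rpow ν hp hq hA
    _ ≤ _ := hsq _ _

end Test

section Pi

variable {ι : Type*} [Fintype ι] {α : ι → Type*} [∀ i, MeasurableSpace (α i)]
  (ν : ∀ i, Measure (α i)) [∀ i, SigmaFinite (ν i)] {p q : ∀ i, α i → ℝ≥0∞}

lemma affinity_pi (hp : ∀ i, Measurable (p i)) (hq : ∀ i, Measurable (q i)) :
    affinity (Measure.pi ν) (fun x => ∏ i, p i (x i)) (fun x => ∏ i, q i (x i))
      = ∏ i, affinity (ν i) (p i) (q i) := by
  simp_rw [affinity, ← Finset.prod_mul_distrib,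
    ← ENNReal.prod_rpow_of_nonneg (one_half_pos (α := ℝ)).le]
  exact lintegral_fintype_prod_eq_prod ν fun i => ((hp i).mul (hq i)).pow_const _

variable {I : Finset ι} {e : ℝ}

lemma ofReal_one_sub_card_mul_le_affinity_pi (hp : ∀ i, Measurable (p i))
    (hq : ∀ i, Measurable (q i)) (he : e ≤ 1)
    (hI : ∀ i ∈ I, ENNReal.ofReal (1 - e) ≤ affinity (ν i) (p i) (q i))
    (hIc : ∀ i ∉ I, 1 ≤ affinity (ν i) (p i) (q i)) :
    ENNReal.ofReal (1 - I.card * e)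
      ≤ affinity (Measure.pi ν) (fun x => ∏ i, p i (x i)) (fun x => ∏ i, q i (x i)) := by
  classical
  have hbernoulli : 1 - I.card * e ≤ (1 - e) ^ I.card := by
    have := one_add_mul_le_pow (a := -e) (by linarith) I.card
    rw [← sub_eq_add_neg] at this
    linarith
  calc ENNReal.ofReal (1 - I.card * e)
      ≤ ENNReal.ofReal ((1 - e) ^ I.card) := ENNReal.ofReal_le_ofReal hbernoulli
    _ = ∏ i, if i ∈ I then ENNReal.ofReal (1 - e) else 1 := by
        rw [ENNReal.ofReal_pow (by linarith), Finset.prod_ite_mem, Finset.univ_inter,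
          Finset.prod_const]
    _ ≤ ∏ i, affinity (ν i) (p i) (q i) := by
        refine Finset.prod_le_prod' fun i _ => ?_
        split_ifs with hi
        exacts [hI i hi, hIc i hi]
    _ = _ := (affinity_pi ν hp hq).symm

lemma sq_one_sub_card_mul_le_measure_pi_add [∀ i, IsProbabilityMeasure ((ν i).withDensity (p i))]
    [∀ i, IsProbabilityMeasure ((ν i).withDensity (q i))] (hp : ∀ i, Measurable (p i))
    (hq : ∀ i, Measurable (q i)) (he : e ≤ 1) (hIe : I.card * e ≤ 1)
    (hI : ∀ i ∈ I, ENNReal.ofReal (1 - e) ≤ affinity (ν i) (p i) (q i))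
    (hIc : ∀ i ∉ I, 1 ≤ affinity (ν i) (p i) (q i)) {A : Set (∀ i, α i)} (hA : MeasurableSet A) :
    (1 - I.card * e) ^ 2 / 2
      ≤ (Measure.pi fun i => (ν i).withDensity (p i)).real A
        + (Measure.pi fun i => (ν i).withDensity (q i)).real Aᶜ := by
  have hprobP : IsProbabilityMeasure ((Measure.pi ν).withDensity fun x => ∏ i, p i (x i)) := by
    rw [← pi_withDensity ν hp]; infer_instance
  have hprobQ : IsProbabilityMeasure ((Measure.pi ν).withDensity fun x => ∏ i, q i (x i)) := by
    rw [← pi_withDensity ν hq]; infer_instance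
  have htest := (pow_le_pow_left' (ofReal_one_sub_card_mul_le_affinity_pi ν hp hq he hI hIc)
    2).trans (sq_affinity_le (Measure.pi ν) (by fun_prop) (by fun_prop) hA)
  have hreal := ENNReal.toReal_mono (by finiteness) htest
  rw [← ENNReal.ofReal_pow (sub_nonneg.2 hIe), ENNReal.toReal_ofReal (sq_nonneg _),
    ENNReal.toReal_mul, ENNReal.toReal_add (by finiteness) (by finiteness),
    ENNReal.toReal_ofNat] at hreal
  rw [pi_withDensity ν hp, pi_withDensity ν hq, Measure.real, Measure.real]
  linarith

end Pi

end Affinity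

section Assouad

variable {ι : Type*}

section Flip

variable [DecidableEq ι]

/-- The neighbour of the vertex `ω` of the hypercube along the edge in direction `j`. -/
def flipAt (j : ι) (ω : ι → Bool) : ι → Bool := Function.update ω j (!ω j)

lemma flipAt_involutive (j : ι) : Function.Involutive (flipAt j) := fun ω => by
  simp [flipAt]

end Flip

variable [Fintype ι] {α : Type*} [MeasurableSpace α]

lemma sum_measureReal_ne_le_of_hammingDist (μ : Measure α) [IsProbabilityMeasure μ]
    {T : α → ι → Bool} (hT : Measurable T) (ω : ι → Bool) {c : ℝ} (hc : 0 ≤ c) :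
    ∑ j, μ.real {z | T z j ≠ ω j}
      ≤ Fintype.card ι * (c + μ.real {z | c * Fintype.card ι < hammingDist (T z) ω}) := by
  have hne (j : ι) : MeasurableSet {z | T z j ≠ ω j} :=
    ((measurable_pi_apply j).comp hT) (.of_discrete (s := {b | b ≠ ω j}))
  have hdist (z : α) : (hammingDist (T z) ω : ℝ) = ∑ j, {z | T z j ≠ ω j}.indicator 1 z := by
    rw [hammingDist, Finset.card_filter]
    push_cast
    exact Finset.sum_congr rfl fun j _ => by simp [Set.indicator_apply]
  have hint (j : ι) : Integrable ({z | T z j ≠ ω j}.indicator (1 : α → ℝ)) μ :=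
    (integrable_const 1).indicator (hne j)
  set F : Set α := {z | c * Fintype.card ι < hammingDist (T z) ω} with hFdef
  have hF : MeasurableSet F := by
    simp_rw [hFdef, hdist]
    exact measurableSet_lt measurable_const
      (Finset.measurable_sum _ fun j _ => measurable_one.indicator (hne j))
  have hFint : Integrable (F.indicator (1 : α → ℝ)) μ := (integrable_const 1).indicator hF
  have hle (z : α) : (hammingDist (T z) ω : ℝ)
      ≤ Fintype.card ι * c + Fintype.card ι * F.indicator 1 z := by
    by_cases hz : z ∈ F
    · have : (hammingDist (T z) ω : ℝ) ≤ Fintype.card ι := by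
        exact_mod_cast hammingDist_le_card_fintype
      have : 0 ≤ Fintype.card ι * c := by positivity
      rw [Set.indicator_of_mem hz, Pi.one_apply]
      linarith
    · rw [Set.indicator_of_notMem hz, mul_zero, add_zero, mul_comm]
      exact not_lt.1 hz
  calc ∑ j, μ.real {z | T z j ≠ ω j}
      = ∫ z, (hammingDist (T z) ω : ℝ) ∂μ := by
        simp_rw [hdist]
        rw [integral_finsetSum _ fun j _ => hint j]
        exact Finset.sum_congr rfl fun j _ => (integral_indicator_one (hne j)).symm
    _ ≤ ∫ z, (Fintype.card ι * c + Fintype.card ι * F.indicator 1 z) ∂μ := by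
        refine integral_mono ?_ ((integrable_const _).add (hFint.const_mul _)) hle
        simp_rw [hdist]
        exact integrable_finsetSum _ fun j _ => hint j
    _ = _ := by
        rw [integral_add (integrable_const _) (hFint.const_mul _),
          integral_const_mul _ (F.indicator 1),
          integral_indicator_one hF, integral_const, probReal_univ, one_smul, mul_add]

variable [DecidableEq ι]

lemma card_mul_le_two_mul_sum_measureReal_ne (μ : (ι → Bool) → Measure α) {T : α → Bool}
    (hT : Measurable T) {ρ : ℝ} (j : ι)
    (htest : ∀ ω (A : Set α), MeasurableSet A → ρ ≤ (μ ω).real A + (μ (flipAt j ω)).real Aᶜ) :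
    Fintype.card (ι → Bool) * ρ ≤ 2 * ∑ ω, (μ ω).real {z | T z ≠ ω j} := by
  have hcompl (ω : ι → Bool) : {z | T z ≠ flipAt j ω j} = {z | T z ≠ ω j}ᶜ := by
    ext z
    simp only [flipAt, Function.update_self, Set.mem_ofPred_eq, Set.mem_compl_iff]
    cases T z <;> cases ω j <;> simp
  calc Fintype.card (ι → Bool) * ρ = ∑ _ω : ι → Bool, ρ := by
        rw [Finset.sum_const, nsmul_eq_mul]; rfl
    _ ≤ ∑ ω, ((μ ω).real {z | T z ≠ ω j}
          + (μ (flipAt j ω)).real {z | T z ≠ flipAt j ω j}) := by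
        refine Finset.sum_le_sum fun ω _ => ?_
        rw [hcompl]
        exact htest ω _ (hT (.of_discrete (s := {b | b ≠ ω j})))
    _ = 2 * ∑ ω, (μ ω).real {z | T z ≠ ω j} := by
        rw [Finset.sum_add_distrib, two_mul]
        congr 1
        exact Equiv.sum_comp (flipAt_involutive j).toPerm fun ω => (μ ω).real {z | T z ≠ ω j}

lemma assouad [Nonempty ι] (μ : (ι → Bool) → Measure α) [∀ ω, IsProbabilityMeasure (μ ω)]
    {T : α → ι → Bool} (hT : Measurable T) {ρ c a : ℝ} (hc : 0 ≤ c)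
    (htest : ∀ ω j (A : Set α), MeasurableSet A → ρ ≤ (μ ω).real A + (μ (flipAt j ω)).real Aᶜ)
    (hfail : ∀ ω, (μ ω).real {z | c * Fintype.card ι < hammingDist (T z) ω} ≤ a) :
    ρ / 2 ≤ c + a := by
  have hpos : (0 : ℝ) < Fintype.card ι * Fintype.card (ι → Bool) := by positivity
  have hsum : Fintype.card ι * (Fintype.card (ι → Bool) * ρ)
      ≤ 2 * (Fintype.card (ι → Bool) * (Fintype.card ι * (c + a))) :=
    calc Fintype.card ι * (Fintype.card (ι → Bool) * ρ)
        = ∑ _j : ι, Fintype.card (ι → Bool) * ρ := by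
          rw [Finset.sum_const, nsmul_eq_mul, Finset.card_univ]
      _ ≤ ∑ j, 2 * ∑ ω, (μ ω).real {z | T z j ≠ ω j} := Finset.sum_le_sum fun j _ =>
          card_mul_le_two_mul_sum_measureReal_ne μ ((measurable_pi_apply j).comp hT) j
            fun ω => htest ω j
      _ = 2 * ∑ ω, ∑ j, (μ ω).real {z | T z j ≠ ω j} := by
          rw [← Finset.mul_sum, Finset.sum_comm]
      _ ≤ 2 * ∑ _ω : ι → Bool, Fintype.card ι * (c + a) := by
          gcongr with ω
          refine (sum_measureReal_ne_le_of_hammingDist (μ ω) hT ω hc).trans ?_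
          have := hfail ω
          gcongr
      _ = _ := by rw [Finset.sum_const, nsmul_eq_mul]; rfl
  refine le_of_mul_le_mul_left ?_ hpos
  linarith

end Assouad

section Cube

variable {ι : Type*} {E F : Type*} [NormedAddCommGroup E] [InnerProductSpace ℝ E]
  [NormedAddCommGroup F] [InnerProductSpace ℝ F] {u : ι → E} {δ : ℝ}

/-- The signs of the coordinates of `x` along `u`, which decode a vertex of the cube. -/
noncomputable def signPattern (u : ι → E) (x : E) (j : ι) : Bool :=
  decide (0 < (inner ℝ (u j) x : ℝ))

lemma measurable_signPattern [MeasurableSpace E] [OpensMeasurableSpace E] (u : ι → E) :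
    Measurable (signPattern u) := by
  refine measurable_pi_lambda _ fun j => measurable_to_bool ?_
  simpa [Set.preimage, signPattern] using
    measurableSet_lt measurable_const
      (Continuous.inner continuous_const continuous_id).measurable

variable [Fintype ι]

/-- The vertices `∑ ± δ • u j` of the parallelotope with edges `2 δ • u j`, which are the
hypotheses of the lower bound. -/
def cubeVertex (u : ι → E) (δ : ℝ) (ω : ι → Bool) : E := ∑ j, (if ω j then δ else -δ) • u j

lemma map_cubeVertex (L : E →L[ℝ] F) (u : ι → E) (δ : ℝ) (ω : ι → Bool) :
    L (cubeVertex u δ ω) = cubeVertex (fun j => L (u j)) δ ω := by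
  simp only [cubeVertex, map_sum, map_smul]

lemma inner_cubeVertex (hu : Orthonormal ℝ u) (δ : ℝ) (ω : ι → Bool) (j : ι) :
    (inner ℝ (u j) (cubeVertex u δ ω) : ℝ) = if ω j then δ else -δ :=
  hu.inner_right_fintype _ j

lemma norm_cubeVertex_sub_flipAt_sq [DecidableEq ι] (u : ι → E) (δ : ℝ) (ω : ι → Bool) (j : ι) :
    ‖cubeVertex u δ ω - cubeVertex u δ (flipAt j ω)‖ ^ 2 = 4 * δ ^ 2 * ‖u j‖ ^ 2 := by
  have hsub : cubeVertex u δ ω - cubeVertex u δ (flipAt j ω)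
      = (if ω j then 2 * δ else -(2 * δ)) • u j := by
    rw [cubeVertex, cubeVertex, ← Finset.sum_sub_distrib, Finset.sum_eq_single j]
    · rw [← sub_smul]
      congr 1
      cases h : ω j <;> simp [flipAt, h] <;> ring
    · intro i _ hij
      simp [flipAt, hij]
    · simp
  rw [hsub, norm_smul, mul_pow, Real.norm_eq_abs, sq_abs]
  split_ifs <;> ring

lemma abs_inner_cubeVertex_le (u : ι → E) (hδ : 0 ≤ δ) (ω : ι → Bool) (x : E) :
    |(inner ℝ x (cubeVertex u δ ω) : ℝ)| ≤ δ * ∑ j, |(inner ℝ x (u j) : ℝ)| := by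
  have habs (j : ι) : |if ω j then δ else -δ| = δ := by
    split_ifs <;> simp [abs_of_nonneg hδ]
  rw [cubeVertex, inner_sum, Finset.mul_sum]
  refine (Finset.abs_sum_le_sum_abs _ _).trans_eq (Finset.sum_congr rfl fun j _ => ?_)
  rw [real_inner_smul_right, abs_mul, habs]

lemma sq_mul_hammingDist_le_norm_sub_cubeVertex_sq (hu : Orthonormal ℝ u) (hδ : 0 ≤ δ)
    (ω : ι → Bool) (x : E) :
    δ ^ 2 * hammingDist (signPattern u x) ω ≤ ‖x - cubeVertex u δ ω‖ ^ 2 := by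
  have hcoord (j : ι) (hj : signPattern u x j ≠ ω j) :
      δ ^ 2 ≤ ‖(inner ℝ (u j) (x - cubeVertex u δ ω) : ℝ)‖ ^ 2 := by
    rw [inner_sub_right, inner_cubeVertex hu, Real.norm_eq_abs, sq_abs]
    cases hω : ω j
    · have : 0 < (inner ℝ (u j) x : ℝ) := by simpa [signPattern, hω] using hj
      simp only [Bool.false_eq_true, if_false]
      nlinarith
    · have : (inner ℝ (u j) x : ℝ) ≤ 0 := by simpa [signPattern, hω] using hj
      simp only [if_true]
      nlinarith
  calc δ ^ 2 * hammingDist (signPattern u x) ω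
      = ∑ j with signPattern u x j ≠ ω j, δ ^ 2 := by
        rw [Finset.sum_const, nsmul_eq_mul, mul_comm, hammingDist]
    _ ≤ ∑ j with signPattern u x j ≠ ω j, ‖(inner ℝ (u j) (x - cubeVertex u δ ω) : ℝ)‖ ^ 2 :=
        Finset.sum_le_sum fun j hj => hcoord j (Finset.mem_filter.1 hj).2
    _ ≤ ‖x - cubeVertex u δ ω‖ ^ 2 := hu.sum_inner_products_le _

end Cube

section GaussianMoments

lemma integrable_sq_gaussianReal (v : ℝ≥0) : Integrable (fun x : ℝ => x ^ 2) (gaussianReal 0 v) :=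
  (memLp_id_gaussianReal 2).integrable_sq

lemma integral_sq_gaussianReal (v : ℝ≥0) : ∫ x, x ^ 2 ∂(gaussianReal 0 v) = v := by
  have hvar := variance_id_gaussianReal (μ := 0) (v := v)
  rw [variance_eq_integral aemeasurable_id] at hvar
  simpa using hvar

lemma lintegral_abs_gaussianReal_le (s : ℝ≥0) :
    ∫⁻ x, ENNReal.ofReal |x| ∂(gaussianReal 0 (s ^ 2)) ≤ s := by
  have hmem : MemLp (fun x : ℝ => |x|) 2 (gaussianReal 0 (s ^ 2)) := (memLp_id_gaussianReal 2).abs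
  have hvar := variance_nonneg (fun x : ℝ => |x|) (gaussianReal 0 (s ^ 2))
  rw [variance_eq_sub hmem] at hvar
  simp only [Pi.pow_apply, sq_abs, integral_sq_gaussianReal] at hvar
  rw [← ofReal_integral_eq_lintegral_ofReal (hmem.integrable one_le_two)
    (.of_forall fun x => abs_nonneg x)]
  refine ENNReal.ofReal_le_of_le_toReal (abs_le_of_sq_le_sq' ?_ s.2).2
  push_cast at hvar
  exact sub_nonneg.1 hvar

lemma ofReal_one_sub_div_le_lintegral_exp_neg_sq_div (v : ℝ≥0) {c : ℝ} (hc : 0 ≤ c) :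
    ENNReal.ofReal (1 - v / c)
      ≤ ∫⁻ r, ENNReal.ofReal (Real.exp (-r ^ 2 / c)) ∂(gaussianReal 0 v) := by
  have hexp : Integrable (fun r : ℝ => Real.exp (-r ^ 2 / c)) (gaussianReal 0 v) := by
    refine .of_bound (by fun_prop) 1 (.of_forall fun r => ?_)
    rw [Real.norm_eq_abs, Real.abs_exp, Real.exp_le_one_iff, neg_div, neg_nonpos]
    positivity
  have hsq := (integrable_sq_gaussianReal v).div_const c
  rw [← ofReal_integral_eq_lintegral_ofReal hexp (.of_forall fun r => (Real.exp_pos _).le)]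
  refine ENNReal.ofReal_le_ofReal ?_
  calc 1 - v / c = ∫ r, (1 - r ^ 2 / c) ∂(gaussianReal 0 v) := by
        rw [integral_sub (integrable_const _) hsq, integral_div, integral_sq_gaussianReal]
        simp
    _ ≤ _ := by
        refine integral_mono ((integrable_const _).sub hsq) hexp fun r => ?_
        have := Real.add_one_le_exp (-r ^ 2 / c)
        rw [neg_div] at this ⊢
        simp only
        linarith

end GaussianMoments

section GaussianAffinity

variable {v : ℝ≥0}

lemma gaussianPDFReal_mul_gaussianPDFReal (v : ℝ≥0) (a b y : ℝ) :
    gaussianPDFReal a v y * gaussianPDFReal b v y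
      = (Real.exp (-(a - b) ^ 2 / (8 * v)) * gaussianPDFReal ((a + b) / 2) v y) ^ 2 := by
  simp only [gaussianPDFReal]
  rw [mul_mul_mul_comm, ← Real.exp_add, mul_left_comm, ← Real.exp_add, mul_pow, ← sq,
    ← Real.exp_nat_mul]
  congr 2
  push_cast
  field_simp
  ring

lemma affinity_gaussianPDF (hv : v ≠ 0) (a b : ℝ) :
    affinity volume (gaussianPDF a v) (gaussianPDF b v)
      = ENNReal.ofReal (Real.exp (-(a - b) ^ 2 / (8 * v))) := by
  have hsqrt (y : ℝ) : (gaussianPDF a v y * gaussianPDF b v y) ^ (1 / 2 : ℝ)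
      = ENNReal.ofReal (Real.exp (-(a - b) ^ 2 / (8 * v))) * gaussianPDF ((a + b) / 2) v y := by
    have hnonneg := gaussianPDFReal_nonneg ((a + b) / 2) v y
    rw [gaussianPDF, gaussianPDF, gaussianPDF, ← ENNReal.ofReal_mul (gaussianPDFReal_nonneg _ _ _),
      gaussianPDFReal_mul_gaussianPDFReal, ← ENNReal.ofReal_mul (Real.exp_pos _).le,
      ENNReal.ofReal_rpow_of_nonneg (sq_nonneg _) (by norm_num), ← Real.sqrt_eq_rpow,
      Real.sqrt_sq (by positivity)]
  simp_rw [affinity, hsqrt]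
  rw [lintegral_const_mul _ (measurable_gaussianPDF _ _), lintegral_gaussianPDF_eq_one _ hv,
    mul_one]

end GaussianAffinity

section RegressionDensity

variable {d : ℕ} {σ : ℝ≥0}

/-- The common reference measure of the clean laws of covariance `S`. -/
noncomputable def refMeasure (S : Matrix (Fin d) (Fin d) ℝ) : Measure (Obs d) :=
  (multivariateGaussian 0 S).prod volume

instance (S : Matrix (Fin d) (Fin d) ℝ) : SigmaFinite (refMeasure S) := by
  unfold refMeasure; infer_instance

/-- The density of the clean law with respect to `refMeasure S`. -/
noncomputable def cleanDensity (σ : ℝ≥0) (β : EuclideanSpace ℝ (Fin d)) (z : Obs d) : ℝ≥0∞ :=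
  gaussianPDF (inner ℝ z.1 β) (σ ^ 2) z.2

@[fun_prop]
lemma measurable_cleanDensity (σ : ℝ≥0) (β : EuclideanSpace ℝ (Fin d)) :
    Measurable (cleanDensity σ β) := by
  unfold cleanDensity
  exact measurable_uncurry_gaussianPDF.comp
    (f := fun z : Obs d => ((inner ℝ z.1 β : ℝ), σ ^ 2, z.2)) (by fun_prop)

lemma cleanLaw_eq_withDensity (S : Matrix (Fin d) (Fin d) ℝ) (hσ : 0 < σ)
    (β : EuclideanSpace ℝ (Fin d)) :
    cleanLaw S σ β = (refMeasure S).withDensity (cleanDensity σ β) := by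
  ext s hs
  rw [cleanLaw, Measure.compProd_apply hs, withDensity_apply _ hs, ← lintegral_indicator hs,
    refMeasure, lintegral_prod _ ((measurable_cleanDensity σ β).indicator hs).aemeasurable]
  refine lintegral_congr fun x => ?_
  change gaussianReal _ _ _ = _
  rw [gaussianReal_apply _ (by positivity), ← lintegral_indicator (measurable_prodMk_left hs)]
  rfl

lemma multivariateGaussian_map_inner (S : Matrix (Fin d) (Fin d) ℝ)
    (v : EuclideanSpace ℝ (Fin d)) :
    (multivariateGaussian 0 S).map (fun x => inner ℝ x v)
      = gaussianReal 0 (‖sqrtCov S v‖₊ ^ 2) := by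
  rw [multivariateGaussian_zero_eq_map_sqrtCov, Measure.map_map (by fun_prop) (by fun_prop),
    ← stdGaussian_map_inner]
  congr 1
  ext g
  rw [Function.comp_apply, inner_sqrtCov_left, real_inner_comm]

lemma affinity_cleanDensity (S : Matrix (Fin d) (Fin d) ℝ) (hσ : 0 < σ)
    (β β' : EuclideanSpace ℝ (Fin d)) :
    affinity (refMeasure S) (cleanDensity σ β) (cleanDensity σ β')
      = ∫⁻ r, ENNReal.ofReal (Real.exp (-r ^ 2 / (8 * σ ^ 2)))
          ∂(gaussianReal 0 (‖sqrtCov S (β - β')‖₊ ^ 2)) := by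
  have hmeas : Measurable fun z => (cleanDensity σ β z * cleanDensity σ β' z) ^ (1 / 2 : ℝ) := by
    fun_prop
  have hfiber (x : EuclideanSpace ℝ (Fin d)) :
      ∫⁻ y, (cleanDensity σ β (x, y) * cleanDensity σ β' (x, y)) ^ (1 / 2 : ℝ)
        = ENNReal.ofReal (Real.exp (-(inner ℝ x (β - β') : ℝ) ^ 2 / (8 * σ ^ 2))) := by
    rw [inner_sub_right, ← NNReal.coe_pow]
    exact affinity_gaussianPDF (v := σ ^ 2) (by positivity) (inner ℝ x β) (inner ℝ x β')
  rw [affinity, refMeasure, lintegral_prod _ hmeas.aemeasurable, ← multivariateGaussian_map_inner,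
    lintegral_map (by fun_prop) (by fun_prop)]
  exact lintegral_congr hfiber

lemma le_affinity_cleanDensity (S : Matrix (Fin d) (Fin d) ℝ) (hσ : 0 < σ)
    (β β' : EuclideanSpace ℝ (Fin d)) :
    ENNReal.ofReal (1 - ‖sqrtCov S (β - β')‖ ^ 2 / (8 * σ ^ 2))
      ≤ affinity (refMeasure S) (cleanDensity σ β) (cleanDensity σ β') := by
  rw [affinity_cleanDensity S hσ, ← coe_nnnorm, ← NNReal.coe_pow]
  exact ofReal_one_sub_div_le_lintegral_exp_neg_sq_div _ (by positivity)

lemma sq_one_sub_card_mul_le_measure_pi_cleanLaw_add {ι : Type*} [Fintype ι] [DecidableEq ι]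
    (I : Finset ι) (S : Matrix (Fin d) (Fin d) ℝ) (hσ : 0 < σ) (Q : Measure (Obs d))
    [IsProbabilityMeasure Q] {β β' : EuclideanSpace ℝ (Fin d)} {e : ℝ}
    (hβ : ‖sqrtCov S (β - β')‖ ^ 2 / (8 * σ ^ 2) ≤ e) (he : e ≤ 1) (hIe : I.card * e ≤ 1)
    {A : Set (ι → Obs d)} (hA : MeasurableSet A) :
    (1 - I.card * e) ^ 2 / 2
      ≤ (Measure.pi fun i => if i ∈ I then cleanLaw S σ β else Q).real A
        + (Measure.pi fun i => if i ∈ I then cleanLaw S σ β' else Q).real Aᶜ := by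
  set ν : ι → Measure (Obs d) := fun i => if i ∈ I then refMeasure S else Q with hν
  set p : EuclideanSpace ℝ (Fin d) → ι → Obs d → ℝ≥0∞ := fun b i =>
    if i ∈ I then cleanDensity σ b else 1 with hp
  have hsigma (i : ι) : SigmaFinite (ν i) := by
    by_cases hi : i ∈ I <;> simp only [hν, hi, if_true, if_false] <;> infer_instance
  have hmeas (b : EuclideanSpace ℝ (Fin d)) (i : ι) : Measurable (p b i) := by
    by_cases hi : i ∈ I <;> simp only [hp, hi, if_true, if_false] <;> fun_prop
  have hlaw (b : EuclideanSpace ℝ (Fin d)) (i : ι) :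
      (if i ∈ I then cleanLaw S σ b else Q) = (ν i).withDensity (p b i) := by
    by_cases hi : i ∈ I <;> simp only [hν, hp, hi, if_true, if_false]
    exacts [cleanLaw_eq_withDensity S hσ b, withDensity_one.symm]
  have hprob (b : EuclideanSpace ℝ (Fin d)) (i : ι) :
      IsProbabilityMeasure ((ν i).withDensity (p b i)) := by
    rw [← hlaw]; split_ifs <;> infer_instance
  simp_rw [hlaw]
  refine sq_one_sub_card_mul_le_measure_pi_add ν (hmeas β) (hmeas β') he hIe (fun i hi => ?_)
    (fun i hi => ?_) hA <;> simp only [hν, hp, hi, if_true, if_false]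
  · exact (ENNReal.ofReal_le_ofReal (by linarith)).trans (le_affinity_cleanDensity S hσ β β')
  · simp [affinity]

end RegressionDensity

section Envelope

variable {v : ℝ≥0} {a : ℝ}

/-- The supremum of the Gaussian densities of variance `v` and mean in `[-a, a]`. -/
noncomputable def envelope (v : ℝ≥0) (a y : ℝ) : ℝ≥0∞ := gaussianPDF 0 v (max (|y| - a) 0)

lemma measurable_envelope (v : ℝ≥0) : Measurable fun z : ℝ × ℝ => envelope v z.1 z.2 :=
  (measurable_gaussianPDF 0 v).comp (f := fun z : ℝ × ℝ => max (|z.2| - z.1) 0) (by fun_prop)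

lemma gaussianPDF_le_envelope (v : ℝ≥0) {m : ℝ} (hm : |m| ≤ a) (y : ℝ) :
    gaussianPDF m v y ≤ envelope v a y := by
  refine ENNReal.ofReal_le_ofReal ?_
  simp only [gaussianPDFReal, sub_zero]
  have hdist : max (|y| - a) 0 ≤ |y - m| :=
    max_le (by linarith [abs_sub_abs_le_abs_sub y m]) (abs_nonneg _)
  have hsq : max (|y| - a) 0 ^ 2 ≤ (y - m) ^ 2 :=
    sq_le_sq.2 (by rwa [abs_of_nonneg (le_max_right _ _)])
  gcongr

lemma envelope_le_add (v : ℝ≥0) (ha : 0 ≤ a) (y : ℝ) :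
    envelope v a y ≤ (Set.Icc (-a) a).indicator (fun _ => gaussianPDF 0 v 0) y
      + ((Set.Ioi 0).indicator (gaussianPDF 0 v) (y - a)
        + (Set.Iio 0).indicator (gaussianPDF 0 v) (y + a)) := by
  rcases le_or_gt |y| a with hy | hy
  · rw [envelope, max_eq_right (by linarith),
      Set.indicator_of_mem (show y ∈ Set.Icc (-a) a from abs_le.1 hy)]
    exact le_self_add
  rw [envelope, max_eq_left (by linarith)]
  refine le_add_left ?_
  rcases lt_abs.1 hy with hy' | hy'
  · rw [abs_of_pos (by linarith), Set.indicator_of_mem (show y - a ∈ Set.Ioi 0 from sub_pos.2 hy')]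
    exact le_self_add
  · rw [abs_of_neg (by linarith), ← neg_add',
      Set.indicator_of_mem (show y + a ∈ Set.Iio 0 by simp only [Set.mem_Iio]; linarith)]
    refine le_add_left (le_of_eq ?_)
    simp only [gaussianPDF, gaussianPDFReal, sub_zero, neg_sq]

lemma lintegral_envelope_le_one_add (hv : v ≠ 0) (ha : 0 ≤ a) :
    ∫⁻ y, envelope v a y ≤ 1 + gaussianPDF 0 v 0 * ENNReal.ofReal (2 * a) := by
  set up := (Set.Ioi 0).indicator (gaussianPDF 0 v)
  set down := (Set.Iio 0).indicator (gaussianPDF 0 v)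
  have hup : Measurable up := (measurable_gaussianPDF 0 v).indicator measurableSet_Ioi
  have hup_shift : Measurable fun y => up (y - a) := hup.comp (measurable_sub_const a)
  have htails (y : ℝ) : up y + down y ≤ gaussianPDF 0 v y := by
    rcases lt_trichotomy y 0 with hy | hy | hy <;> simp [up, down, hy, hy.le]
  calc ∫⁻ y, envelope v a y ≤ _ := lintegral_mono (envelope_le_add v ha)
    _ = gaussianPDF 0 v 0 * ENNReal.ofReal (2 * a)
        + ∫⁻ y, (up y + down y) := by
        rw [lintegral_add_left (measurable_const.indicator measurableSet_Icc),
          lintegral_add_left hup_shift, lintegral_add_left hup,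
          lintegral_sub_right_eq_self up a, lintegral_add_right_eq_self down a,
          lintegral_indicator_const measurableSet_Icc, Real.volume_Icc, sub_neg_eq_add, two_mul]
    _ ≤ gaussianPDF 0 v 0 * ENNReal.ofReal (2 * a) + ∫⁻ y, gaussianPDF 0 v y := by
        gcongr with y
        exact htails y
    _ = _ := by rw [lintegral_gaussianPDF_eq_one 0 hv, add_comm]

lemma lintegral_envelope_le {σ : ℝ≥0} (hσ : 0 < σ) (ha : 0 ≤ a) :
    ∫⁻ y, envelope (σ ^ 2) a y ≤ 1 + ENNReal.ofReal (a / σ) := by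
  have hpeak : gaussianPDFReal 0 (σ ^ 2) 0 ≤ (2 * σ : ℝ)⁻¹ := by
    have hsqrt : 2 * (σ : ℝ) ≤ √(2 * Real.pi * σ ^ 2) :=
      Real.le_sqrt_of_sq_le (by nlinarith [Real.pi_gt_three, sq_nonneg (σ : ℝ)])
    simpa [gaussianPDFReal] using inv_anti₀ (by positivity) hsqrt
  refine (lintegral_envelope_le_one_add (by positivity) ha).trans ?_
  gcongr
  rw [gaussianPDF, ← ENNReal.ofReal_mul (gaussianPDFReal_nonneg _ _ _)]
  refine ENNReal.ofReal_le_ofReal ?_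
  calc gaussianPDFReal 0 (σ ^ 2) 0 * (2 * a) ≤ (2 * σ : ℝ)⁻¹ * (2 * a) := by gcongr
    _ = a / σ := by field_simp

end Envelope

section DominatingLaw

variable {d : ℕ} {σ : ℝ≥0} {a : EuclideanSpace ℝ (Fin d) → ℝ}

/-- Covariates `N(0, S)` with response density the envelope of half-width `a x` at `x`: a
finite measure dominating every clean law whose regression function is bounded by `a`. -/
noncomputable def envelopeMeasure (S : Matrix (Fin d) (Fin d) ℝ) (σ : ℝ≥0)
    (a : EuclideanSpace ℝ (Fin d) → ℝ) : Measure (Obs d) :=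
  (refMeasure S).withDensity fun z => envelope (σ ^ 2) (a z.1) z.2

lemma cleanLaw_le_envelopeMeasure (S : Matrix (Fin d) (Fin d) ℝ) (hσ : 0 < σ)
    {β : EuclideanSpace ℝ (Fin d)} (hβ : ∀ x, |(inner ℝ x β : ℝ)| ≤ a x) :
    cleanLaw S σ β ≤ envelopeMeasure S σ a := by
  rw [cleanLaw_eq_withDensity S hσ]
  exact withDensity_mono (.of_forall fun z => gaussianPDF_le_envelope _ (hβ z.1) _)

lemma envelopeMeasure_univ_le {S : Matrix (Fin d) (Fin d) ℝ} (hσ : 0 < σ) (ham : Measurable a)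
    (ha : ∀ x, 0 ≤ a x) :
    envelopeMeasure S σ a Set.univ
      ≤ 1 + ∫⁻ x, ENNReal.ofReal (a x / σ) ∂(multivariateGaussian 0 S) := by
  have hmeas : Measurable fun z : Obs d => envelope (σ ^ 2) (a z.1) z.2 :=
    (measurable_envelope (σ ^ 2)).comp (f := fun z : Obs d => (a z.1, z.2)) (by fun_prop)
  rw [envelopeMeasure, withDensity_apply _ .univ, Measure.restrict_univ, refMeasure,
    lintegral_prod _ hmeas.aemeasurable]
  calc _ ≤ ∫⁻ x, (1 + ENNReal.ofReal (a x / σ)) ∂(multivariateGaussian 0 S) :=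
        lintegral_mono fun x => lintegral_envelope_le hσ (ha x)
    _ = _ := by rw [lintegral_add_left measurable_const]; simp

lemma exists_isProbabilityMeasure_smul_cleanLaw_le (S : Matrix (Fin d) (Fin d) ℝ) (hσ : 0 < σ)
    {t : ℝ} (ht : 0 ≤ t) (ham : Measurable a) (ha : ∀ x, 0 ≤ a x)
    (hat : ∫⁻ x, ENNReal.ofReal (a x / σ) ∂(multivariateGaussian 0 S) ≤ ENNReal.ofReal t) :
    ∃ Q : Measure (Obs d), IsProbabilityMeasure Q ∧
      ∀ β : EuclideanSpace ℝ (Fin d), (∀ x, |(inner ℝ x β : ℝ)| ≤ a x) →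
        ENNReal.ofReal (1 - t) • cleanLaw S σ β ≤ Q := by
  set m := envelopeMeasure S σ a Set.univ with hm
  have hm_ge : 1 ≤ m := by
    simpa using cleanLaw_le_envelopeMeasure S hσ (β := 0) (by simpa using ha) Set.univ
  have hm_le : m ≤ ENNReal.ofReal (1 + t) :=
    calc m ≤ 1 + ENNReal.ofReal t := (envelopeMeasure_univ_le hσ ham ha).trans (by gcongr)
      _ = _ := by rw [ENNReal.ofReal_add zero_le_one ht, ENNReal.ofReal_one]
  have hinv : ENNReal.ofReal (1 - t) ≤ m⁻¹ := by
    rw [ENNReal.le_inv_iff_mul_le]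
    calc ENNReal.ofReal (1 - t) * m ≤ ENNReal.ofReal (1 - t) * ENNReal.ofReal (1 + t) := by gcongr
      _ = ENNReal.ofReal ((1 - t) * (1 + t)) := (ENNReal.ofReal_mul' (by linarith)).symm
      _ ≤ 1 := ENNReal.ofReal_le_one.2 (by nlinarith [sq_nonneg t])
  refine ⟨m⁻¹ • envelopeMeasure S σ a, ⟨?_⟩, fun β hβ => ?_⟩
  · rw [Measure.smul_apply, smul_eq_mul, ← hm, ENNReal.inv_mul_cancel
      (zero_lt_one.trans_le hm_ge).ne' (hm_le.trans_lt ENNReal.ofReal_lt_top).ne]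
  · intro s
    simp only [Measure.smul_apply, smul_eq_mul]
    exact mul_le_mul' hinv (cleanLaw_le_envelopeMeasure S hσ hβ s)

end DominatingLaw

section CubeHypotheses

variable {d n : ℕ} {ι : Type*} [Fintype ι] {S : Matrix (Fin d) (Fin d) ℝ} {σ : ℝ≥0} {δ : ℝ}
  {w : ι → EuclideanSpace ℝ (Fin d)}

lemma lintegral_abs_inner_multivariateGaussian_le (S : Matrix (Fin d) (Fin d) ℝ)
    (v : EuclideanSpace ℝ (Fin d)) :
    ∫⁻ x, ENNReal.ofReal |(inner ℝ x v : ℝ)| ∂(multivariateGaussian 0 S) ≤ ‖sqrtCov S v‖₊ := by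
  have habs := lintegral_abs_gaussianReal_le ‖sqrtCov S v‖₊
  rwa [← multivariateGaussian_map_inner, lintegral_map (by fun_prop) (by fun_prop)] at habs

lemma lintegral_mul_sum_abs_inner_div_le (hw : Orthonormal ℝ fun j => sqrtCov S (w j)) (hδ : 0 ≤ δ)
    (σ : ℝ≥0) :
    ∫⁻ x, ENNReal.ofReal ((δ * ∑ j, |(inner ℝ x (w j) : ℝ)|) / σ) ∂(multivariateGaussian 0 S)
      ≤ ENNReal.ofReal (δ * Fintype.card ι / σ) := by
  have hsum (x : EuclideanSpace ℝ (Fin d)) :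
      ENNReal.ofReal ((δ * ∑ j, |(inner ℝ x (w j) : ℝ)|) / σ)
        = ENNReal.ofReal (δ / σ) * ∑ j, ENNReal.ofReal |(inner ℝ x (w j) : ℝ)| := by
    rw [mul_div_right_comm, ENNReal.ofReal_mul (by positivity),
      ENNReal.ofReal_sum_of_nonneg fun j _ => abs_nonneg _]
  have hone (j : ι) :
      ∫⁻ x, ENNReal.ofReal |(inner ℝ x (w j) : ℝ)| ∂(multivariateGaussian 0 S) ≤ 1 := by
    have hnorm : ‖sqrtCov S (w j)‖₊ = 1 := NNReal.eq (hw.1 j)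
    simpa only [hnorm, ENNReal.coe_one] using lintegral_abs_inner_multivariateGaussian_le S (w j)
  simp_rw [hsum]
  rw [lintegral_const_mul _ (by fun_prop), lintegral_finsetSum _ fun j _ => by fun_prop,
    mul_div_right_comm, ENNReal.ofReal_mul (by positivity), ENNReal.ofReal_natCast]
  gcongr
  simpa using Finset.sum_le_sum fun j (_ : j ∈ Finset.univ) => hone j

-- The adversary makes every observation of corruption rate above `t` uninformative.
lemma exists_contaminatedLaw_cubeVertex_eq_pi (lam : Fin n → unitInterval) (t : unitInterval)
    (hσ : 0 < σ) (hw : Orthonormal ℝ fun j => sqrtCov S (w j)) (hδ : 0 ≤ δ)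
    (hδt : δ * Fintype.card ι / σ ≤ t) :
    ∃ Q : Measure (Obs d), IsProbabilityMeasure Q ∧ ∀ ω, ∃ κ : Adversary (Obs d) n,
      contaminatedLaw lam (cleanLaw S σ (cubeVertex w δ ω)) κ = Measure.pi fun i =>
        if i ∈ lowRate lam t then cleanLaw S σ (cubeVertex w δ ω) else Q := by
  obtain ⟨Q, hQprob, hQ⟩ := exists_isProbabilityMeasure_smul_cleanLaw_le S hσ t.2.1
    (a := fun x => δ * ∑ j, |(inner ℝ x (w j) : ℝ)|) (by fun_prop) (fun x => by positivity)
    ((lintegral_mul_sum_abs_inner_div_le hw hδ σ).trans (ENNReal.ofReal_le_ofReal hδt))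
  refine ⟨Q, hQprob, fun ω => ?_⟩
  have hprob (i : Fin n) : IsProbabilityMeasure
      (if i ∈ lowRate lam t then cleanLaw S σ (cubeVertex w δ ω) else Q) := by
    split_ifs <;> infer_instance
  refine exists_contaminatedLaw_eq_pi fun i => ?_
  split_ifs with hi
  · calc ENNReal.ofReal (1 - lam i) • cleanLaw S σ (cubeVertex w δ ω)
        ≤ (1 : ℝ≥0∞) • cleanLaw S σ (cubeVertex w δ ω) := by
          gcongr
          exact ENNReal.ofReal_le_one.2 (sub_le_self _ (lam i).2.1)
      _ = _ := one_smul _ _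
  · have hti : (t : ℝ) ≤ lam i := by
      simpa [lowRate] using (not_le.1 (by simpa [lowRate] using hi)).le
    calc ENNReal.ofReal (1 - lam i) • cleanLaw S σ (cubeVertex w δ ω)
        ≤ ENNReal.ofReal (1 - t) • cleanLaw S σ (cubeVertex w δ ω) := by gcongr
      _ ≤ Q := hQ _ (abs_inner_cubeVertex_le w hδ ω)

lemma lt_ofReal_sqError_cubeVertex (hS : S.PosDef)
    (hw : Orthonormal ℝ fun j => sqrtCov S (w j)) (hδ : 0 < δ) {ω : ι → Bool}
    {b : EuclideanSpace ℝ (Fin d)} {c : ℝ} {r : ℝ≥0∞}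
    (hr : r ≤ ENNReal.ofReal (δ ^ 2 * (c * Fintype.card ι))) (hc : 0 ≤ c)
    (hb : c * Fintype.card ι
      < hammingDist (signPattern (fun j => sqrtCov S (w j)) (sqrtCov S b)) ω) :
    r < ENNReal.ofReal (sqError S b (cubeVertex w δ ω)) := by
  have hdist := sq_mul_hammingDist_le_norm_sub_cubeVertex_sq hw hδ.le ω (sqrtCov S b)
  rw [← map_cubeVertex, ← map_sub, ← sqError_eq_norm_sq hS] at hdist
  have hlt : δ ^ 2 * (c * Fintype.card ι) < sqError S b (cubeVertex w δ ω) :=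
    (by gcongr : _ < δ ^ 2 * _).trans_le hdist
  exact hr.trans_lt ((ENNReal.ofReal_lt_ofReal_iff (hlt.trans_le' (by positivity))).2 hlt)

theorem ofReal_le_worstFailure [Nonempty ι] {lam : Fin n → unitInterval}
    {t : unitInterval} (hS : S.PosDef) (hσ : 0 < σ)
    (hw : Orthonormal ℝ fun j => sqrtCov S (w j)) (hδ : 0 < δ)
    (hδt : δ * Fintype.card ι / σ ≤ t) (hδσ : δ ^ 2 / (2 * σ ^ 2) ≤ 1)
    (hN : countLE lam t * (δ ^ 2 / (2 * σ ^ 2)) ≤ 1 / 28)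
    {M : Dataset d n → EuclideanSpace ℝ (Fin d)} (hM : Measurable M) {r : ℝ≥0∞}
    (hr : r ≤ ENNReal.ofReal (δ ^ 2 * (1 / 100 * Fintype.card ι))) :
    ENNReal.ofReal (21 / 100) ≤ worstFailure lam S σ M r := by
  classical
  by_contra! hfail
  obtain ⟨Q, hQprob, hQ⟩ := exists_contaminatedLaw_cubeVertex_eq_pi lam t hσ hw hδ.le hδt
  choose κ hκ using hQ
  have htest (ω : ι → Bool) (j : ι) (A : Set (Dataset d n)) (hA : MeasurableSet A) :
      (27 / 28 : ℝ) ^ 2 / 2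
        ≤ (contaminatedLaw lam (cleanLaw S σ (cubeVertex w δ ω)) (κ ω)).real A
          + (contaminatedLaw lam (cleanLaw S σ (cubeVertex w δ (flipAt j ω)))
            (κ (flipAt j ω))).real Aᶜ := by
    rw [hκ, hκ]
    rw [← card_lowRate] at hN
    have hsep : ‖sqrtCov S (cubeVertex w δ ω - cubeVertex w δ (flipAt j ω))‖ ^ 2 / (8 * σ ^ 2)
        = δ ^ 2 / (2 * σ ^ 2) := by
      rw [map_sub, map_cubeVertex, map_cubeVertex, norm_cubeVertex_sub_flipAt_sq, hw.1 j]
      field_simp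
      norm_num
    refine le_trans ?_ (sq_one_sub_card_mul_le_measure_pi_cleanLaw_add _ S hσ Q hsep.le hδσ
      (hN.trans (by norm_num)) hA)
    gcongr
    linarith
  have hmeas : Measurable fun z => signPattern (fun j => sqrtCov S (w j)) (sqrtCov S (M z)) :=
    (measurable_signPattern _).comp ((sqrtCov S).continuous.measurable.comp hM)
  have hassouad := assouad _ hmeas (c := 1 / 100) (a := 21 / 100) (by norm_num) htest fun ω =>
    ENNReal.toReal_le_of_le_ofReal (by norm_num) <| (measure_mono fun z hz =>
      lt_ofReal_sqError_cubeVertex hS hw hδ hr (by norm_num) hz).trans <|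
      (le_iSup₂ (f := fun β κ => contaminatedLaw lam (cleanLaw S σ β) κ
        {z | r < ENNReal.ofReal (sqError S (M z) β)}) _ (κ ω)).trans hfail.le
  norm_num at hassouad

end CubeHypotheses

section Rate

variable {d n : ℕ} {lam : Fin n → unitInterval} {S : Matrix (Fin d) (Fin d) ℝ} {σ : ℝ≥0} {f : ℝ}

lemma exists_nat_le_sq_le_two_mul_sqrt (hd : 1 ≤ d) :
    ∃ k : ℕ, 1 ≤ k ∧ k ≤ d ∧ d ≤ k ^ 2 ∧ (k : ℝ) ≤ 2 * √d := by
  have hone : 1 ≤ √(d : ℝ) := Real.one_le_sqrt.2 (by exact_mod_cast hd)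
  refine ⟨⌈√(d : ℝ)⌉₊, Nat.one_le_ceil_iff.2 (by linarith), Nat.ceil_le.2 (Real.sqrt_le_iff.2
    ⟨Nat.cast_nonneg d, by exact_mod_cast Nat.le_self_pow two_ne_zero d⟩), ?_, ?_⟩
  · exact_mod_cast (Real.sqrt_le_left (Nat.cast_nonneg _)).1 (Nat.le_ceil √(d : ℝ))
  · linarith [Nat.ceil_lt_add_one (Real.sqrt_nonneg (d : ℝ))]

lemma exists_orthonormal_sqrtCov (hS : S.PosDef) {k : ℕ} (hk : k ≤ d) :
    ∃ w : Fin k → EuclideanSpace ℝ (Fin d), Orthonormal ℝ fun j => sqrtCov S (w j) := by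
  refine ⟨fun j => (sqrtCovEquiv hS).symm (EuclideanSpace.basisFun (Fin d) ℝ (Fin.castLE hk j)), ?_⟩
  simp only [← sqrtCovEquiv_apply hS, ContinuousLinearEquiv.apply_symm_apply]
  exact (EuclideanSpace.basisFun (Fin d) ℝ).orthonormal.comp _ (Fin.castLE_injective hk)

lemma countLE_mul_le (hf : effectiveError lam d = ENNReal.ofReal f) (t : unitInterval) :
    countLE lam t * (f - (t : ℝ) ^ 2) ≤ d := by
  rcases Nat.eq_zero_or_pos (countLE lam t) with hN | hN
  · simp [hN]
  have hle : ENNReal.ofReal f ≤ thresholdError lam d t := hf ▸ iInf_le _ t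
  rw [thresholdError_eq_ofReal hN, ENNReal.ofReal_le_ofReal_iff (by positivity)] at hle
  rw [← le_div_iff₀' (by exact_mod_cast hN)]
  linarith

theorem ofReal_div_sqrt_le_minimaxPACRate (hd : 1 ≤ d) (hS : S.PosDef) (hσ : 0 < σ) (hf : 0 < f)
    (hf1 : f ≤ 1) (hfe : effectiveError lam d = ENNReal.ofReal f) :
    ENNReal.ofReal (σ ^ 2 * f / (3000 * √d)) ≤ minimaxPACRate lam S σ (1 / 5) := by
  obtain ⟨k, hk0, hkd, hdk, hk⟩ := exists_nat_le_sq_le_two_mul_sqrt hd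
  have : Nonempty (Fin k) := ⟨0, hk0⟩
  obtain ⟨w, hw⟩ := exists_orthonormal_sqrtCov hS hkd
  have hτ_sq : √(f / 15) ^ 2 = f / 15 := Real.sq_sqrt (by positivity)
  let t : unitInterval := ⟨√(f / 15), Real.sqrt_nonneg _, Real.sqrt_le_one.2 (by linarith)⟩
  have hδσ : (σ * √(f / 15) / k) ^ 2 / (2 * σ ^ 2) = f / (30 * k ^ 2) := by
    rw [div_pow, mul_pow, hτ_sq]
    field_simp
    norm_num
  refine le_sInf fun r hr => ?_
  by_contra! hlt
  have hfail (M : {M : Dataset d n → EuclideanSpace ℝ (Fin d) // Measurable M}) :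
      ENNReal.ofReal (21 / 100) ≤ worstFailure lam S σ M.1 r := by
    refine ofReal_le_worstFailure (t := t) (δ := σ * √(f / 15) / k) hS hσ hw (by positivity)
      ?_ ?_ ?_ M.2 (hlt.le.trans (ENNReal.ofReal_le_ofReal ?_))
    · rw [Fintype.card_fin]
      change _ ≤ √(f / 15)
      exact le_of_eq (by field_simp)
    · rw [hδσ, div_le_one (by positivity)]
      nlinarith [show (1 : ℝ) ≤ k by exact_mod_cast hk0]
    · have hcount := countLE_mul_le hfe t
      rw [hδσ, mul_div_assoc', div_le_iff₀ (by positivity)]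
      change _ * (f - √(f / 15) ^ 2) ≤ _ at hcount
      rw [hτ_sq] at hcount
      linarith [show (d : ℝ) ≤ k ^ 2 by exact_mod_cast hdk]
    · rw [Fintype.card_fin, div_pow, mul_pow, hτ_sq, div_le_iff₀ (by positivity)]
      calc (σ : ℝ) ^ 2 * f = σ ^ 2 * f * (k / k) := by rw [div_self (by positivity), mul_one]
        _ ≤ σ ^ 2 * f * (2 * √d / k) := by gcongr
        _ = _ := by field_simp; norm_num
  have hlevel : (1 / 5 : ℝ≥0∞) < ENNReal.ofReal (21 / 100) := by
    rw [ENNReal.lt_ofReal_iff_toReal_lt (by simp)]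
    norm_num
  exact hlevel.not_ge ((le_iInf hfail).trans hr)

end Rate

section Rates

variable {d n : ℕ} {lam : Fin n → unitInterval} {S : Matrix (Fin d) (Fin d) ℝ} {σ : ℝ≥0}
  {t : unitInterval}

lemma thresholdWeight_nonneg (lam : Fin n → unitInterval) (t : unitInterval) (i : Fin n) :
    0 ≤ thresholdWeight lam t i := by
  unfold thresholdWeight
  split_ifs <;> positivity

lemma exists_effectiveError_eq_ofReal (hd : 1 ≤ d) (ht : IsOptimalThreshold lam d t) {c : ℝ≥0}
    (hc : effectiveError lam d ≤ c) :
    ∃ f : ℝ, 0 < countLE lam t ∧ f = d / countLE lam t + (t : ℝ) ^ 2 ∧ 0 < f ∧ f ≤ c ∧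
      effectiveError lam d = ENNReal.ofReal f := by
  have heq := effectiveError_eq_thresholdError ht
  have hN : 0 < countLE lam t := by
    by_contra! hN
    exact (heq ▸ hc.trans_lt ENNReal.coe_lt_top).ne
      (thresholdError_eq_top hd (Nat.le_zero.1 hN))
  rw [thresholdError_eq_ofReal hN] at heq
  refine ⟨_, hN, rfl, ?_, ?_, heq⟩
  · have : (0 : ℝ) < d := by exact_mod_cast hd
    positivity
  · rw [heq, ← ENNReal.ofReal_coe_nnreal] at hc
    exact (ENNReal.ofReal_le_ofReal_iff c.2).1 hc

theorem worstFailure_tukey_le_of_isOptimalThreshold (hd : 1 ≤ d) (hS : S.PosDef) (hσ : 0 < σ)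
    (hc : effectiveError lam d ≤ (1 / 1660000 ^ 2 : ℝ≥0)) (ht : IsOptimalThreshold lam d t)
    {M : Dataset d n → EuclideanSpace ℝ (Fin d)}
    (hM : IsTukeyRegression (thresholdWeight lam t) M) :
    worstFailure lam S σ M (((1660000 ^ 2 * σ ^ 2 : ℝ≥0) : ℝ≥0∞) * effectiveError lam d)
      ≤ 1 / 5 := by
  obtain ⟨f, hN, hf, -, hfc, he⟩ := exists_effectiveError_eq_ofReal hd ht hc
  rw [he, ← ENNReal.ofReal_coe_nnreal, ← ENNReal.ofReal_mul (NNReal.coe_nonneg _)]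
  exact worstFailure_tukey_le hd hS hσ hN hf (by push_cast at hfc; linarith) hM

theorem minimaxPACRate_le (hd : 1 ≤ d) (hS : S.PosDef) (hσ : 0 < σ)
    (hc : effectiveError lam d ≤ (1 / 1660000 ^ 2 : ℝ≥0)) :
    minimaxPACRate lam S σ (1 / 5)
      ≤ ((1660000 ^ 2 * σ ^ 2 : ℝ≥0) : ℝ≥0∞) * effectiveError lam d := by
  obtain ⟨t, ht⟩ := exists_isOptimalThreshold hd lam
  obtain ⟨M, hM_meas, hM⟩ := exists_measurable_isTukeyRegression hd (thresholdWeight_nonneg lam t)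
  refine sInf_le ?_
  rw [Set.mem_ofPred_eq]
  exact iInf_le_of_le ⟨M, hM_meas⟩
    (worstFailure_tukey_le_of_isOptimalThreshold hd hS hσ hc ht hM)

theorem le_minimaxPACRate (hd : 1 ≤ d) (hS : S.PosDef) (hσ : 0 < σ)
    (hc : effectiveError lam d ≤ 1) :
    ((1 / 3000 * (σ ^ 2 / NNReal.sqrt (d : ℝ≥0)) : ℝ≥0) : ℝ≥0∞) * effectiveError lam d
      ≤ minimaxPACRate lam S σ (1 / 5) := by
  obtain ⟨t, ht⟩ := exists_isOptimalThreshold hd lam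
  obtain ⟨f, -, -, hf0, hf1, he⟩ := exists_effectiveError_eq_ofReal (c := 1) hd ht hc
  refine le_of_eq_of_le ?_ (ofReal_div_sqrt_le_minimaxPACRate hd hS hσ hf0 hf1 he)
  rw [he, ← ENNReal.ofReal_coe_nnreal, ← ENNReal.ofReal_mul (NNReal.coe_nonneg _)]
  congr 1
  push_cast
  field_simp

end Rates

end HeterogeneousRegression

theorem theorem3 :
    ∃ c C₁ C₂ : ℝ≥0, 0 < c ∧ 0 < C₁ ∧ 0 < C₂ ∧
      ∀ (d n : ℕ), 1 ≤ d →
      ∀ (lam : Fin n → unitInterval) (S : Matrix (Fin d) (Fin d) ℝ) (σ : ℝ≥0), S.PosDef → 0 < σ →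
      effectiveError lam d ≤ (c : ℝ≥0∞) →
        ((C₁ * (σ ^ 2 / NNReal.sqrt (d : ℝ≥0)) : ℝ≥0) : ℝ≥0∞) * effectiveError lam d
            ≤ minimaxPACRate lam S σ (1 / 5) ∧
        minimaxPACRate lam S σ (1 / 5)
            ≤ ((C₂ * σ ^ 2 : ℝ≥0) : ℝ≥0∞) * effectiveError lam d ∧
        (∃ t : unitInterval, IsOptimalThreshold lam d t) ∧
        ∀ t : unitInterval, IsOptimalThreshold lam d t →
          (∃ M : Dataset d n → EuclideanSpace ℝ (Fin d),
            Measurable M ∧ IsTukeyRegression (thresholdWeight lam t) M) ∧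
          ∀ M : Dataset d n → EuclideanSpace ℝ (Fin d),
            IsTukeyRegression (thresholdWeight lam t) M →
              worstFailure lam S σ M (((C₂ * σ ^ 2 : ℝ≥0) : ℝ≥0∞) * effectiveError lam d)
                ≤ 1 / 5 := by
  refine ⟨1 / 1660000 ^ 2, 1 / 3000, 1660000 ^ 2, by positivity, by positivity, by positivity, ?_⟩
  intro d n hd lam S σ hS hσ hc
  have hc_le_one : effectiveError lam d ≤ 1 :=
    hc.trans (ENNReal.coe_le_one_iff.2 (div_le_one_of_le₀ (by norm_num) (by positivity)))
  refine ⟨le_minimaxPACRate hd hS hσ hc_le_one, minimaxPACRate_le hd hS hσ hc,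
    exists_isOptimalThreshold hd lam, fun t ht => ⟨?_, fun M hM => ?_⟩⟩
  · exact exists_measurable_isTukeyRegression hd (thresholdWeight_nonneg lam t)
  · exact worstFailure_tukey_le_of_isOptimalThreshold hd hS hσ hc ht hM
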